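/- All matroids have a finite ground set. For sets $X$, $Y$ write $X-Y$ for the difference, and $X-e+f$ for $(X-\{e\})\cup\{f\}$. Let $(A_1,A_2)$ and $(B_1,B_2)$ be ordered pairs of bases of a rank-$r$ matroid $M$ that are compatible, that is, $A_1\cap A_2=B_1\cap B_2$ and $A_1\cup A_2=B_1\cup B_2$. A symmetric exchange replaces an ordered pair of bases $(X_1,X_2)$ by $(X_1-e+f,\;X_2+e-f)$, where $e\in X_1-X_2$ and $f\in X_2-X_1$ are such that both new sets are bases. A sequence of symmetric exchanges starting from $(A_1,A_2)$ is strictly monotone (for $(A_1,A_2)$ and $(B_1,B_2)$) if each step decreases $|X_1-B_1|$, where $X_1$ is the first member of the current pair. **Theorem.** There exists a strictly monotone sequence of symmetric exchanges for $(A_1,A_2)$ and $(B_1,B_2)$ of length (a) $r-3|A_1\cap B_1|$, if $M$ is a split matroid, (b) $r-2|A_1\cap B_1|$, if $M$ is a base orderable split matroid, (c) $r-|A_1\cap B_1|-2$, if $M$ is a paving matroid, where a negative number is read as $0$. Here $M$ is *paving* if every set of size at most $r-1$ is independent. $M$ is *base orderable* if for any two bases $A,B$ there is a bijection $\varphi\colon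 A\to B$ such that $A-e+\varphi(e)$ and $B-\varphi(e)+e$ are bases for every $e\in A$. *Split* matroids are those of Joswig and Schröter: let $S$ be the ground set, $r_M$ the rank function and $P$ the convex hull in $\mathbb R^S$ of the incidence vectors of the bases of $M$, let $L$ be the affine hull of $P$, and put $Q=L\cap[0,1]^S$. A split flacet is a flat $F$ such that $\{x\in P: \sum_{e\in F}x_e=r_M(F)\}$ is a facet of $P$ and the hyperplane $h_F=\{x\in L:\sum_{e\in F}x_e=r_M(F)\}$ defines a split of $Q$, i.e. it cuts $Q$ into two full-dimensional cells without creating new vertices. $M$ is split if for any two split flacets $F,G$ either $h_F=h_G$ or $h_F\cap h_G$ is disjoint from the relative interior of $Q$. -/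

import Mathlib

namespace Matroid

variable {α : Type*}

/-- The base polytope `P(M)`: the convex hull of the incidence vectors of the bases of `M`. -/
def basePolytope (M : Matroid α) : Set (α → ℝ) :=
  convexHull ℝ {x | ∃ B, M.IsBase B ∧ x = B.indicator 1}

/-- The intersection of the unit cube with the affine hull of the base polytope.
For a connected matroid this is a hypersimplex. -/
def ambientPolytope (M : Matroid α) : Set (α → ℝ) :=
  (affineSpan ℝ M.basePolytope : Set (α → ℝ)) ∩ Set.Icc 0 1

/-- The linear functional `x ↦ x(F) = ∑ e ∈ F, x e`. -/
def coordSum (F : Finset α) : (α → ℝ) →ₗ[ℝ] ℝ :=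
  ∑ e ∈ F, LinearMap.proj e

/-- The rank of a subset of a finite matroid, as a natural number. -/
noncomputable def natRk (M : Matroid α) (F : Finset α) : ℕ :=
  (M.eRk (F : Set α)).toNat

/-- The hyperplane `{f = c}` defines a split of the polytope `Q`: it cuts `Q` into two
full-dimensional cells (it meets the relative interior of `Q` and does not contain `Q`), and
this subdivision has no new vertices. -/
def DefinesSplit {V : Type*} [AddCommGroup V] [Module ℝ V] [TopologicalSpace V]
    (Q : Set V) (f : V →ₗ[ℝ] ℝ) (c : ℝ) : Prop :=
  (∃ x ∈ intrinsicInterior ℝ Q, f x = c) ∧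
  (∃ x ∈ Q, f x ≠ c) ∧
  ({x ∈ Q | f x ≤ c}).extremePoints ℝ ⊆ Q.extremePoints ℝ ∧
  ({x ∈ Q | c ≤ f x}).extremePoints ℝ ⊆ Q.extremePoints ℝ

/-- A flacet: a flat `F` for which the inequality `x(F) ≤ r(F)`, valid on the base polytope,
defines a facet of it, that is, a nonempty face of codimension one. -/
def IsFlacet (M : Matroid α) (F : Finset α) : Prop :=
  M.IsFlat (F : Set α) ∧
  ({x ∈ M.basePolytope | coordSum F x = M.natRk F}).Nonempty ∧
  Module.finrank ℝ (vectorSpan ℝ {x ∈ M.basePolytope | coordSum F x = M.natRk F}) + 1 =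
    Module.finrank ℝ (vectorSpan ℝ M.basePolytope)

/-- A split flacet: a flacet whose hyperplane `x(F) = r(F)` defines a split of the
intersection of the unit cube with the affine hull of the base polytope. -/
def IsSplitFlacet (M : Matroid α) (F : Finset α) : Prop :=
  M.IsFlacet F ∧ DefinesSplit M.ambientPolytope (coordSum F) (M.natRk F)

/-- The split hyperplane of a split flacet, inside the affine hull of the base polytope. -/
def splitHyperplane (M : Matroid α) (F : Finset α) : Set (α → ℝ) :=
  {x ∈ (affineSpan ℝ M.basePolytope : Set (α → ℝ)) | coordSum F x = M.natRk F}

/-- Split matroids (Joswig and Schröter): the split flacets form a compatible system of splits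
of the affine hull of the base polytope intersected with the unit cube. Two splits are compatible
if they are equal or their hyperplanes do not meet in the relative interior. -/
def IsSplit (M : Matroid α) : Prop :=
  ∀ F G : Finset α, M.IsSplitFlacet F → M.IsSplitFlacet G →
    M.splitHyperplane F ≠ M.splitHyperplane G →
    Disjoint (M.splitHyperplane F ∩ M.splitHyperplane G) (intrinsicInterior ℝ M.ambientPolytope)

/-- Paving matroids: every set of size less than the rank is independent. -/
def IsPaving (M : Matroid α) : Prop :=
  ∀ X : Set α, X ⊆ M.E → X.encard < M.eRank → M.Indep X

/-- Base orderable matroids: any two bases `A`, `B` admit a bijection `φ : A → B` such that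
`A - e + φ(e)` and `B - φ(e) + e` are bases for every `e ∈ A`. -/
def IsBaseOrderable (M : Matroid α) : Prop :=
  ∀ A B : Set α, M.IsBase A → M.IsBase B → ∃ φ : A ≃ B, ∀ e : A,
    M.IsBase (insert (φ e : α) (A \ {(e : α)})) ∧ M.IsBase (insert (e : α) (B \ {(φ e : α)}))

/-- `Y` is obtained from the ordered pair of bases `X` by a symmetric exchange. -/
def SymmExchange (M : Matroid α) (X Y : Set α × Set α) : Prop :=
  M.IsBase X.1 ∧ M.IsBase X.2 ∧ ∃ e ∈ X.1 \ X.2, ∃ f ∈ X.2 \ X.1,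
    Y.1 = insert f (X.1 \ {e}) ∧ Y.2 = insert e (X.2 \ {f}) ∧ M.IsBase Y.1 ∧ M.IsBase Y.2

/-- There is a sequence of exactly `n` symmetric exchanges starting from the pair `A`, such that
each of them decreases the difference of the first member from the first member of `B`. -/
def HasStrictlyMonotoneSeq (M : Matroid α) (A B : Set α × Set α) (n : ℕ) : Prop :=
  ∃ X : ℕ → Set α × Set α, X 0 = A ∧ ∀ i < n,
    M.SymmExchange (X i) (X (i + 1)) ∧ ((X (i + 1)).1 \ B.1).ncard < ((X i).1 \ B.1).ncard

/-- Compatible basis pairs: ordered pairs of bases with the same union and intersection. -/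
def CompatiblePairs (M : Matroid α) (A B : Set α × Set α) : Prop :=
  M.IsBase A.1 ∧ M.IsBase A.2 ∧ M.IsBase B.1 ∧ M.IsBase B.2 ∧
  A.1 ∩ A.2 = B.1 ∩ B.2 ∧ A.1 ∪ A.2 = B.1 ∪ B.2

end Matroid

/-! Write `P = X₁ \ B₁` and `Q = X₂ \ B₂` for the elements still to be moved. Strictly monotone
exchanges swap some `e ∈ P` with some `f ∈ Q`, so a run that reaches the target has length `|P|`.

For (a) and (b), the polyhedral definition of split matroids is first turned into combinatorics,
`SplitSystem`: there is a set `C`, a connected component or empty, such that exchanges inside other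
components always succeed, while an exchange inside `C` fails at a base only because of a tight
hyperedge `H` with `f ∈ H` and `e ∉ H`. Distinct hyperedges satisfy `|H ∩ K| + ρ ≤ b H + b K`. Hence
an element outside a base lies in at most one tight hyperedge, and an element of the base in `C` is
missed by at most one.

This makes a stuck pair rigid: hyperedges `H₁, H₂` tight for `X₁` and `K₁, K₂` tight for `X₂` cut `P
∪ Q` into four classes between which nothing can be exchanged, and the numbers of elements of `P`
and `Q` in a class differ by `t > 0`. `Doomed` records this structure for pairs that need not be
stuck yet. Three facts finish the count. A pair that is not doomed and not at the target has an
exchange to a pair that is not doomed (`ExchangePair.exists_exchange`), so it reaches the target. A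
doomed pair can be exchanged until exactly `2 * t` elements of `P` remain
(`Doomed.exists_exchange`). Finally `t` is at most the number of common elements of `X₁` and `B₁` in
`C` (`Doomed.le_card_inter`), and in the base orderable case even `2 * t` is
(`Doomed.two_mul_le_card_inter`).

The hyperedges come from the exchange graph of a base `X`. If `e` and `f` cannot be exchanged, the
elements not reachable from `e` after deleting `f` and its neighbours form a flat `F`
(`exists_exchangeCut`). It is a split flacet (`ExchangeCut.isSplitFlacet`), and compatibility of the
splits puts all these flats into one component (`ExchangeCut.sameClass_of_isSplit`) and bounds their
intersections (`ExchangeCut.card_inter_add_le`).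

For (c), in a paving matroid each `f` is blocked at a base by at most one `e`, and a pigeonhole
argument gives an exchange whenever `|P| ≥ 3`. -/

namespace Matroid

variable {α : Type*} [DecidableEq α] {M : Matroid α}

/-! ### Split systems, exchange pairs and doomed pairs. -/

/-- A system of hyperedges `H ⊆ C` with bounds `b H`, any two of which are far apart, such that
the exchanges inside `C` that fail at a base are those blocked by a hyperedge that is tight for
this base. -/
structure SplitSystem (M : Matroid α) (C : Finset α) (ρ : ℕ) (𝓗 : Set (Finset α))
    (b : Finset α → ℕ) : Prop where
  card_inter : ∀ X : Finset α, M.IsBase X → (X ∩ C).card = ρ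
  subset : ∀ H ∈ 𝓗, H ⊆ C
  card_le : ∀ X : Finset α, M.IsBase X → ∀ H ∈ 𝓗, (X ∩ H).card ≤ b H
  card_inter_add_le : ∀ H ∈ 𝓗, ∀ K ∈ 𝓗, H ≠ K → (H ∩ K).card + ρ ≤ b H + b K
  exists_tight : ∀ X : Finset α, M.IsBase X → ∀ e ∈ X, e ∈ C → ∀ f ∈ C, f ∉ X →
    ¬ M.IsBase (insert f (X.erase e) : Finset α) →
    ∃ H ∈ 𝓗, (X ∩ H).card = b H ∧ f ∈ H ∧ e ∉ H

/-- A hyperedge is tight for `X` if its bound is attained by `X`. -/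
def IsTight (𝓗 : Set (Finset α)) (b : Finset α → ℕ) (X H : Finset α) : Prop :=
  H ∈ 𝓗 ∧ (X ∩ H).card = b H

section Finset

variable {S H K X B : Finset α} {e f : α}

lemma card_inter_add_card_inter_of_pure (h : ∀ a ∈ S, (a ∈ H ↔ a ∉ K)) :
    (S ∩ H).card + (S ∩ K).card = S.card := by
  rw [← Finset.card_union_of_disjoint]
  · congr 1; ext a; have := h a; simp only [Finset.mem_union, Finset.mem_inter]; tauto
  · rw [Finset.disjoint_left]; intro a; have := h a; simp only [Finset.mem_inter]; tauto

lemma card_inter_add_card_sdiff_inter (X B S : Finset α) :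
    (B ∩ S).card + ((X \ B) ∩ S).card = (X ∩ S).card + ((B \ X) ∩ S).card := by
  have h1 : (B ∩ S).card = (X ∩ B ∩ S).card + ((B \ X) ∩ S).card := by
    rw [← Finset.card_union_of_disjoint]
    · congr 1; ext a; simp only [Finset.mem_union, Finset.mem_inter, Finset.mem_sdiff]; tauto
    · rw [Finset.disjoint_left]; intro a; simp only [Finset.mem_inter, Finset.mem_sdiff]; tauto
  have h2 : (X ∩ S).card = (X ∩ B ∩ S).card + ((X \ B) ∩ S).card := by
    rw [← Finset.card_union_of_disjoint]
    · congr 1; ext a; simp only [Finset.mem_union, Finset.mem_inter, Finset.mem_sdiff]; tauto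
    · rw [Finset.disjoint_left]; intro a; simp only [Finset.mem_inter, Finset.mem_sdiff]; tauto
  omega

lemma card_inter_eq_sdiff_add (X B S : Finset α) :
    (X ∩ S).card = ((X \ B) ∩ S).card + (X ∩ B ∩ S).card := by
  rw [← Finset.card_union_of_disjoint]
  · congr 1; ext a; simp only [Finset.mem_union, Finset.mem_inter, Finset.mem_sdiff]; tauto
  · rw [Finset.disjoint_left]; intro a; simp only [Finset.mem_inter, Finset.mem_sdiff]; tauto

/-- The effect of an exchange on the size of the intersection with a set. -/
lemma card_exchange_inter (he : e ∈ X) (hf : f ∉ X) (S : Finset α) :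
    (insert f (X.erase e) ∩ S).card + (if e ∈ S then 1 else 0) =
      (X ∩ S).card + (if f ∈ S then 1 else 0) := by
  have h1 : ((X.erase e) ∩ S).card + (if e ∈ S then 1 else 0) = (X ∩ S).card := by
    split_ifs with h
    · rw [Finset.erase_inter]
      exact Finset.card_erase_add_one (Finset.mem_inter.2 ⟨he, h⟩)
    · rw [Finset.erase_inter, Finset.erase_eq_of_notMem]; · rfl
      simp [h]
  split_ifs with h2 h3 h3
  · rw [Finset.insert_inter_of_mem h3, Finset.card_insert_of_notMem (by simp [hf])]
    rw [if_pos h2] at h1; omega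
  · rw [Finset.insert_inter_of_notMem h3]
    rw [if_pos h2] at h1; omega
  · rw [Finset.insert_inter_of_mem h3, Finset.card_insert_of_notMem (by simp [hf])]
    rw [if_neg h2] at h1; omega
  · rw [Finset.insert_inter_of_notMem h3]
    rw [if_neg h2] at h1; omega

lemma card_erase_inter_eq_iff {P Q : Finset α} {t : ℕ} (he : e ∈ P) (hf : f ∈ Q)
    (hH : e ∈ H ↔ f ∈ H) (hK : e ∈ K ↔ f ∈ K) :
    (Q.erase f ∩ H ∩ K).card = (P.erase e ∩ H ∩ K).card + t ↔
      (Q ∩ H ∩ K).card = (P ∩ H ∩ K).card + t := by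
  simp only [Finset.erase_inter]
  by_cases hm : e ∈ H ∧ e ∈ K
  · have c1 := Finset.card_erase_add_one
      (Finset.mem_inter.2 ⟨Finset.mem_inter.2 ⟨he, hm.1⟩, hm.2⟩)
    have c2 := Finset.card_erase_add_one
      (Finset.mem_inter.2 ⟨Finset.mem_inter.2 ⟨hf, hH.1 hm.1⟩, hK.1 hm.2⟩)
    omega
  · rw [Finset.erase_eq_of_notMem (a := e), Finset.erase_eq_of_notMem (a := f)]
    · simp only [Finset.mem_inter, ← hH, ← hK]; tauto
    · simp only [Finset.mem_inter]; tauto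

end Finset

section System

variable {C X X₁ X₂ B₁ B₂ H K : Finset α} {ρ : ℕ} {𝓗 : Set (Finset α)} {b : Finset α → ℕ} {e f : α}

/-- Inclusion-exclusion inside `X ∩ C`, which has `ρ` elements, gives `|X ∩ H ∩ K| ≥ b H + b K - ρ ≥
|H ∩ K|`, so equality holds throughout. The two uniqueness lemmas below are how this is used
everywhere. -/
lemma SplitSystem.inter_subset_and_subset_union (hS : SplitSystem M C ρ 𝓗 b) (hX : M.IsBase X)
    (hH : IsTight 𝓗 b X H) (hK : IsTight 𝓗 b X K) (hne : H ≠ K) :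
    H ∩ K ⊆ X ∧ X ∩ C ⊆ H ∪ K := by
  have h1 := Finset.card_union_add_card_inter (X ∩ H) (X ∩ K)
  have h2 := hS.card_inter_add_le H hH.1 K hK.1 hne
  have h3 := hS.card_inter X hX
  have s1 : X ∩ H ∪ X ∩ K ⊆ X ∩ C := by
    have := hS.subset H hH.1; have := hS.subset K hK.1
    grind
  have s2 : (X ∩ H) ∩ (X ∩ K) ⊆ H ∩ K := by grind
  have c1 := Finset.card_le_card s1
  have c2 := Finset.card_le_card s2
  rw [hH.2, hK.2] at h1
  have e1 := Finset.eq_of_subset_of_card_le s1 (by omega)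
  have e2 := Finset.eq_of_subset_of_card_le s2 (by omega)
  constructor
  · rw [← e2]; grind
  · rw [← e1]; grind

lemma SplitSystem.eq_of_mem_of_mem (hS : SplitSystem M C ρ 𝓗 b) (hX : M.IsBase X)
    (hH : IsTight 𝓗 b X H) (hK : IsTight 𝓗 b X K) (hf : f ∉ X) (h1 : f ∈ H) (h2 : f ∈ K) :
    H = K := by
  by_contra hne
  exact hf ((hS.inter_subset_and_subset_union hX hH hK hne).1 (Finset.mem_inter.2 ⟨h1, h2⟩))

lemma SplitSystem.eq_of_notMem_of_notMem (hS : SplitSystem M C ρ 𝓗 b) (hX : M.IsBase X)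
    (hH : IsTight 𝓗 b X H) (hK : IsTight 𝓗 b X K) (he : e ∈ X) (heC : e ∈ C) (h1 : e ∉ H)
    (h2 : e ∉ K) : H = K := by
  by_contra hne
  have := (hS.inter_subset_and_subset_union hX hH hK hne).2 (Finset.mem_inter.2 ⟨he, heC⟩)
  simp [h1, h2] at this

/-- A tight hyperedge containing `f` but not `e` blocks the exchange of `e` and `f`. -/
lemma SplitSystem.mem_of_isBase (hS : SplitSystem M C ρ 𝓗 b) (hH : IsTight 𝓗 b X H) (he : e ∈ X)
    (hf : f ∉ X) (h : M.IsBase (insert f (X.erase e) : Finset α)) (hfH : f ∈ H) : e ∈ H := by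
  by_contra heH
  have h1 := hS.card_le _ h H hH.1
  have h2 := card_exchange_inter he hf H
  rw [if_neg heH, if_pos hfH, hH.2] at h2
  omega

lemma IsTight.exchange (hH : IsTight 𝓗 b X H) (he : e ∈ X) (hf : f ∉ X) (h : e ∈ H ↔ f ∈ H) :
    IsTight 𝓗 b (insert f (X.erase e)) H := by
  refine ⟨hH.1, ?_⟩
  have h2 := card_exchange_inter he hf H
  rw [hH.2] at h2
  by_cases h3 : e ∈ H
  · rw [if_pos h3, if_pos (h.1 h3)] at h2; omega
  · rw [if_neg h3, if_neg (fun h4 => h3 (h.2 h4))] at h2; omega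

/-- A pair of bases `(X₁, X₂)` that differs from the compatible target pair `(B₁, B₂)` only
inside `C`. -/
structure ExchangePair (M : Matroid α) (C X₁ X₂ B₁ B₂ : Finset α) : Prop where
  base₁ : M.IsBase X₁
  base₂ : M.IsBase X₂
  target₁ : M.IsBase B₁
  target₂ : M.IsBase B₂
  sdiff₁ : X₁ \ B₁ = B₂ \ X₂
  sdiff₂ : X₂ \ B₂ = B₁ \ X₁
  subset₁ : X₁ \ B₁ ⊆ C
  subset₂ : X₂ \ B₂ ⊆ C

namespace ExchangePair

lemma symm (h : ExchangePair M C X₁ X₂ B₁ B₂) : ExchangePair M C X₂ X₁ B₂ B₁ :=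
  ⟨h.base₂, h.base₁, h.target₂, h.target₁, h.sdiff₂, h.sdiff₁, h.subset₂, h.subset₁⟩

lemma mem_left (h : ExchangePair M C X₁ X₂ B₁ B₂) (he : e ∈ X₁ \ B₁) :
    e ∈ X₁ ∧ e ∉ B₁ ∧ e ∉ X₂ ∧ e ∈ B₂ ∧ e ∈ C := by
  have h1 := h.subset₁ he
  have h2 := he
  rw [h.sdiff₁] at h2
  simp only [Finset.mem_sdiff] at he h2
  tauto

lemma exchange_sdiff (h : ExchangePair M C X₁ X₂ B₁ B₂) (he : e ∈ X₁ \ B₁) (hf : f ∈ X₂ \ B₂) :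
    insert f (X₁.erase e) \ B₁ = (X₁ \ B₁).erase e := by
  have h3 := h.mem_left he
  have h4 := h.symm.mem_left hf
  grind

lemma exchange (h : ExchangePair M C X₁ X₂ B₁ B₂) (he : e ∈ X₁ \ B₁) (hf : f ∈ X₂ \ B₂)
    (h1 : M.IsBase (insert f (X₁.erase e) : Finset α))
    (h2 : M.IsBase (insert e (X₂.erase f) : Finset α)) :
    ExchangePair M C (insert f (X₁.erase e)) (insert e (X₂.erase f)) B₁ B₂ := by
  have e1 := h.exchange_sdiff he hf
  have e2 := h.symm.exchange_sdiff hf he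
  refine ⟨h1, h2, h.target₁, h.target₂, ?_, ?_, ?_, ?_⟩
  · rw [e1, h.sdiff₁, Finset.sdiff_insert]
    congr 1
    ext a
    have := h.symm.mem_left hf
    simp only [Finset.mem_sdiff, Finset.mem_erase]
    grind
  · rw [e2, h.sdiff₂, Finset.sdiff_insert]
    congr 1
    ext a
    have := h.mem_left he
    simp only [Finset.mem_sdiff, Finset.mem_erase]
    grind
  · rw [e1]; exact (Finset.erase_subset _ _).trans h.subset₁
  · rw [e2]; exact (Finset.erase_subset _ _).trans h.subset₂

lemma card_sdiff_add (hS : SplitSystem M C ρ 𝓗 b) (h : ExchangePair M C X₁ X₂ B₁ B₂) :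
    (X₁ \ B₁).card + (X₁ ∩ B₁ ∩ C).card = ρ := by
  rw [← hS.card_inter X₁ h.base₁, card_inter_eq_sdiff_add X₁ B₁ C,
    Finset.inter_eq_left.2 h.subset₁]

lemma card_sdiff_eq (hS : SplitSystem M C ρ 𝓗 b) (h : ExchangePair M C X₁ X₂ B₁ B₂) :
    (X₁ \ B₁).card = (X₂ \ B₂).card := by
  have h1 := card_inter_add_card_sdiff_inter X₁ B₁ C
  rw [hS.card_inter X₁ h.base₁, hS.card_inter B₁ h.target₁, ← h.sdiff₂,
    Finset.inter_eq_left.2 h.subset₁, Finset.inter_eq_left.2 h.subset₂] at h1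
  omega

lemma card_inter_inter_eq (hS : SplitSystem M C ρ 𝓗 b) (h : ExchangePair M C X₁ X₂ B₁ B₂) :
    (X₁ ∩ B₁ ∩ C).card = (X₂ ∩ B₂ ∩ C).card := by
  have h1 := h.card_sdiff_add hS
  have h2 := h.symm.card_sdiff_add hS
  have h3 := h.card_sdiff_eq hS
  omega

/-- A tight hyperedge contains at least as many elements to be removed as to be added. -/
lemma card_inter_le (hS : SplitSystem M C ρ 𝓗 b) (h : ExchangePair M C X₁ X₂ B₁ B₂)
    (hH : IsTight 𝓗 b X₁ H) : ((X₂ \ B₂) ∩ H).card ≤ ((X₁ \ B₁) ∩ H).card := by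
  have h1 := card_inter_add_card_sdiff_inter X₁ B₁ H
  have h2 := hS.card_le B₁ h.target₁ H hH.1
  rw [← h.sdiff₂, hH.2] at h1
  omega

lemma subset_of_subset (hS : SplitSystem M C ρ 𝓗 b) (h : ExchangePair M C X₁ X₂ B₁ B₂)
    (hH : IsTight 𝓗 b X₁ H) (hQ : X₂ \ B₂ ⊆ H) : X₁ \ B₁ ⊆ H := by
  have h1 := h.card_inter_le hS hH
  rw [Finset.inter_eq_left.2 hQ, ← h.card_sdiff_eq hS] at h1
  exact Finset.inter_eq_left.1 (Finset.eq_of_subset_of_card_le Finset.inter_subset_left h1)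

lemma disjoint_of_disjoint (hS : SplitSystem M C ρ 𝓗 b) (h : ExchangePair M C X₁ X₂ B₁ B₂)
    (hH : IsTight 𝓗 b X₁ H) (hP : ∀ a ∈ X₁ \ B₁, a ∉ H) : ∀ a ∈ X₂ \ B₂, a ∉ H := by
  have h1 := h.card_inter_le hS hH
  rw [Finset.card_eq_zero.2 (Finset.disjoint_iff_inter_eq_empty.1 (Finset.disjoint_left.2 hP)),
    Nat.le_zero, Finset.card_eq_zero] at h1
  exact fun a ha => Finset.disjoint_left.1 (Finset.disjoint_iff_inter_eq_empty.2 h1) ha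

end ExchangePair

/-- Two pairs of tight hyperedges that split the elements to be exchanged into four classes,
such that only exchanges inside a class are possible and at least `2 * t` elements remain
unexchanged. -/
structure Doomed (𝓗 : Set (Finset α)) (b : Finset α → ℕ) (X₁ X₂ B₁ B₂ H₁ H₂ K₁ K₂ : Finset α)
    (t : ℕ) : Prop where
  tight_H₁ : IsTight 𝓗 b X₁ H₁
  tight_H₂ : IsTight 𝓗 b X₁ H₂
  tight_K₁ : IsTight 𝓗 b X₂ K₁
  tight_K₂ : IsTight 𝓗 b X₂ K₂
  pure_H₁ : ∀ a ∈ X₁ \ B₁, (a ∈ H₁ ↔ a ∉ H₂)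
  pure_H₂ : ∀ a ∈ X₂ \ B₂, (a ∈ H₁ ↔ a ∉ H₂)
  pure_K₁ : ∀ a ∈ X₁ \ B₁, (a ∈ K₁ ↔ a ∉ K₂)
  pure_K₂ : ∀ a ∈ X₂ \ B₂, (a ∈ K₁ ↔ a ∉ K₂)
  card_add : ((X₂ \ B₂) ∩ H₁ ∩ K₁).card = ((X₁ \ B₁) ∩ H₁ ∩ K₁).card + t
  one_le : 1 ≤ t

namespace Doomed

variable {H₁ H₂ K₁ K₂ : Finset α} {t : ℕ}

/-- Tightness for `X₁` bounds the part of `Q` in `H₁`, and in `H₂`, by that of `P`; both pairs of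
parts add up to `|P| = |Q|`, so the bounds are equalities, and likewise for `K₁, K₂`. The single
surplus `t` then fixes all four classes: `Q` is ahead by `t` in `H₁ ∩ K₁` and `H₂ ∩ K₂`, and `P` in
`H₁ ∩ K₂` and `H₂ ∩ K₁`. -/
lemma card_classes (hS : SplitSystem M C ρ 𝓗 b) (h : ExchangePair M C X₁ X₂ B₁ B₂)
    (hD : Doomed 𝓗 b X₁ X₂ B₁ B₂ H₁ H₂ K₁ K₂ t) :
    ((X₁ \ B₁) ∩ H₁).card = ((X₂ \ B₂) ∩ H₁).card ∧
    ((X₁ \ B₁) ∩ H₂).card = ((X₂ \ B₂) ∩ H₂).card ∧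
    ((X₁ \ B₁) ∩ K₁).card = ((X₂ \ B₂) ∩ K₁).card ∧
    ((X₁ \ B₁) ∩ K₂).card = ((X₂ \ B₂) ∩ K₂).card ∧
    ((X₂ \ B₂) ∩ H₂ ∩ K₂).card = ((X₁ \ B₁) ∩ H₂ ∩ K₂).card + t ∧
    ((X₁ \ B₁) ∩ H₁ ∩ K₂).card = ((X₂ \ B₂) ∩ H₁ ∩ K₂).card + t ∧
    ((X₁ \ B₁) ∩ H₂ ∩ K₁).card = ((X₂ \ B₂) ∩ H₂ ∩ K₁).card + t ∧
    ((X₁ \ B₁) ∩ H₁ ∩ K₁).card + ((X₁ \ B₁) ∩ H₁ ∩ K₂).card = ((X₁ \ B₁) ∩ H₁).card ∧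
    ((X₁ \ B₁) ∩ H₂ ∩ K₁).card + ((X₁ \ B₁) ∩ H₂ ∩ K₂).card = ((X₁ \ B₁) ∩ H₂).card ∧
    ((X₂ \ B₂) ∩ H₁ ∩ K₁).card + ((X₂ \ B₂) ∩ H₂ ∩ K₁).card = ((X₂ \ B₂) ∩ K₁).card ∧
    ((X₁ \ B₁) ∩ H₁).card + ((X₁ \ B₁) ∩ H₂).card = (X₁ \ B₁).card ∧
    ((X₁ \ B₁) ∩ K₁).card + ((X₁ \ B₁) ∩ K₂).card = (X₁ \ B₁).card := by
  have a1 := card_inter_add_card_inter_of_pure hD.pure_H₁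
  have a2 := card_inter_add_card_inter_of_pure hD.pure_H₂
  have a3 := card_inter_add_card_inter_of_pure hD.pure_K₁
  have a4 := card_inter_add_card_inter_of_pure hD.pure_K₂
  have c := h.card_sdiff_eq hS
  have b1 := h.card_inter_le hS hD.tight_H₁
  have b2 := h.card_inter_le hS hD.tight_H₂
  have b3 := h.symm.card_inter_le hS hD.tight_K₁
  have b4 := h.symm.card_inter_le hS hD.tight_K₂
  have s {S T : Finset α} (hp : ∀ a ∈ S, (a ∈ K₁ ↔ a ∉ K₂)) :
      (S ∩ T ∩ K₁).card + (S ∩ T ∩ K₂).card = (S ∩ T).card :=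
    card_inter_add_card_inter_of_pure (fun a ha => hp a (Finset.mem_inter.1 ha).1)
  have s' {S T : Finset α} (hp : ∀ a ∈ S, (a ∈ H₁ ↔ a ∉ H₂)) :
      (S ∩ H₁ ∩ T).card + (S ∩ H₂ ∩ T).card = (S ∩ T).card := by
    rw [Finset.inter_right_comm S H₁, Finset.inter_right_comm S H₂]
    exact card_inter_add_card_inter_of_pure (fun a ha => hp a (Finset.mem_inter.1 ha).1)
  have s1 := s (T := H₁) hD.pure_K₁
  have s2 := s (T := H₂) hD.pure_K₁
  have s3 := s (T := H₁) hD.pure_K₂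
  have s4 := s (T := H₂) hD.pure_K₂
  have s5 := s' (T := K₁) hD.pure_H₁
  have s6 := s' (T := K₂) hD.pure_H₁
  have s7 := s' (T := K₁) hD.pure_H₂
  have s8 := s' (T := K₂) hD.pure_H₂
  have := hD.card_add
  omega

lemma flip (hS : SplitSystem M C ρ 𝓗 b) (h : ExchangePair M C X₁ X₂ B₁ B₂)
    (hD : Doomed 𝓗 b X₁ X₂ B₁ B₂ H₁ H₂ K₁ K₂ t) :
    Doomed 𝓗 b X₁ X₂ B₁ B₂ H₂ H₁ K₂ K₁ t :=
  ⟨hD.tight_H₂, hD.tight_H₁, hD.tight_K₂, hD.tight_K₁,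
    fun a ha => by have := hD.pure_H₁ a ha; tauto, fun a ha => by have := hD.pure_H₂ a ha; tauto,
    fun a ha => by have := hD.pure_K₁ a ha; tauto, fun a ha => by have := hD.pure_K₂ a ha; tauto,
    (hD.card_classes hS h).2.2.2.2.1, hD.one_le⟩

/-- The order of `H₁, H₂` is reversed because after swapping the members the surplus counted by
`card_add` is that of `P`, which sits in `H₂ ∩ K₁`. -/
lemma symm (hS : SplitSystem M C ρ 𝓗 b) (h : ExchangePair M C X₁ X₂ B₁ B₂)
    (hD : Doomed 𝓗 b X₁ X₂ B₁ B₂ H₁ H₂ K₁ K₂ t) :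
    Doomed 𝓗 b X₂ X₁ B₂ B₁ K₁ K₂ H₂ H₁ t :=
  ⟨hD.tight_K₁, hD.tight_K₂, hD.tight_H₂, hD.tight_H₁, hD.pure_K₂, hD.pure_K₁,
    fun a ha => by have := hD.pure_H₂ a ha; tauto, fun a ha => by have := hD.pure_H₁ a ha; tauto,
    by
      rw [Finset.inter_right_comm _ K₁, Finset.inter_right_comm _ K₁]
      exact (hD.card_classes hS h).2.2.2.2.2.2.1, hD.one_le⟩

lemma two_mul_le_card (hS : SplitSystem M C ρ 𝓗 b) (h : ExchangePair M C X₁ X₂ B₁ B₂)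
    (hD : Doomed 𝓗 b X₁ X₂ B₁ B₂ H₁ H₂ K₁ K₂ t) : 2 * t ≤ (X₁ \ B₁).card := by
  have := hD.card_classes hS h
  have := hD.card_add
  omega

/-- This is `card_inter_add_le` for `H₁` and `K₁`, which differ since `P` meets `H₁ ∩ K₂`. Their
intersection contains the first class of both `P` and `Q`, while their bounds count elements of `P`,
`Q` and common elements; the elements of `P` and `Q` alone violate the inequality by at least `t`,
which common elements must make up. -/
lemma le_card_inter (hS : SplitSystem M C ρ 𝓗 b) (h : ExchangePair M C X₁ X₂ B₁ B₂)
    (hD : Doomed 𝓗 b X₁ X₂ B₁ B₂ H₁ H₂ K₁ K₂ t) : t ≤ (X₁ ∩ B₁ ∩ C).card := by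
  have hc := hD.card_classes hS h
  have ha := hD.card_add
  have ho := hD.one_le
  have hne : H₁ ≠ K₁ := by
    rintro rfl
    have : ((X₁ \ B₁) ∩ H₁ ∩ K₂).card = 0 := by
      rw [Finset.card_eq_zero, Finset.eq_empty_iff_forall_notMem]
      intro a ha
      simp only [Finset.mem_inter] at ha
      have := hD.pure_K₁ a ha.1.1
      tauto
    omega
  have hp := hS.card_inter_add_le H₁ hD.tight_H₁.1 K₁ hD.tight_K₁.1 hne
  rw [← hD.tight_H₁.2, ← hD.tight_K₁.2, card_inter_eq_sdiff_add X₁ B₁,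
    card_inter_eq_sdiff_add X₂ B₂, ← h.card_sdiff_add hS] at hp
  have s1 : (X₁ ∩ B₁ ∩ H₁).card ≤ (X₁ ∩ B₁ ∩ C).card :=
    Finset.card_le_card (Finset.inter_subset_inter_left (hS.subset _ hD.tight_H₁.1))
  have s2 : (X₂ ∩ B₂ ∩ K₁).card ≤ (X₂ ∩ B₂ ∩ C).card :=
    Finset.card_le_card (Finset.inter_subset_inter_left (hS.subset _ hD.tight_K₁.1))
  rw [← h.card_inter_inter_eq hS] at s2
  have s3 : ((X₁ \ B₁) ∩ H₁ ∩ K₁).card + ((X₂ \ B₂) ∩ H₁ ∩ K₁).card ≤ (H₁ ∩ K₁).card := by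
    rw [← Finset.card_union_of_disjoint]
    · exact Finset.card_le_card (by grind)
    · rw [Finset.disjoint_left]
      intro a ha hb
      simp only [Finset.mem_inter] at ha hb
      exact (h.mem_left ha.1.1).2.1 (h.symm.mem_left hb.1.1).2.2.2.1
  omega

/-- Exchanging two elements of the same class. -/
lemma exchange (h : ExchangePair M C X₁ X₂ B₁ B₂)
    (hD : Doomed 𝓗 b X₁ X₂ B₁ B₂ H₁ H₂ K₁ K₂ t) (he : e ∈ X₁ \ B₁) (hf : f ∈ X₂ \ B₂)
    (hH : e ∈ H₁ ↔ f ∈ H₁) (hK : e ∈ K₁ ↔ f ∈ K₁) :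
    Doomed 𝓗 b (insert f (X₁.erase e)) (insert e (X₂.erase f)) B₁ B₂ H₁ H₂ K₁ K₂ t := by
  have h1 := h.mem_left he
  have h2 := h.symm.mem_left hf
  have a1 := hD.pure_H₁ e he
  have a2 := hD.pure_H₂ f hf
  have a3 := hD.pure_K₁ e he
  have a4 := hD.pure_K₂ f hf
  have e1 := h.exchange_sdiff he hf
  have e2 := h.symm.exchange_sdiff hf he
  refine ⟨hD.tight_H₁.exchange h1.1 h2.2.2.1 hH, hD.tight_H₂.exchange h1.1 h2.2.2.1 (by tauto),
    hD.tight_K₁.exchange h2.1 h1.2.2.1 hK.symm, hD.tight_K₂.exchange h2.1 h1.2.2.1 (by tauto),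
    ?_, ?_, ?_, ?_, ?_, hD.one_le⟩
  · rw [e1]; exact fun a ha => hD.pure_H₁ a (Finset.mem_of_mem_erase ha)
  · rw [e2]; exact fun a ha => hD.pure_H₂ a (Finset.mem_of_mem_erase ha)
  · rw [e1]; exact fun a ha => hD.pure_K₁ a (Finset.mem_of_mem_erase ha)
  · rw [e2]; exact fun a ha => hD.pure_K₂ a (Finset.mem_of_mem_erase ha)
  · rw [e1, e2, card_erase_inter_eq_iff he hf hH hK]
    exact hD.card_add

/-- The converse of `Doomed.exchange`. -/
lemma of_exchange (h : ExchangePair M C X₁ X₂ B₁ B₂) (he : e ∈ X₁ \ B₁) (hf : f ∈ X₂ \ B₂)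
    (hD : Doomed 𝓗 b (insert f (X₁.erase e)) (insert e (X₂.erase f)) B₁ B₂ H₁ H₂ K₁ K₂ t)
    (hH : e ∈ H₁ ↔ f ∈ H₁) (hK : e ∈ K₁ ↔ f ∈ K₁) (eH : e ∈ H₁ ↔ e ∉ H₂) (fH : f ∈ H₁ ↔ f ∉ H₂)
    (eK : e ∈ K₁ ↔ e ∉ K₂) (fK : f ∈ K₁ ↔ f ∉ K₂) :
    Doomed 𝓗 b X₁ X₂ B₁ B₂ H₁ H₂ K₁ K₂ t := by
  have h1 := h.mem_left he
  have h2 := h.symm.mem_left hf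
  have e1 := h.exchange_sdiff he hf
  have e2 := h.symm.exchange_sdiff hf he
  have tight {Y H : Finset α} {x y : α} (hx : x ∈ Y) (hy : y ∉ Y) (hxy : x ∈ H ↔ y ∈ H)
      (ht : IsTight 𝓗 b (insert y (Y.erase x)) H) : IsTight 𝓗 b Y H := by
    have := ht.exchange (e := y) (f := x) (by simp) (by simp; rintro rfl; exact hy hx) hxy.symm
    rwa [Finset.erase_insert (by simp [hy]), Finset.insert_erase hx] at this
  have c := hD.card_add
  refine ⟨tight h1.1 h2.2.2.1 hH hD.tight_H₁, tight h1.1 h2.2.2.1 (by tauto) hD.tight_H₂,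
    tight h2.1 h1.2.2.1 hK.symm hD.tight_K₁, tight h2.1 h1.2.2.1 (by tauto) hD.tight_K₂,
    ?_, ?_, ?_, ?_, ?_, hD.one_le⟩
  · intro a ha
    by_cases hae : a = e
    · rwa [hae]
    · exact hD.pure_H₁ a (e1 ▸ Finset.mem_erase.2 ⟨hae, ha⟩)
  · intro a ha
    by_cases hae : a = f
    · rwa [hae]
    · exact hD.pure_H₂ a (e2 ▸ Finset.mem_erase.2 ⟨hae, ha⟩)
  · intro a ha
    by_cases hae : a = e
    · rwa [hae]
    · exact hD.pure_K₁ a (e1 ▸ Finset.mem_erase.2 ⟨hae, ha⟩)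
  · intro a ha
    by_cases hae : a = f
    · rwa [hae]
    · exact hD.pure_K₂ a (e2 ▸ Finset.mem_erase.2 ⟨hae, ha⟩)
  · rwa [e1, e2, card_erase_inter_eq_iff he hf hH hK] at c

end Doomed

end System

end Matroid

/-! ### Stuck pairs are doomed, and comparison of doomed pairs that differ by a swap. -/

namespace Matroid

variable {α : Type*} [DecidableEq α] {M : Matroid α}

section System

variable {C X X₁ X₂ B₁ B₂ H K H₁ H₂ K₁ K₂ : Finset α} {ρ t : ℕ} {𝓗 : Set (Finset α)}
  {b : Finset α → ℕ} {e f q : α}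

/-- The pair admits two pairs of tight hyperedges that obstruct it. -/
def IsDoomed (𝓗 : Set (Finset α)) (b : Finset α → ℕ) (X₁ X₂ B₁ B₂ : Finset α) : Prop :=
  ∃ H₁ H₂ K₁ K₂ t, Doomed 𝓗 b X₁ X₂ B₁ B₂ H₁ H₂ K₁ K₂ t

namespace ExchangePair

lemma nonempty_right (hS : SplitSystem M C ρ 𝓗 b) (h : ExchangePair M C X₁ X₂ B₁ B₂)
    (hne : (X₁ \ B₁).Nonempty) : (X₂ \ B₂).Nonempty := by
  rw [← Finset.card_pos, ← h.card_sdiff_eq hS, Finset.card_pos]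
  exact hne

/-- If no hyperedge tight for `X₁` missed `e`, every `f ∈ Q` would be blocked by a hyperedge tight
for `X₂` that contains `e`. By uniqueness it is always the same one, so it misses all of `Q`, hence
all of `P`, including `e`. The second claim is dual. -/
lemma exists_tight_of_blocked (hS : SplitSystem M C ρ 𝓗 b) (h : ExchangePair M C X₁ X₂ B₁ B₂)
    (hbad : ∀ e ∈ X₁ \ B₁, ∀ f ∈ X₂ \ B₂, (∃ H, IsTight 𝓗 b X₁ H ∧ f ∈ H ∧ e ∉ H) ∨
      ∃ K, IsTight 𝓗 b X₂ K ∧ e ∈ K ∧ f ∉ K) (he : e ∈ X₁ \ B₁) :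
    (∃ H, IsTight 𝓗 b X₁ H ∧ e ∉ H) ∧ ∃ K, IsTight 𝓗 b X₂ K ∧ e ∈ K := by
  obtain ⟨f, hf⟩ := h.nonempty_right hS ⟨e, he⟩
  have me := h.mem_left he
  constructor
  · by_contra hc
    push Not at hc
    have h2 : ∀ f ∈ X₂ \ B₂, ∃ K, IsTight 𝓗 b X₂ K ∧ e ∈ K ∧ f ∉ K := fun f hf =>
      (hbad e he f hf).resolve_left fun ⟨H, hH, _, h3⟩ => h3 (hc H hH)
    obtain ⟨K, hK, heK, -⟩ := h2 f hf
    refine h.symm.disjoint_of_disjoint hS hK (fun a ha haK => ?_) e he heK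
    obtain ⟨K', hK', heK', haK'⟩ := h2 a ha
    rw [hS.eq_of_mem_of_mem h.base₂ hK' hK me.2.2.1 heK' heK] at haK'
    exact haK' haK
  · by_contra hc
    push Not at hc
    have h2 : ∀ f ∈ X₂ \ B₂, ∃ H, IsTight 𝓗 b X₁ H ∧ f ∈ H ∧ e ∉ H := fun f hf =>
      (hbad e he f hf).resolve_right fun ⟨K, hK, h3, _⟩ => hc K hK h3
    obtain ⟨H, hH, -, heH⟩ := h2 f hf
    refine heH (h.subset_of_subset hS hH (fun a ha => ?_) he)
    obtain ⟨H', hH', haH', heH'⟩ := h2 a ha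
    rwa [hS.eq_of_notMem_of_notMem h.base₁ hH' hH me.1 me.2.2.2.2 heH' heH] at haH'

/-- A pair which admits no exchange towards a different target is doomed. -/
lemma isDoomed_of_stuck (hS : SplitSystem M C ρ 𝓗 b) (h : ExchangePair M C X₁ X₂ B₁ B₂)
    (hne : (X₁ \ B₁).Nonempty)
    (hstuck : ∀ e ∈ X₁ \ B₁, ∀ f ∈ X₂ \ B₂, M.IsBase (insert f (X₁.erase e) : Finset α) →
      ¬ M.IsBase (insert e (X₂.erase f) : Finset α)) : IsDoomed 𝓗 b X₁ X₂ B₁ B₂ := by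
  have hbad : ∀ e ∈ X₁ \ B₁, ∀ f ∈ X₂ \ B₂, (∃ H, IsTight 𝓗 b X₁ H ∧ f ∈ H ∧ e ∉ H) ∨
      ∃ K, IsTight 𝓗 b X₂ K ∧ e ∈ K ∧ f ∉ K := by
    intro e he f hf
    have me := h.mem_left he
    have mf := h.symm.mem_left hf
    by_cases h1 : M.IsBase (insert f (X₁.erase e) : Finset α)
    · obtain ⟨K, a1, a2, a3, a4⟩ := hS.exists_tight X₂ h.base₂ f mf.1 mf.2.2.2.2 e me.2.2.2.2
        me.2.2.1 (hstuck e he f hf h1)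
      exact Or.inr ⟨K, ⟨a1, a2⟩, a3, a4⟩
    · obtain ⟨K, a1, a2, a3, a4⟩ := hS.exists_tight X₁ h.base₁ e me.1 me.2.2.2.2 f mf.2.2.2.2
        mf.2.2.1 h1
      exact Or.inl ⟨K, ⟨a1, a2⟩, a3, a4⟩
  have hbad' : ∀ f ∈ X₂ \ B₂, ∀ e ∈ X₁ \ B₁, (∃ K, IsTight 𝓗 b X₂ K ∧ e ∈ K ∧ f ∉ K) ∨
      ∃ H, IsTight 𝓗 b X₁ H ∧ f ∈ H ∧ e ∉ H := fun f hf e he => (hbad e he f hf).symm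
  -- Uniqueness of the tight hyperedge on the relevant side of an element; with these facts each
  -- blocked exchange can be attributed to the hyperedges named so far.
  have uP {p : α} (hp : p ∈ X₁ \ B₁) {H H' : Finset α} (h1 : IsTight 𝓗 b X₁ H)
      (h2 : IsTight 𝓗 b X₁ H') (h3 : p ∉ H) (h4 : p ∉ H') : H = H' :=
    hS.eq_of_notMem_of_notMem h.base₁ h1 h2 (h.mem_left hp).1 (h.mem_left hp).2.2.2.2 h3 h4
  have uP' {p : α} (hp : p ∈ X₁ \ B₁) {K K' : Finset α} (h1 : IsTight 𝓗 b X₂ K)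
      (h2 : IsTight 𝓗 b X₂ K') (h3 : p ∈ K) (h4 : p ∈ K') : K = K' :=
    hS.eq_of_mem_of_mem h.base₂ h1 h2 (h.mem_left hp).2.2.1 h3 h4
  have uQ {p : α} (hp : p ∈ X₂ \ B₂) {H H' : Finset α} (h1 : IsTight 𝓗 b X₁ H)
      (h2 : IsTight 𝓗 b X₁ H') (h3 : p ∈ H) (h4 : p ∈ H') : H = H' :=
    hS.eq_of_mem_of_mem h.base₁ h1 h2 (h.symm.mem_left hp).2.2.1 h3 h4
  have uQ' {p : α} (hp : p ∈ X₂ \ B₂) {K K' : Finset α} (h1 : IsTight 𝓗 b X₂ K)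
      (h2 : IsTight 𝓗 b X₂ K') (h3 : p ∉ K) (h4 : p ∉ K') : K = K' :=
    hS.eq_of_notMem_of_notMem h.base₂ h1 h2 (h.symm.mem_left hp).1
      (h.symm.mem_left hp).2.2.2.2 h3 h4
  obtain ⟨p₀, hp₀⟩ := hne
  obtain ⟨⟨H₁, tH₁, p₀H₁⟩, K₁, tK₁, p₀K₁⟩ := h.exists_tight_of_blocked hS hbad hp₀
  obtain ⟨q₂, hq₂, q₂H₁⟩ : ∃ q ∈ X₂ \ B₂, q ∉ H₁ := by
    by_contra hc
    push Not at hc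
    exact p₀H₁ (h.subset_of_subset hS tH₁ hc hp₀)
  obtain ⟨-, H₂, tH₂, q₂H₂⟩ := h.symm.exists_tight_of_blocked hS hbad' hq₂
  have neH : H₁ ≠ H₂ := by rintro rfl; exact q₂H₁ q₂H₂
  have q₂K₁ : q₂ ∉ K₁ := by
    rcases hbad p₀ hp₀ q₂ hq₂ with ⟨H, tH, a1, a2⟩ | ⟨K, tK, a1, a2⟩
    · exact absurd (uP hp₀ tH tH₁ a2 p₀H₁ ▸ a1) q₂H₁
    · rwa [uP' hp₀ tK tK₁ a1 p₀K₁] at a2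
  obtain ⟨q₁, hq₁, q₁K₁⟩ : ∃ q ∈ X₂ \ B₂, q ∈ K₁ := by
    by_contra hc
    push Not at hc
    exact h.symm.disjoint_of_disjoint hS tK₁ hc p₀ hp₀ p₀K₁
  have q₁H₁ : q₁ ∈ H₁ := by
    rcases hbad p₀ hp₀ q₁ hq₁ with ⟨H, tH, a1, a2⟩ | ⟨K, tK, a1, a2⟩
    · rwa [uP hp₀ tH tH₁ a2 p₀H₁] at a1
    · exact absurd q₁K₁ (uP' hp₀ tK tK₁ a1 p₀K₁ ▸ a2)
  obtain ⟨⟨K₂, tK₂, q₁K₂⟩, -⟩ := h.symm.exists_tight_of_blocked hS hbad' hq₁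
  have neK : K₁ ≠ K₂ := by rintro rfl; exact q₁K₂ q₁K₁
  obtain ⟨p₃, hp₃, p₃K₁⟩ : ∃ p ∈ X₁ \ B₁, p ∉ K₁ := by
    by_contra hc
    push Not at hc
    exact q₂K₁ (h.symm.subset_of_subset hS tK₁ hc hq₂)
  have p₃H₂ : p₃ ∉ H₂ := by
    rcases hbad p₃ hp₃ q₂ hq₂ with ⟨H, tH, a1, a2⟩ | ⟨K, tK, a1, a2⟩
    · rwa [uQ hq₂ tH tH₂ a1 q₂H₂] at a2
    · exact absurd (uQ' hq₂ tK tK₁ a2 q₂K₁ ▸ a1) p₃K₁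
  have p₃K₂ : p₃ ∈ K₂ := by
    rcases hbad p₃ hp₃ q₁ hq₁ with ⟨H, tH, a1, a2⟩ | ⟨K, tK, a1, a2⟩
    · rw [uQ hq₁ tH tH₁ a1 q₁H₁] at a2
      exact absurd (uP hp₃ tH₁ tH₂ a2 p₃H₂) neH
    · rwa [uQ' hq₁ tK tK₂ a2 q₁K₂] at a1
  -- `P` lies in the classes `H₂ ∩ K₁` and `H₁ ∩ K₂`, and below `Q` lies in the other two: no class
  -- meets both.
  have purP : ∀ p ∈ X₁ \ B₁,
      (p ∉ H₁ ∧ p ∈ H₂ ∧ p ∈ K₁ ∧ p ∉ K₂) ∨ (p ∈ H₁ ∧ p ∉ H₂ ∧ p ∉ K₁ ∧ p ∈ K₂) := by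
    intro p hp
    have a1 : p ∉ H₁ ∨ p ∈ K₂ := by
      rcases hbad p hp q₁ hq₁ with ⟨H, tH, a1, a2⟩ | ⟨K, tK, a1, a2⟩
      · exact Or.inl (uQ hq₁ tH tH₁ a1 q₁H₁ ▸ a2)
      · exact Or.inr (uQ' hq₁ tK tK₂ a2 q₁K₂ ▸ a1)
    have a2 : p ∉ H₂ ∨ p ∈ K₁ := by
      rcases hbad p hp q₂ hq₂ with ⟨H, tH, a1, a2⟩ | ⟨K, tK, a1, a2⟩
      · exact Or.inl (uQ hq₂ tH tH₂ a1 q₂H₂ ▸ a2)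
      · exact Or.inr (uQ' hq₂ tK tK₁ a2 q₂K₁ ▸ a1)
    have a3 : ¬ (p ∉ H₁ ∧ p ∉ H₂) := fun hh => neH (uP hp tH₁ tH₂ hh.1 hh.2)
    have a4 : ¬ (p ∈ K₁ ∧ p ∈ K₂) := fun hh => neK (uP' hp tK₁ tK₂ hh.1 hh.2)
    clear uP uP' uQ uQ' hbad hbad' hstuck
    tauto
  have purQ : ∀ q ∈ X₂ \ B₂,
      (q ∈ H₁ ∧ q ∉ H₂ ∧ q ∈ K₁ ∧ q ∉ K₂) ∨ (q ∉ H₁ ∧ q ∈ H₂ ∧ q ∉ K₁ ∧ q ∈ K₂) := by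
    intro q hq
    have a1 : q ∈ H₁ ∨ q ∉ K₁ := by
      rcases hbad p₀ hp₀ q hq with ⟨H, tH, a1, a2⟩ | ⟨K, tK, a1, a2⟩
      · exact Or.inl (uP hp₀ tH tH₁ a2 p₀H₁ ▸ a1)
      · exact Or.inr (uP' hp₀ tK tK₁ a1 p₀K₁ ▸ a2)
    have a2 : q ∈ H₂ ∨ q ∉ K₂ := by
      rcases hbad p₃ hp₃ q hq with ⟨H, tH, a1, a2⟩ | ⟨K, tK, a1, a2⟩
      · exact Or.inl (uP hp₃ tH tH₂ a2 p₃H₂ ▸ a1)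
      · exact Or.inr (uP' hp₃ tK tK₂ a1 p₃K₂ ▸ a2)
    have a3 : ¬ (q ∈ H₁ ∧ q ∈ H₂) := fun hh => neH (uQ hq tH₁ tH₂ hh.1 hh.2)
    have a4 : ¬ (q ∉ K₁ ∧ q ∉ K₂) := fun hh => neK (uQ' hq tK₁ tK₂ hh.1 hh.2)
    clear uP uP' uQ uQ' hbad hbad' hstuck
    tauto
  -- As `P` misses the first class, the surplus of `Q` there is all of `Q` in it; `q₁` shows that it
  -- is positive.
  refine ⟨H₁, H₂, K₁, K₂, ((X₂ \ B₂) ∩ H₁ ∩ K₁).card, tH₁, tH₂, tK₁, tK₂, ?_, ?_, ?_, ?_, ?_, ?_⟩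
  · intro a ha; rcases purP a ha with hh | hh <;> simp [hh]
  · intro a ha; rcases purQ a ha with hh | hh <;> simp [hh]
  · intro a ha; rcases purP a ha with hh | hh <;> simp [hh]
  · intro a ha; rcases purQ a ha with hh | hh <;> simp [hh]
  · rw [eq_comm, Nat.add_eq_right, Finset.card_eq_zero, Finset.eq_empty_iff_forall_notMem]
    intro a ha
    rw [Finset.mem_inter, Finset.mem_inter] at ha
    rcases purP a ha.1.1 with hh | hh
    · exact hh.1 ha.1.2
    · exact hh.2.2.1 ha.2
  · exact Finset.card_pos.2 ⟨q₁, Finset.mem_inter.2 ⟨Finset.mem_inter.2 ⟨hq₁, q₁H₁⟩, q₁K₁⟩⟩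

end ExchangePair

namespace Doomed

variable {J₁ J₂ L₁ L₂ : Finset α} {t' : ℕ}

lemma card_inter_add_le_card {D C H J : Finset α} (hH : H ⊆ C) (hJ : J ⊆ C) :
    (D ∩ H).card + (D ∩ J).card ≤ (D ∩ C).card + (D ∩ H ∩ J).card := by
  rw [← Finset.card_union_add_card_inter]
  exact Nat.add_le_add (Finset.card_le_card (by grind)) (Finset.card_le_card (by grind))

lemma card_add_card_add_card_le {S T U V : Finset α} (h1 : Disjoint S T) (h2 : Disjoint S U)
    (h3 : Disjoint T U) (s1 : S ⊆ V) (s2 : T ⊆ V) (s3 : U ⊆ V) :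
    S.card + T.card + U.card ≤ V.card := by
  rw [← Finset.card_union_of_disjoint h1,
    ← Finset.card_union_of_disjoint (Finset.disjoint_union_left.2 ⟨h2, h3⟩)]
  exact Finset.card_le_card (Finset.union_subset (Finset.union_subset s1 s2) s3)

/-- Undoing an exchange that added `f` and adding an element `q` of the first class instead leads
to a doomed pair only if `f ∉ H₂`. -/
lemma notMem_of_swap (hS : SplitSystem M C ρ 𝓗 b) (h : ExchangePair M C X₁ X₂ B₁ B₂)
    (hD : Doomed 𝓗 b X₁ X₂ B₁ B₂ H₁ H₂ K₁ K₂ t) (hfX₁ : f ∈ X₁) (hfB₁ : f ∈ B₁) (hfX₂ : f ∉ X₂)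
    (hfB₂ : f ∉ B₂) (hq : q ∈ X₂ \ B₂) (hqH : q ∈ H₁) (hfH : f ∈ H₁)
    (b₁ : M.IsBase (insert q (X₁.erase f) : Finset α))
    (hD' : Doomed 𝓗 b (insert q (X₁.erase f)) (insert f (X₂.erase q)) B₁ B₂ J₁ J₂ L₁ L₂ t') :
    f ∉ H₂ := by
  have mq := h.symm.mem_left hq
  have eP : insert q (X₁.erase f) \ B₁ = X₁ \ B₁ := by grind
  have eQ : insert f (X₂.erase q) \ B₂ = insert f ((X₂ \ B₂).erase q) := by grind
  have hc := hD.card_classes hS h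
  have ht := hD.one_le
  have h2 := hD.two_mul_le_card hS h
  have hρ := h.card_sdiff_add hS
  have qH₂ : q ∉ H₂ := (hD.pure_H₂ q hq).1 hqH
  have pJ₁ := hD'.pure_H₁
  have pJ₂ := hD'.pure_H₂
  rw [eP] at pJ₁
  rw [eQ] at pJ₂
  have hfq : f ≠ q := fun hh => hfX₂ (hh ▸ mq.1)
  have dPQ : Disjoint (X₁ \ B₁) (X₂ \ B₂) := by
    rw [Finset.disjoint_left]
    exact fun a ha hb => (h.mem_left ha).2.2.1 (h.symm.mem_left hb).1
  -- Otherwise `H₁` stays tight after the swap while `H₂` loses `f`. The new doomed structure uses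
  -- `H₁` and a partner `J`, which splits the remaining elements as `H₂` does but differs from it,
  -- and the two overlap too much.
  intro hfH₂
  obtain ⟨J, tJ, pJ, pJ'⟩ : ∃ J, IsTight 𝓗 b (insert q (X₁.erase f)) J ∧
      (∀ a ∈ X₁ \ B₁, (a ∈ H₁ ↔ a ∉ J)) ∧
      ∀ a ∈ insert f ((X₂ \ B₂).erase q), (a ∈ H₁ ↔ a ∉ J) := by
    have tH : IsTight 𝓗 b (insert q (X₁.erase f)) H₁ :=
      hD.tight_H₁.exchange hfX₁ mq.2.2.1 (iff_of_true hfH hqH)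
    have hf' : f ∉ insert q (X₁.erase f) := by simp [hfq]
    by_cases hfJ : f ∈ J₁
    · obtain rfl := hS.eq_of_mem_of_mem b₁ hD'.tight_H₁ tH hf' hfJ hfH
      exact ⟨J₂, hD'.tight_H₂, pJ₁, pJ₂⟩
    · have hfJ₂ : f ∈ J₂ := by
        have := pJ₂ f (Finset.mem_insert_self _ _)
        tauto
      obtain rfl := hS.eq_of_mem_of_mem b₁ hD'.tight_H₂ tH hf' hfJ₂ hfH
      exact ⟨J₁, hD'.tight_H₁, fun a ha => by have := pJ₁ a ha; tauto,
        fun a ha => by have := pJ₂ a ha; tauto⟩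
  have x1 := card_exchange_inter hfX₁ mq.2.2.1 H₂
  rw [if_pos hfH₂, if_neg qH₂, hD.tight_H₂.2] at x1
  have hne : H₂ ≠ J := by
    rintro rfl
    have := tJ.2
    omega
  have hp := hS.card_inter_add_le H₂ hD.tight_H₂.1 J tJ.1 hne
  have x2 := card_exchange_inter hfX₁ mq.2.2.1 J
  have x3 : (if q ∈ J then 1 else 0) ≤ 1 := by split_ifs <;> simp
  rw [tJ.2, card_inter_eq_sdiff_add X₁ B₁ J] at x2
  have x4 := hD.tight_H₂.2
  rw [card_inter_eq_sdiff_add X₁ B₁ H₂] at x4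
  have x5 : (X₁ \ B₁) ∩ J = (X₁ \ B₁) ∩ H₂ := by
    ext a
    simp only [Finset.mem_inter]
    refine and_congr_right fun ha => ?_
    have := pJ a ha; have := hD.pure_H₁ a ha; tauto
  rw [x5] at x2
  have x6 := card_inter_add_le_card (D := X₁ ∩ B₁) (hS.subset _ hD.tight_H₂.1)
    (hS.subset _ tJ.1)
  have x7 : ((X₁ \ B₁) ∩ H₂).card + ((X₂ \ B₂) ∩ H₂).card + (X₁ ∩ B₁ ∩ H₂ ∩ J).card ≤
      (H₂ ∩ J).card := by
    refine card_add_card_add_card_le ?_ ?_ ?_ ?_ ?_ ?_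
    · exact Finset.disjoint_of_subset_left Finset.inter_subset_left
        (Finset.disjoint_of_subset_right Finset.inter_subset_left dPQ)
    · rw [Finset.disjoint_left]; intro a; simp only [Finset.mem_inter, Finset.mem_sdiff]; tauto
    · rw [Finset.disjoint_left]
      intro a ha hb
      simp only [Finset.mem_inter] at ha hb
      exact (h.symm.mem_left ha.1).2.2.1 hb.1.1.1
    · rw [← x5]; intro a ha
      have ha' := ha
      rw [x5] at ha'
      exact Finset.mem_inter.2 ⟨(Finset.mem_inter.1 ha').2, (Finset.mem_inter.1 ha).2⟩
    · intro a ha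
      rw [Finset.mem_inter] at ha ⊢
      refine ⟨ha.2, ?_⟩
      have haq : a ≠ q := fun hh => qH₂ (hh ▸ ha.2)
      have := pJ' a (Finset.mem_insert_of_mem (Finset.mem_erase.2 ⟨haq, ha.1⟩))
      have := hD.pure_H₂ a ha.1
      tauto
    · intro a; simp only [Finset.mem_inter]; tauto
  -- The overlap forces `|P| ≤ 1` in `card_inter_add_le`, against `2 ≤ 2 * t ≤ |P|`.
  omega

/-- Undoing an exchange that added `f` and adding an element `q` of the first class instead leads
to a doomed pair only if `f ∈ K₁`. -/
lemma mem_of_swap (hS : SplitSystem M C ρ 𝓗 b) (h : ExchangePair M C X₁ X₂ B₁ B₂)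
    (hD : Doomed 𝓗 b X₁ X₂ B₁ B₂ H₁ H₂ K₁ K₂ t) (hfB₁ : f ∈ B₁) (hfX₂ : f ∉ X₂)
    (hfB₂ : f ∉ B₂) (hq : q ∈ X₂ \ B₂) (hqK : q ∈ K₁)
    (hfK : f ∉ K₂)
    (b₂ : M.IsBase (insert f (X₂.erase q) : Finset α))
    (hD' : Doomed 𝓗 b (insert q (X₁.erase f)) (insert f (X₂.erase q)) B₁ B₂ J₁ J₂ L₁ L₂ t') :
    f ∈ K₁ := by
  have mq := h.symm.mem_left hq
  have eP : insert q (X₁.erase f) \ B₁ = X₁ \ B₁ := by grind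
  have eQ : insert f (X₂.erase q) \ B₂ = insert f ((X₂ \ B₂).erase q) := by grind
  have hc := hD.card_classes hS h
  have ht := hD.one_le
  have h2 := hD.two_mul_le_card hS h
  have hρ := h.card_sdiff_add hS
  have qK₂ : q ∉ K₂ := (hD.pure_K₂ q hq).1 hqK
  have pL₁ := hD'.pure_K₁
  have pL₂ := hD'.pure_K₂
  rw [eP] at pL₁
  rw [eQ] at pL₂
  have dPQ : Disjoint (X₁ \ B₁) (X₂ \ B₂) := by
    rw [Finset.disjoint_left]
    exact fun a ha hb => (h.mem_left ha).2.2.1 (h.symm.mem_left hb).1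
  -- Dual to `notMem_of_swap`: now `K₂` stays tight and `K₁` loses `q`, so the partner `L` of `K₂`
  -- in the new structure differs from `K₁` but splits `P` and `Q` without `q` in the same way.
  by_contra hfK₁
  have tK : IsTight 𝓗 b (insert f (X₂.erase q)) K₂ :=
    hD.tight_K₂.exchange mq.1 hfX₂ (iff_of_false qK₂ hfK)
  -- An element of `K₂` outside the new second base identifies `K₂` as one of `L₁, L₂`.
  obtain ⟨p, hp⟩ : ((X₁ \ B₁) ∩ H₁ ∩ K₂).Nonempty := by rw [← Finset.card_pos]; omega
  simp only [Finset.mem_inter] at hp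
  have mp := h.mem_left hp.1.1
  have hp' : p ∉ insert f (X₂.erase q) := by
    rw [Finset.mem_insert, Finset.mem_erase, not_or]
    exact ⟨fun hh => mp.2.1 (hh ▸ hfB₁), fun hh => mp.2.2.1 hh.2⟩
  obtain ⟨L, tL, pL, pL'⟩ : ∃ L, IsTight 𝓗 b (insert f (X₂.erase q)) L ∧
      (∀ a ∈ X₁ \ B₁, (a ∈ K₂ ↔ a ∉ L)) ∧
      ∀ a ∈ insert f ((X₂ \ B₂).erase q), (a ∈ K₂ ↔ a ∉ L) := by
    by_cases hpL : p ∈ L₁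
    · obtain rfl := hS.eq_of_mem_of_mem b₂ hD'.tight_K₁ tK hp' hpL hp.2
      exact ⟨L₂, hD'.tight_K₂, pL₁, pL₂⟩
    · have hpL₂ : p ∈ L₂ := by
        have := pL₁ p hp.1.1
        tauto
      obtain rfl := hS.eq_of_mem_of_mem b₂ hD'.tight_K₂ tK hp' hpL₂ hp.2
      exact ⟨L₁, hD'.tight_K₁, fun a ha => by have := pL₁ a ha; tauto,
        fun a ha => by have := pL₂ a ha; tauto⟩
  have x1 := card_exchange_inter mq.1 hfX₂ K₁
  rw [if_pos hqK, if_neg hfK₁, hD.tight_K₁.2] at x1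
  have hne : K₁ ≠ L := by
    rintro rfl
    have := tL.2
    omega
  have hp := hS.card_inter_add_le K₁ hD.tight_K₁.1 L tL.1 hne
  have hfL : f ∈ L := by
    have := pL' f (Finset.mem_insert_self _ _)
    tauto
  have x2 := card_exchange_inter mq.1 hfX₂ L
  rw [tL.2, if_pos hfL, card_inter_eq_sdiff_add X₂ B₂ L] at x2
  have x4 := hD.tight_K₁.2
  rw [card_inter_eq_sdiff_add X₂ B₂ K₁] at x4
  have x5 : ((X₂ \ B₂) ∩ L).erase q = ((X₂ \ B₂) ∩ K₁).erase q := by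
    ext a
    simp only [Finset.mem_inter, Finset.mem_erase]
    refine and_congr_right fun haq => and_congr_right fun ha => ?_
    have := pL' a (Finset.mem_insert_of_mem (Finset.mem_erase.2 ⟨haq, ha⟩))
    have := hD.pure_K₂ a ha
    tauto
  have x5' := Finset.card_erase_add_one (Finset.mem_inter.2 ⟨hq, hqK⟩)
  have x5'' : (((X₂ \ B₂) ∩ L).erase q).card + (if q ∈ L then 1 else 0) =
      ((X₂ \ B₂) ∩ L).card := by
    split_ifs with hqL
    · exact Finset.card_erase_add_one (Finset.mem_inter.2 ⟨hq, hqL⟩)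
    · rw [Finset.erase_eq_of_notMem]; · rfl
      simp [hqL]
  rw [x5] at x5''
  have x6 := card_inter_add_le_card (D := X₂ ∩ B₂) (hS.subset _ hD.tight_K₁.1)
    (hS.subset _ tL.1)
  have x7 : ((X₁ \ B₁) ∩ K₁).card + (((X₂ \ B₂) ∩ K₁).erase q).card +
      (X₂ ∩ B₂ ∩ K₁ ∩ L).card ≤ (K₁ ∩ L).card := by
    refine card_add_card_add_card_le ?_ ?_ ?_ ?_ ?_ ?_
    · exact Finset.disjoint_of_subset_left Finset.inter_subset_left
        (Finset.disjoint_of_subset_right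
          ((Finset.erase_subset _ _).trans Finset.inter_subset_left) dPQ)
    · rw [Finset.disjoint_left]
      intro a ha hb
      simp only [Finset.mem_inter] at ha hb
      exact (h.mem_left ha.1).2.2.1 hb.1.1.1
    · rw [Finset.disjoint_left]; intro a
      simp only [Finset.mem_inter, Finset.mem_sdiff, Finset.mem_erase]; tauto
    · intro a ha
      rw [Finset.mem_inter] at ha ⊢
      refine ⟨ha.2, ?_⟩
      have := pL a ha.1
      have := hD.pure_K₁ a ha.1
      tauto
    · rw [← x5]
      intro a ha
      have ha' := ha
      rw [x5] at ha'
      simp only [Finset.mem_inter, Finset.mem_erase] at ha ha' ⊢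
      exact ⟨ha'.2.2, ha.2.2⟩
    · intro a; simp only [Finset.mem_inter]; tauto
  have := h.card_inter_inter_eq hS
  omega

end Doomed

end System

end Matroid

/-! ### Monotone sequences obtained from a split system. -/

namespace Matroid

variable {α : Type*} {M : Matroid α}

lemma hasStrictlyMonotoneSeq_zero {A B : Set α × Set α} : M.HasStrictlyMonotoneSeq A B 0 :=
  ⟨fun _ => A, rfl, by simp⟩

lemma HasStrictlyMonotoneSeq.mono {A B : Set α × Set α} {m n : ℕ}
    (h : M.HasStrictlyMonotoneSeq A B n) (hmn : m ≤ n) : M.HasStrictlyMonotoneSeq A B m := by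
  obtain ⟨X, h0, hX⟩ := h
  exact ⟨X, h0, fun i hi => hX i (hi.trans_le hmn)⟩

lemma HasStrictlyMonotoneSeq.cons {A A' B : Set α × Set α} {n : ℕ} (hA : M.SymmExchange A A')
    (hlt : (A'.1 \ B.1).ncard < (A.1 \ B.1).ncard) (h : M.HasStrictlyMonotoneSeq A' B n) :
    M.HasStrictlyMonotoneSeq A B (n + 1) := by
  obtain ⟨X, rfl, hX⟩ := h
  refine ⟨fun i => i.casesOn A X, rfl, fun i hi => ?_⟩
  cases i with
  | zero => exact ⟨hA, hlt⟩
  | succ i => exact hX i (by omega)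

variable [DecidableEq α]

section System

variable {C X X₁ X₂ B₁ B₂ H K H₁ H₂ K₁ K₂ : Finset α} {ρ t : ℕ} {𝓗 : Set (Finset α)}
  {b : Finset α → ℕ} {e f q : α}

/-- If all exchanges at a pair lead to doomed pairs, then an added element that is in `H₁` but not
in `K₂` is in the first class. -/
lemma ExchangePair.mem_class (hS : SplitSystem M C ρ 𝓗 b) (h : ExchangePair M C X₁ X₂ B₁ B₂)
    (he : e ∈ X₁ \ B₁) (hf : f ∈ X₂ \ B₂) (b₁ : M.IsBase (insert f (X₁.erase e) : Finset α))
    (b₂ : M.IsBase (insert e (X₂.erase f) : Finset α))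
    (hall : ∀ e ∈ X₁ \ B₁, ∀ f ∈ X₂ \ B₂, M.IsBase (insert f (X₁.erase e) : Finset α) →
      M.IsBase (insert e (X₂.erase f) : Finset α) →
      IsDoomed 𝓗 b (insert f (X₁.erase e)) (insert e (X₂.erase f)) B₁ B₂)
    (hD : Doomed 𝓗 b (insert f (X₁.erase e)) (insert e (X₂.erase f)) B₁ B₂ H₁ H₂ K₁ K₂ t)
    (hfH : f ∈ H₁) (hfK : f ∉ K₂) : f ∉ H₂ ∧ f ∈ K₁ := by
  have me := h.mem_left he
  have mf := h.symm.mem_left hf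
  have hef : e ≠ f := fun hh => me.2.2.1 (hh ▸ mf.1)
  have hW := h.exchange he hf b₁ b₂
  -- The surplus of the first class provides an element `q` to exchange with `e` in place of `f`.
  -- That exchange is shown to be legal, so it also leads to a doomed pair, and the swap lemmas
  -- compare the two.
  obtain ⟨q, hq⟩ : (((insert e (X₂.erase f)) \ B₂) ∩ H₁ ∩ K₁).Nonempty := by
    have := hD.card_add; have := hD.one_le
    rw [← Finset.card_pos]; omega
  simp only [Finset.mem_inter] at hq
  obtain ⟨⟨hq, hqH⟩, hqK⟩ := hq
  have mq := hW.symm.mem_left hq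
  rw [h.symm.exchange_sdiff hf he, Finset.mem_erase] at hq
  have mq' := h.symm.mem_left hq.2
  have hqe : q ≠ e := fun hh => me.2.2.1 (hh ▸ mq'.1)
  have e₁ : insert q (X₁.erase e) = insert q ((insert f (X₁.erase e)).erase f) := by
    rw [Finset.erase_insert (by simp [mf.2.2.1])]
  have e₂ : insert e (X₂.erase q) = insert f ((insert e (X₂.erase f)).erase q) := by
    ext a; simp only [Finset.mem_insert, Finset.mem_erase]
    by_cases ha : a = f
    · subst ha; simp [mf.1, hq.1.symm]
    · by_cases ha' : a = e
      · subst ha'; simp [hqe.symm]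
      · simp [ha, ha']
  have hfW : f ∉ insert e (X₂.erase f) := by simp [hef.symm]
  have qH₂ : q ∉ H₂ := (hD.pure_H₂ q (by rw [h.symm.exchange_sdiff hf he]; grind)).1 hqH
  have qK₂ : q ∉ K₂ := (hD.pure_K₂ q (by rw [h.symm.exchange_sdiff hf he]; grind)).1 hqK
  -- A blocking hyperedge would contain `q`, so it would be `H₁`, which also contains `f`. Dually
  -- for `c₂` with `K₂`, which misses both.
  have c₁ : M.IsBase (insert q (X₁.erase e) : Finset α) := by
    by_contra hc
    rw [e₁] at hc
    obtain ⟨J, a1, a2, a3, a4⟩ := hS.exists_tight _ b₁ f (by simp) mf.2.2.2.2 q mq.2.2.2.2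
      mq.2.2.1 hc
    rw [hS.eq_of_mem_of_mem b₁ ⟨a1, a2⟩ hD.tight_H₁ mq.2.2.1 a3 hqH] at a4
    exact a4 hfH
  have c₂ : M.IsBase (insert e (X₂.erase q) : Finset α) := by
    by_contra hc
    rw [e₂] at hc
    obtain ⟨J, a1, a2, a3, a4⟩ := hS.exists_tight _ b₂ q mq.1 mq.2.2.2.2 f mf.2.2.2.2 hfW hc
    rw [hS.eq_of_notMem_of_notMem b₂ ⟨a1, a2⟩ hD.tight_K₂ mq.1 mq.2.2.2.2 a4 qK₂] at a3
    exact hfK a3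
  obtain ⟨J₁, J₂, L₁, L₂, t', hD'⟩ := hall e he q hq.2 c₁ c₂
  rw [e₁] at c₁
  rw [e₂] at c₂
  rw [e₁, e₂] at hD'
  have hq' : q ∈ insert e (X₂.erase f) \ B₂ := by
    rw [h.symm.exchange_sdiff hf he]; exact Finset.mem_erase.2 hq
  exact ⟨hD.notMem_of_swap hS hW (by simp) mf.2.2.2.1 hfW mf.2.1 hq' hqH hfH c₁ hD',
    hD.mem_of_swap hS hW mf.2.2.2.1 hfW mf.2.1 hq' hqK hfK c₂ hD'⟩

/-- After the exchange `f` is in the first base and not in the second, so it lies in `H₁ ∪ H₂` and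
not in `K₁ ∩ K₂`. Applying `mem_class` to the structure and to its flip rules out everything except
a proper class for `f`. -/
lemma ExchangePair.pure_of_forall_isDoomed (hS : SplitSystem M C ρ 𝓗 b)
    (h : ExchangePair M C X₁ X₂ B₁ B₂)
    (he : e ∈ X₁ \ B₁) (hf : f ∈ X₂ \ B₂) (b₁ : M.IsBase (insert f (X₁.erase e) : Finset α))
    (b₂ : M.IsBase (insert e (X₂.erase f) : Finset α))
    (hall : ∀ e ∈ X₁ \ B₁, ∀ f ∈ X₂ \ B₂, M.IsBase (insert f (X₁.erase e) : Finset α) →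
      M.IsBase (insert e (X₂.erase f) : Finset α) →
      IsDoomed 𝓗 b (insert f (X₁.erase e)) (insert e (X₂.erase f)) B₁ B₂)
    (hD : Doomed 𝓗 b (insert f (X₁.erase e)) (insert e (X₂.erase f)) B₁ B₂ H₁ H₂ K₁ K₂ t) :
    (f ∈ H₁ ↔ f ∉ H₂) ∧ (f ∈ K₁ ↔ f ∉ K₂) := by
  have me := h.mem_left he
  have mf := h.symm.mem_left hf
  have hef : e ≠ f := fun hh => me.2.2.1 (hh ▸ mf.1)
  have hW := h.exchange he hf b₁ b₂
  have r₁ := h.mem_class hS he hf b₁ b₂ hall hD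
  have r₂ := h.mem_class hS he hf b₁ b₂ hall (hD.flip hS hW)
  have neK : K₁ ≠ K₂ := by
    have h2 := hD.two_mul_le_card hS hW
    have h3 := hD.one_le
    obtain ⟨p, hp⟩ : (insert f (X₁.erase e) \ B₁).Nonempty := by rw [← Finset.card_pos]; omega
    rintro rfl
    have := hD.pure_K₁ p hp
    tauto
  have neH : H₁ ≠ H₂ := by
    have h2 := hD.two_mul_le_card hS hW
    have h3 := hD.one_le
    obtain ⟨p, hp⟩ : (insert f (X₁.erase e) \ B₁).Nonempty := by rw [← Finset.card_pos]; omega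
    rintro rfl
    have := hD.pure_H₁ p hp
    tauto
  have r₃ : f ∈ H₁ ∨ f ∈ H₂ := by
    rw [← Finset.mem_union]
    exact (hS.inter_subset_and_subset_union b₁ hD.tight_H₁ hD.tight_H₂ neH).2
      (Finset.mem_inter.2 ⟨by simp, mf.2.2.2.2⟩)
  have r₄ : ¬ (f ∈ K₁ ∧ f ∈ K₂) := by
    rw [← Finset.mem_inter]
    intro hh
    have := (hS.inter_subset_and_subset_union b₂ hD.tight_K₁ hD.tight_K₂ neK).1 hh
    simp [hef.symm] at this
  clear hall hD hW neK neH me mf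
  tauto

lemma iff_of_complementary {p p' q q' : Prop} (hp : p ↔ ¬ p') (hq : q ↔ ¬ q') (h : p → q)
    (h' : p' → q') : p ↔ q := by
  tauto

/-- A pair that is neither doomed nor equal to the target admits an exchange to such a pair. -/
lemma ExchangePair.exists_exchange (hS : SplitSystem M C ρ 𝓗 b)
    (h : ExchangePair M C X₁ X₂ B₁ B₂) (hne : (X₁ \ B₁).Nonempty)
    (hnd : ¬ IsDoomed 𝓗 b X₁ X₂ B₁ B₂) :
    ∃ e ∈ X₁ \ B₁, ∃ f ∈ X₂ \ B₂, M.IsBase (insert f (X₁.erase e) : Finset α) ∧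
      M.IsBase (insert e (X₂.erase f) : Finset α) ∧
      ¬ IsDoomed 𝓗 b (insert f (X₁.erase e)) (insert e (X₂.erase f)) B₁ B₂ := by
  by_contra hc
  have hall : ∀ e ∈ X₁ \ B₁, ∀ f ∈ X₂ \ B₂, M.IsBase (insert f (X₁.erase e) : Finset α) →
      M.IsBase (insert e (X₂.erase f) : Finset α) →
      IsDoomed 𝓗 b (insert f (X₁.erase e)) (insert e (X₂.erase f)) B₁ B₂ := by
    intro e he f hf b₁ b₂
    by_contra hd
    exact hc ⟨e, he, f, hf, b₁, b₂, hd⟩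
  obtain ⟨e, he, f, hf, b₁, b₂⟩ : ∃ e ∈ X₁ \ B₁, ∃ f ∈ X₂ \ B₂,
      M.IsBase (insert f (X₁.erase e) : Finset α) ∧
      M.IsBase (insert e (X₂.erase f) : Finset α) := by
    by_contra hs
    exact hnd (h.isDoomed_of_stuck hS hne
      (fun e he f hf h1 h2 => hs ⟨e, he, f, hf, h1, h2⟩))
  obtain ⟨H₁, H₂, K₁, K₂, t, hD⟩ := hall e he f hf b₁ b₂
  have me := h.mem_left he
  have mf := h.symm.mem_left hf
  have hW := h.exchange he hf b₁ b₂
  have pf := h.pure_of_forall_isDoomed hS he hf b₁ b₂ hall hD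
  have pe := h.symm.pure_of_forall_isDoomed hS hf he b₂ b₁ (fun f hf e he b₂ b₁ => by
    obtain ⟨_, _, _, _, _, hD'⟩ := hall e he f hf b₁ b₂
    exact ⟨_, _, _, _, _, hD'.symm hS (h.exchange he hf b₁ b₂)⟩) (hD.symm hS hW)
  -- Undoing the exchange gives a base, so no hyperedge tight for the new base may block the reverse
  -- exchange. Together with purity this puts `e` and `f` into the same class, and the doomed
  -- structure transfers back to the original pair.
  have up {Y H : Finset α} {x y : α} (hY : M.IsBase Y) (hx : x ∈ Y) (hy : y ∉ Y)
      (ht : IsTight 𝓗 b (insert y (Y.erase x)) H) (hxH : x ∈ H) : y ∈ H := by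
    refine hS.mem_of_isBase (e := y) (f := x) ht (by simp) ?_ ?_ hxH
    · simp only [Finset.mem_insert, Finset.mem_erase]
      rintro (rfl | hh)
      · exact hy hx
      · exact hh.1 rfl
    · rwa [Finset.erase_insert (by simp [hy]), Finset.insert_erase hx]
  have u₁ := up h.base₁ me.1 mf.2.2.1 hD.tight_H₁
  have u₂ := up h.base₁ me.1 mf.2.2.1 hD.tight_H₂
  have u₃ := up h.base₂ mf.1 me.2.2.1 hD.tight_K₁
  have u₄ := up h.base₂ mf.1 me.2.2.1 hD.tight_K₂
  have eH : e ∈ H₁ ↔ e ∉ H₂ := ⟨fun h1 h2 => pe.2.1 h2 h1, fun h1 => by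
    by_contra h2
    exact h1 (pe.2.2 h2)⟩
  exact hnd ⟨H₁, H₂, K₁, K₂, t, Doomed.of_exchange h he hf hD
    (iff_of_complementary eH pf.1 u₁ u₂) (iff_of_complementary pf.2 pe.1 u₃ u₄).symm
    eH pf.1 pe.1 pf.2⟩

/-- A doomed pair admits an exchange until only `2 * t` elements are left. -/
lemma Doomed.exists_exchange (hS : SplitSystem M C ρ 𝓗 b) (h : ExchangePair M C X₁ X₂ B₁ B₂)
    (hD : Doomed 𝓗 b X₁ X₂ B₁ B₂ H₁ H₂ K₁ K₂ t) (hlt : 2 * t < (X₁ \ B₁).card) :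
    ∃ e ∈ X₁ \ B₁, ∃ f ∈ X₂ \ B₂, M.IsBase (insert f (X₁.erase e) : Finset α) ∧
      M.IsBase (insert e (X₂.erase f) : Finset α) ∧
      Doomed 𝓗 b (insert f (X₁.erase e)) (insert e (X₂.erase f)) B₁ B₂ H₁ H₂ K₁ K₂ t := by
  -- If every class missed `P` or `Q`, the only elements of `P` would be the two surpluses, giving
  -- `|P| = 2 * t`.
  obtain ⟨e, he, f, hf, hH, hK⟩ :
      ∃ e ∈ X₁ \ B₁, ∃ f ∈ X₂ \ B₂, (e ∈ H₁ ↔ f ∈ H₁) ∧ (e ∈ K₁ ↔ f ∈ K₁) := by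
    by_contra hc
    have key {S T : Finset α} (hST : ∀ e ∈ X₁ \ B₁, e ∈ S → e ∈ T → ∀ f ∈ X₂ \ B₂, f ∈ S → f ∈ T →
        (e ∈ H₁ ↔ f ∈ H₁) ∧ (e ∈ K₁ ↔ f ∈ K₁)) :
        ((X₁ \ B₁) ∩ S ∩ T).card = 0 ∨ ((X₂ \ B₂) ∩ S ∩ T).card = 0 := by
      by_contra hn
      simp only [not_or, Finset.card_eq_zero, ← Finset.not_nonempty_iff_eq_empty, not_not] at hn
      obtain ⟨⟨e, he⟩, f, hf⟩ := hn
      simp only [Finset.mem_inter] at he hf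
      exact hc ⟨e, he.1.1, f, hf.1.1, hST e he.1.1 he.1.2 he.2 f hf.1.1 hf.1.2 hf.2⟩
    have k₁ := key (S := H₁) (T := K₁) (fun e _ h1 h2 f _ h3 h4 => by simp [*])
    have k₂ := key (S := H₂) (T := K₂) (fun e he h1 h2 f hf h3 h4 => by
      simp [hD.pure_H₁ e he, hD.pure_H₂ f hf, hD.pure_K₁ e he, hD.pure_K₂ f hf, *])
    have k₃ := key (S := H₁) (T := K₂) (fun e he h1 h2 f hf h3 h4 => by
      simp [hD.pure_K₁ e he, hD.pure_K₂ f hf, *])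
    have k₄ := key (S := H₂) (T := K₁) (fun e he h1 h2 f hf h3 h4 => by
      simp [hD.pure_H₁ e he, hD.pure_H₂ f hf, *])
    have := hD.card_classes hS h
    have := hD.card_add
    have := hD.one_le
    omega
  have me := h.mem_left he
  have mf := h.symm.mem_left hf
  have pe := hD.pure_H₁ e he
  have pf := hD.pure_H₂ f hf
  have pe' := hD.pure_K₁ e he
  have pf' := hD.pure_K₂ f hf
  refine ⟨e, he, f, hf, ?_, ?_, hD.exchange h he hf hH hK⟩
  -- A hyperedge blocking this exchange contains `f`, hence is `H₁` or `H₂`; neither separates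
  -- elements of the same class.
  · by_contra hc
    obtain ⟨J, a1, a2, a3, a4⟩ := hS.exists_tight _ h.base₁ e me.1 me.2.2.2.2 f mf.2.2.2.2
      mf.2.2.1 hc
    by_cases hfH : f ∈ H₁
    · rw [hS.eq_of_mem_of_mem h.base₁ ⟨a1, a2⟩ hD.tight_H₁ mf.2.2.1 a3 hfH] at a4
      exact a4 (hH.2 hfH)
    · have hfH₂ : f ∈ H₂ := by_contra fun h2 => hfH (pf.2 h2)
      rw [hS.eq_of_mem_of_mem h.base₁ ⟨a1, a2⟩ hD.tight_H₂ mf.2.2.1 a3 hfH₂] at a4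
      exact hfH (hH.1 (pe.2 a4))
  · by_contra hc
    obtain ⟨J, a1, a2, a3, a4⟩ := hS.exists_tight _ h.base₂ f mf.1 mf.2.2.2.2 e me.2.2.2.2
      me.2.2.1 hc
    by_cases heK : e ∈ K₁
    · rw [hS.eq_of_mem_of_mem h.base₂ ⟨a1, a2⟩ hD.tight_K₁ me.2.2.1 a3 heK] at a4
      exact a4 (hK.1 heK)
    · have heK₂ : e ∈ K₂ := by_contra fun h2 => heK (pe'.2 h2)
      rw [hS.eq_of_mem_of_mem h.base₂ ⟨a1, a2⟩ hD.tight_K₂ me.2.2.1 a3 heK₂] at a4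
      exact heK (hK.2 (pf'.2 a4))

/-- In a base orderable matroid, the elements that cannot be exchanged correspond to common
elements of the second members. -/
lemma Doomed.two_mul_le_card_inter (hS : SplitSystem M C ρ 𝓗 b)
    (h : ExchangePair M C X₁ X₂ B₁ B₂) (hD : Doomed 𝓗 b X₁ X₂ B₁ B₂ H₁ H₂ K₁ K₂ t)
    (hM : M.IsBaseOrderable) : 2 * t ≤ (X₁ ∩ B₁ ∩ C).card := by
  obtain ⟨φ, hφ⟩ := hM X₁ X₂ h.base₁ h.base₂
  have mem_cases : ∀ e (he : e ∈ X₁ \ B₁),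
      ((φ ⟨e, (h.mem_left he).1⟩ : α) ∈ X₂ ∩ B₂ ∩ C) ∨
      ((φ ⟨e, (h.mem_left he).1⟩ : α) ∈ X₂ \ B₂ ∧
        (e ∈ H₁ → e ∈ K₂ → (φ ⟨e, (h.mem_left he).1⟩ : α) ∈ H₁ ∩ K₂) ∧
        (e ∈ H₂ → e ∈ K₁ → (φ ⟨e, (h.mem_left he).1⟩ : α) ∈ H₂ ∩ K₁)) := by
    intro e he
    have me := h.mem_left he
    obtain ⟨b₁, b₂⟩ := hφ ⟨e, me.1⟩
    have hf : (φ ⟨e, me.1⟩ : α) ∈ X₂ := (φ ⟨e, me.1⟩).2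
    generalize (φ ⟨e, me.1⟩ : α) = f at *
    have hef : e ≠ f := fun hh => me.2.2.1 (hh ▸ hf)
    have b₁ : M.IsBase (insert f (X₁.erase e) : Finset α) := by simpa using b₁
    have b₂ : M.IsBase (insert e (X₂.erase f) : Finset α) := by simpa using b₂
    -- All bases have `ρ` elements in `C`, so an exchange cannot leave `C`.
    have hfC : f ∈ C := by
      by_contra hfC
      have c₁ := hS.card_inter _ h.base₂
      have c₂ := hS.card_inter _ b₂
      have c₃ := card_exchange_inter hf me.2.2.1 C
      rw [c₁, c₂, if_neg hfC, if_pos me.2.2.2.2] at c₃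
      omega
    by_cases hfB : f ∈ B₂
    · exact Or.inl (by simp [hf, hfB, hfC])
    · have hfQ : f ∈ X₂ \ B₂ := Finset.mem_sdiff.2 ⟨hf, hfB⟩
      have mf := h.symm.mem_left hfQ
      have p₁ := hD.pure_H₁ e he
      have p₂ := hD.pure_H₂ f hfQ
      have m₁ := fun hh => hS.mem_of_isBase hD.tight_H₁ me.1 mf.2.2.1 b₁ hh
      have m₂ := fun hh => hS.mem_of_isBase hD.tight_H₂ me.1 mf.2.2.1 b₁ hh
      have m₃ := fun hh => hS.mem_of_isBase hD.tight_K₁ hf me.2.2.1 b₂ hh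
      have m₄ := fun hh => hS.mem_of_isBase hD.tight_K₂ hf me.2.2.1 b₂ hh
      refine Or.inr ⟨hfQ, fun h1 h2 => Finset.mem_inter.2 ⟨?_, m₄ h2⟩,
        fun h1 h2 => Finset.mem_inter.2 ⟨?_, m₃ h2⟩⟩
      · by_contra hh; exact p₁.1 h1 (m₂ (by tauto))
      · by_contra hh; exact (fun h3 => p₁.1 h3 h1) (m₁ (p₂.2 hh))
  have hdis {S : Finset α} (hp : ∀ a ∈ S, (a ∈ H₁ ↔ a ∉ H₂)) :
      (S ∩ H₁ ∩ K₂ ∪ S ∩ H₂ ∩ K₁).card = (S ∩ H₁ ∩ K₂).card + (S ∩ H₂ ∩ K₁).card := by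
    refine Finset.card_union_of_disjoint (Finset.disjoint_left.2 fun a ha hb => ?_)
    simp only [Finset.mem_inter] at ha hb
    exact (hp a ha.1.1).1 ha.1.2 hb.1.2
  have c₁ := hdis hD.pure_H₁
  have c₂ := hdis hD.pure_H₂
  have c₃ := Finset.card_union_le ((X₂ \ B₂) ∩ H₁ ∩ K₂ ∪ (X₂ \ B₂) ∩ H₂ ∩ K₁) (X₂ ∩ B₂ ∩ C)
  -- The bijection injects the two classes where `P` is ahead into the same classes of `Q` together
  -- with the common elements in `C`. The total surplus there is `2 * t`.
  have c₄ : ((X₁ \ B₁) ∩ H₁ ∩ K₂ ∪ (X₁ \ B₁) ∩ H₂ ∩ K₁).card ≤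
      (((X₂ \ B₂) ∩ H₁ ∩ K₂ ∪ (X₂ \ B₂) ∩ H₂ ∩ K₁) ∪ (X₂ ∩ B₂ ∩ C)).card := by
    have mem' : ∀ {e}, e ∈ (X₁ \ B₁) ∩ H₁ ∩ K₂ ∪ (X₁ \ B₁) ∩ H₂ ∩ K₁ → e ∈ X₁ \ B₁ := by
      intro e he
      simp only [Finset.mem_union, Finset.mem_inter] at he
      exact he.elim (fun h => h.1.1) (fun h => h.1.1)
    refine Finset.card_le_card_of_injOn (fun e => if he : e ∈ X₁ then φ ⟨e, he⟩ else e) ?_ ?_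
    · intro e he
      have he' := mem' he
      have hm := mem_cases e he'
      simp only [dif_pos (h.mem_left he').1]
      simp only [Finset.coe_union, Set.mem_union, Finset.mem_coe, Finset.mem_inter] at he hm ⊢
      rcases hm with hm | hm
      · exact Or.inr hm
      · rcases he with he | he
        · have := hm.2.1 he.1.2 he.2
          exact Or.inl (Or.inl ⟨⟨hm.1, this.1⟩, this.2⟩)
        · have := hm.2.2 he.1.2 he.2
          exact Or.inl (Or.inr ⟨⟨hm.1, this.1⟩, this.2⟩)
    · intro e he e' he' hee
      have a1 := (h.mem_left (mem' he)).1
      have a2 := (h.mem_left (mem' he')).1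
      simp only [dif_pos a1, dif_pos a2] at hee
      have := φ.injective (Subtype.ext hee)
      exact congrArg Subtype.val this
  have := hD.card_classes hS h
  have := h.card_inter_inter_eq hS
  omega

end System

section Sequence

variable {C X₁ X₂ B₁ B₂ : Finset α} {ρ : ℕ} {𝓗 : Set (Finset α)} {b : Finset α → ℕ} {e f : α}
  {n : ℕ}

lemma ExchangePair.hasStrictlyMonotoneSeq_cons (h : ExchangePair M C X₁ X₂ B₁ B₂)
    (he : e ∈ X₁ \ B₁) (hf : f ∈ X₂ \ B₂) (b₁ : M.IsBase (insert f (X₁.erase e) : Finset α))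
    (b₂ : M.IsBase (insert e (X₂.erase f) : Finset α))
    (hs : M.HasStrictlyMonotoneSeq ((insert f (X₁.erase e) : Finset α),
      (insert e (X₂.erase f) : Finset α)) (B₁, B₂) n) :
    M.HasStrictlyMonotoneSeq (X₁, X₂) (B₁, B₂) (n + 1) := by
  have me := h.mem_left he
  have mf := h.symm.mem_left hf
  refine hs.cons ⟨h.base₁, h.base₂, e, ?_, f, ?_, ?_, ?_, b₁, b₂⟩ ?_
  · exact ⟨me.1, me.2.2.1⟩
  · exact ⟨mf.1, mf.2.2.1⟩
  · simp
  · simp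
  · have h1 := h.exchange_sdiff he hf
    have h2 := Finset.card_erase_lt_of_mem he
    rw [← h1] at h2
    simpa only [← Finset.coe_sdiff, Set.ncard_coe_finset] using h2

lemma ExchangePair.hasStrictlyMonotoneSeq_of_not_isDoomed (hS : SplitSystem M C ρ 𝓗 b) :
    ∀ (n : ℕ) (X₁ X₂ : Finset α), ExchangePair M C X₁ X₂ B₁ B₂ →
      ¬ IsDoomed 𝓗 b X₁ X₂ B₁ B₂ → (X₁ \ B₁).card = n →
      M.HasStrictlyMonotoneSeq (X₁, X₂) (B₁, B₂) n
  | 0, _, _, _, _, _ => hasStrictlyMonotoneSeq_zero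
  | n + 1, X₁, X₂, h, hnd, hn => by
    obtain ⟨e, he, f, hf, b₁, b₂, hd⟩ :=
      h.exists_exchange hS (Finset.card_pos.1 (by omega)) hnd
    refine h.hasStrictlyMonotoneSeq_cons he hf b₁ b₂
      (hasStrictlyMonotoneSeq_of_not_isDoomed hS n _ _ (h.exchange he hf b₁ b₂) hd ?_)
    rw [h.exchange_sdiff he hf, Finset.card_erase_of_mem he, hn, Nat.add_sub_cancel]

lemma Doomed.hasStrictlyMonotoneSeq (hS : SplitSystem M C ρ 𝓗 b) {H₁ H₂ K₁ K₂ : Finset α} {t : ℕ} :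
    ∀ (n : ℕ) (X₁ X₂ : Finset α), ExchangePair M C X₁ X₂ B₁ B₂ →
      Doomed 𝓗 b X₁ X₂ B₁ B₂ H₁ H₂ K₁ K₂ t → (X₁ \ B₁).card = n + 2 * t →
      M.HasStrictlyMonotoneSeq (X₁, X₂) (B₁, B₂) n
  | 0, _, _, _, _, _ => hasStrictlyMonotoneSeq_zero
  | n + 1, X₁, X₂, h, hD, hn => by
    obtain ⟨e, he, f, hf, b₁, b₂, hd⟩ := hD.exists_exchange hS h (by omega)
    refine h.hasStrictlyMonotoneSeq_cons he hf b₁ b₂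
      (hasStrictlyMonotoneSeq hS n _ _ (h.exchange he hf b₁ b₂) hd ?_)
    rw [h.exchange_sdiff he hf, Finset.card_erase_of_mem he, hn]
    omega

/-- With `c` common elements in `C`, `|P| = ρ - c`, and at most `2 * t ≤ 2 * c` elements are lost.
-/
lemma ExchangePair.hasStrictlyMonotoneSeq (hS : SplitSystem M C ρ 𝓗 b)
    (h : ExchangePair M C X₁ X₂ B₁ B₂) :
    M.HasStrictlyMonotoneSeq (X₁, X₂) (B₁, B₂) (ρ - 3 * (X₁ ∩ B₁ ∩ C).card) := by
  have hc := h.card_sdiff_add hS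
  by_cases hd : IsDoomed 𝓗 b X₁ X₂ B₁ B₂
  · obtain ⟨H₁, H₂, K₁, K₂, t, hD⟩ := hd
    have h1 := hD.le_card_inter hS h
    have h2 := hD.two_mul_le_card hS h
    exact (hD.hasStrictlyMonotoneSeq hS ((X₁ \ B₁).card - 2 * t) X₁ X₂ h (by omega)).mono
      (by omega)
  · exact (hasStrictlyMonotoneSeq_of_not_isDoomed hS _ X₁ X₂ h hd rfl).mono (by omega)

lemma ExchangePair.hasStrictlyMonotoneSeq_of_isBaseOrderable (hS : SplitSystem M C ρ 𝓗 b)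
    (h : ExchangePair M C X₁ X₂ B₁ B₂) (hM : M.IsBaseOrderable) :
    M.HasStrictlyMonotoneSeq (X₁, X₂) (B₁, B₂) (ρ - 2 * (X₁ ∩ B₁ ∩ C).card) := by
  have hc := h.card_sdiff_add hS
  by_cases hd : IsDoomed 𝓗 b X₁ X₂ B₁ B₂
  · obtain ⟨H₁, H₂, K₁, K₂, t, hD⟩ := hd
    have h1 := hD.two_mul_le_card_inter hS h hM
    have h2 := hD.two_mul_le_card hS h
    exact (hD.hasStrictlyMonotoneSeq hS ((X₁ \ B₁).card - 2 * t) X₁ X₂ h (by omega)).mono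
      (by omega)
  · exact (hasStrictlyMonotoneSeq_of_not_isDoomed hS _ X₁ X₂ h hd rfl).mono (by omega)

end Sequence

end Matroid

/-! ### The directions of the base polytope and the connected components. -/

namespace Matroid

variable {α : Type*} {M : Matroid α}

section Linear

/-- The direction of the affine hull of the base polytope. -/
abbrev dirSpace (M : Matroid α) : Submodule ℝ (α → ℝ) := vectorSpan ℝ M.basePolytope

lemma indicator_mem_basePolytope {X : Set α} (hX : M.IsBase X) :
    X.indicator 1 ∈ M.basePolytope :=
  subset_convexHull _ _ ⟨X, hX, rfl⟩

lemma indicator_mem_affineSpan {X : Set α} (hX : M.IsBase X) :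
    X.indicator 1 ∈ affineSpan ℝ M.basePolytope :=
  subset_affineSpan _ _ (indicator_mem_basePolytope hX)

lemma indicator_sub_mem_dirSpace {X Y : Set α} (hX : M.IsBase X) (hY : M.IsBase Y) :
    Y.indicator 1 - X.indicator 1 ∈ M.dirSpace :=
  vsub_mem_vectorSpan ℝ (indicator_mem_basePolytope hY) (indicator_mem_basePolytope hX)

lemma mem_affineSpan_iff {X : Set α} (hX : M.IsBase X) {x : α → ℝ} :
    x ∈ affineSpan ℝ M.basePolytope ↔ x - X.indicator 1 ∈ M.dirSpace := by
  rw [dirSpace, ← direction_affineSpan,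
    ← AffineSubspace.vsub_right_mem_direction_iff_mem (indicator_mem_affineSpan hX) x, vsub_eq_sub]

lemma add_mem_affineSpan {x v : α → ℝ} (hx : x ∈ affineSpan ℝ M.basePolytope)
    (hv : v ∈ M.dirSpace) : x + v ∈ affineSpan ℝ M.basePolytope := by
  rw [dirSpace, ← direction_affineSpan] at hv
  simpa [add_comm] using AffineSubspace.vadd_mem_of_mem_direction hv hx

lemma sub_mem_dirSpace {x y : α → ℝ} (hx : x ∈ affineSpan ℝ M.basePolytope)
    (hy : y ∈ affineSpan ℝ M.basePolytope) : x - y ∈ M.dirSpace := by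
  rw [dirSpace, ← direction_affineSpan]
  exact AffineSubspace.vsub_mem_direction hx hy

lemma coordSum_apply (F : Finset α) (x : α → ℝ) : coordSum F x = ∑ e ∈ F, x e := by
  simp [coordSum, LinearMap.sum_apply]

variable [DecidableEq α] {X Y F : Finset α} {e f : α}

lemma coordSum_indicator (F X : Finset α) :
    coordSum F ((X : Set α).indicator 1) = ((X ∩ F).card : ℝ) := by
  simp [coordSum_apply, Set.indicator_apply, Finset.inter_comm]

lemma coordSum_single (F : Finset α) (a : α) :
    coordSum F (Pi.single a 1) = if a ∈ F then 1 else 0 := by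
  rw [coordSum_apply]
  simp [Pi.single_apply]

lemma indicator_exchange (he : e ∈ X) (hf : f ∉ X) :
    ((insert f (X.erase e) : Finset α) : Set α).indicator (1 : α → ℝ) =
      (X : Set α).indicator 1 + (Pi.single f 1 - Pi.single e 1) := by
  ext a
  by_cases h1 : a = e
  · subst h1
    have : a ≠ f := fun h => hf (h ▸ he)
    simp [this, he]
  · by_cases h2 : a = f
    · subst h2
      simp [hf, h1]
    · simp [Set.indicator_apply, h1, h2]

/-- An element outside a base is spanned by the elements that it can replace. -/
lemma IsBase.mem_closure_of_forall_exchange (hX : M.IsBase X) (hf : f ∈ M.E) (hfX : f ∉ X)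
    {T : Set α} (hT : ∀ e ∈ X, M.IsBase (insert f (X.erase e) : Finset α) → e ∈ M.closure T) :
    f ∈ M.closure T := by
  have hcl : f ∈ M.closure X := by rwa [hX.closure_eq]
  have hC := hX.fundCircuit_isCircuit hf (by simpa using hfX)
  -- The rest of the fundamental circuit spans `f`, and it consists of the elements of `X` that `f`
  -- can replace.
  refine M.closure_subset_closure_of_subset_closure (fun e heC => ?_)
    (hC.mem_closure_sdiff_singleton_of_mem (M.mem_fundCircuit f X))
  have hef : e ≠ f := heC.2
  have heX : e ∈ X := by
    have := M.fundCircuit_subset_insert f X heC.1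
    simpa [hef] using this
  have h1 := (hX.indep.mem_fundCircuit_iff hcl (by simpa using hfX)).1 heC.1
  refine hT e heX ?_
  rw [Finset.coe_insert, Finset.coe_erase, Set.insert_sdiff_singleton_comm hef.symm]
  exact hX.exchange_isBase_of_indep' heX (by simpa using hfX) h1

/-- Since `f` is not spanned by `Y` without `f`, neither are all the elements of `X` that `f` can
replace; any unspanned one serves. -/
lemma IsBase.exists_symm_exchange (hX : M.IsBase X) (hY : M.IsBase Y) (hfY : f ∈ Y)
    (hfX : f ∉ X) : ∃ e ∈ X, e ∉ Y ∧ M.IsBase (insert f (X.erase e) : Finset α) ∧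
      M.IsBase (insert e (Y.erase f) : Finset α) := by
  obtain ⟨e, heX, hb, heY⟩ : ∃ e ∈ X, M.IsBase (insert f (X.erase e) : Finset α) ∧
      e ∉ M.closure ((Y : Set α) \ {f}) := by
    by_contra hc
    push Not at hc
    exact hY.indep.notMem_closure_sdiff_of_mem (e := f) hfY
      (hX.mem_closure_of_forall_exchange (hY.subset_ground hfY) hfX hc)
  have heE : e ∈ M.E := hX.subset_ground heX
  have hef : e ≠ f := fun h => hfX (h ▸ heX)
  refine ⟨e, heX, fun h => heY (M.mem_closure_of_mem' ⟨h, hef⟩ heE), hb, ?_⟩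
  rw [Finset.coe_insert, Finset.coe_erase]
  exact hY.exchange_base_of_notMem_closure (e := f) (f := e) hfY heY heE

/-- A symmetric exchange moves `Y` one step closer to `X`, and its direction is that of an exchange
at `X` itself. Thus exchanges at one fixed base suffice. -/
lemma indicator_sub_mem_of_forall_exchange (S : Submodule ℝ (α → ℝ)) (hX : M.IsBase X)
    (hS : ∀ e ∈ X, ∀ f ∈ M.E, f ∉ X → M.IsBase (insert f (X.erase e) : Finset α) →
      (Pi.single f 1 - Pi.single e 1 : α → ℝ) ∈ S) :
    ∀ (n : ℕ) (Y : Finset α), M.IsBase Y → (Y \ X).card = n →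
      (Y : Set α).indicator 1 - (X : Set α).indicator 1 ∈ S
  | 0, Y, hY, hn => by
    have h1 : Y ⊆ X := by rwa [Finset.card_eq_zero, Finset.sdiff_eq_empty_iff_subset] at hn
    have h2 := hY.eq_of_subset_isBase hX (by exact_mod_cast h1)
    rw [h2, sub_self]
    exact S.zero_mem
  | n + 1, Y, hY, hn => by
    obtain ⟨f, hf⟩ : (Y \ X).Nonempty := by rw [← Finset.card_pos]; omega
    rw [Finset.mem_sdiff] at hf
    obtain ⟨e, heX, heY, h1, h2⟩ := hX.exists_symm_exchange hY hf.1 hf.2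
    have h3 : insert e (Y.erase f) \ X = (Y \ X).erase f := by grind
    have h4 := indicator_sub_mem_of_forall_exchange S hX hS n _ h2 (by
      rw [h3, Finset.card_erase_of_mem (Finset.mem_sdiff.2 hf), hn, Nat.add_sub_cancel])
    rw [indicator_exchange hf.1 heY] at h4
    have h5 := S.add_mem h4 (hS e heX f (hY.subset_ground hf.1) hf.2 h1)
    convert h5 using 1
    abel

variable [M.Finite]

/-- The direction space is spanned by the exchanges at a single base. -/
lemma dirSpace_le (S : Submodule ℝ (α → ℝ)) (hX : M.IsBase X)
    (hS : ∀ e ∈ X, ∀ f ∈ M.E, f ∉ X → M.IsBase (insert f (X.erase e) : Finset α) →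
      (Pi.single f 1 - Pi.single e 1 : α → ℝ) ∈ S) : M.dirSpace ≤ S := by
  have hmem : (X : Set α).indicator (1 : α → ℝ) ∈ {x | ∃ B, M.IsBase B ∧ x = B.indicator 1} :=
    ⟨X, hX, rfl⟩
  rw [dirSpace, basePolytope, ← direction_affineSpan, affineSpan_convexHull, direction_affineSpan,
    vectorSpan_eq_span_vsub_set_right ℝ hmem, Submodule.span_le]
  rintro _ ⟨_, ⟨Y, hY, rfl⟩, rfl⟩
  lift Y to Finset α using M.ground_finite.subset hY.subset_ground
  exact indicator_sub_mem_of_forall_exchange S hX hS _ Y hY rfl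

omit [M.Finite] in
lemma exchange_mem_dirSpace (hX : M.IsBase X) (he : e ∈ X) (hf : f ∉ X)
    (h : M.IsBase (insert f (X.erase e) : Finset α)) :
    (Pi.single f 1 - Pi.single e 1 : α → ℝ) ∈ M.dirSpace := by
  have h1 := indicator_sub_mem_dirSpace hX h
  rwa [indicator_exchange he hf, add_sub_cancel_left] at h1

omit [DecidableEq α] in
lemma exists_finset_isBase (M : Matroid α) [M.Finite] : ∃ X : Finset α, M.IsBase X := by
  obtain ⟨X, hX⟩ := M.exists_isBase
  lift X to Finset α using M.ground_finite.subset hX.subset_ground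
  exact ⟨X, hX⟩

lemma apply_eq_zero_of_notMem_ground {v : α → ℝ} (hv : v ∈ M.dirSpace) {a : α} (ha : a ∉ M.E) :
    v a = 0 := by
  obtain ⟨X, hX⟩ := M.exists_finset_isBase
  have h := dirSpace_le (LinearMap.ker (LinearMap.proj (R := ℝ) (φ := fun _ : α => ℝ) a)) hX
    (fun e he f hf hfX _ => by
      have h1 : a ≠ e := fun h => ha (h ▸ hX.subset_ground he)
      have h2 : a ≠ f := fun h => ha (h ▸ hf)
      simp [LinearMap.mem_ker, h1, h2])
  simpa using h hv

/-- Two elements belong to the same class if the difference of their unit vectors is parallel to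
the base polytope. -/
def SameClass (M : Matroid α) (a b : α) : Prop :=
  (Pi.single a 1 - Pi.single b 1 : α → ℝ) ∈ M.dirSpace

omit [M.Finite] in
lemma SameClass.refl (M : Matroid α) (a : α) : M.SameClass a a := by
  rw [SameClass, sub_self]; exact Submodule.zero_mem _

omit [M.Finite] in
lemma SameClass.symm {a b : α} (h : M.SameClass a b) : M.SameClass b a := by
  have := Submodule.neg_mem _ h
  rwa [neg_sub] at this

omit [M.Finite] in
lemma SameClass.trans {a b c : α} (h : M.SameClass a b) (h' : M.SameClass b c) :
    M.SameClass a c := by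
  have := Submodule.add_mem _ h h'
  rwa [sub_add_sub_cancel] at this

open Classical in
/-- The elements of the ground set in the class of a given element. -/
noncomputable def classFinset (M : Matroid α) [M.Finite] (e : α) : Finset α :=
  M.ground_finite.toFinset.filter (fun a => M.SameClass a e)

lemma mem_classFinset {a e : α} : a ∈ M.classFinset e ↔ a ∈ M.E ∧ M.SameClass a e := by
  simp [classFinset]

/-- A set of elements of the ground set that is a union of classes has constant coordinate sum. -/
lemma coordSum_eq_zero_of_saturated {S : Finset α}
    (hS : ∀ a ∈ M.E, ∀ b ∈ M.E, M.SameClass a b → a ∈ S → b ∈ S) {v : α → ℝ}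
    (hv : v ∈ M.dirSpace) : coordSum S v = 0 := by
  obtain ⟨X, hX⟩ := M.exists_finset_isBase
  have h := dirSpace_le (LinearMap.ker (coordSum S)) hX (fun e he f hf hfX hb => by
      have h1 := exchange_mem_dirSpace hX he hfX hb
      have h2 : e ∈ S ↔ f ∈ S := ⟨hS e (hX.subset_ground he) f hf (SameClass.symm h1),
        hS f hf e (hX.subset_ground he) h1⟩
      simp [LinearMap.mem_ker, coordSum_single, h2])
  simpa using h hv

lemma coordSum_classFinset {v : α → ℝ} (hv : v ∈ M.dirSpace) (e : α) :
    coordSum (M.classFinset e) v = 0 :=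
  coordSum_eq_zero_of_saturated (fun _ _ _ hb hab ha =>
    mem_classFinset.2 ⟨hb, hab.symm.trans (mem_classFinset.1 ha).2⟩) hv

lemma coordSum_ground {v : α → ℝ} (hv : v ∈ M.dirSpace) :
    coordSum M.ground_finite.toFinset v = 0 :=
  coordSum_eq_zero_of_saturated (fun _ _ _ hb _ _ => by simpa using hb) hv

lemma card_inter_classFinset (hX : M.IsBase X) (hY : M.IsBase Y) (e : α) :
    (X ∩ M.classFinset e).card = (Y ∩ M.classFinset e).card := by
  have h1 := coordSum_classFinset (indicator_sub_mem_dirSpace hY hX) e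
  rw [map_sub, coordSum_indicator, coordSum_indicator, sub_eq_zero] at h1
  exact_mod_cast h1

open Classical in
/-- The direction space is closed under restriction to a class. -/
lemma restrict_class_mem_dirSpace {v : α → ℝ} (hv : v ∈ M.dirSpace) (e : α) :
    (fun a => if a ∈ M.classFinset e then v a else 0) ∈ M.dirSpace := by
  obtain ⟨X, hX⟩ := M.exists_finset_isBase
  let ρ : (α → ℝ) →ₗ[ℝ] (α → ℝ) := LinearMap.pi (fun a => if a ∈ M.classFinset e then
    LinearMap.proj a else 0)
  have hρ : ∀ v, ρ v = fun a => if a ∈ M.classFinset e then v a else 0 := by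
    intro v; ext a; simp only [ρ, LinearMap.pi_apply]; split_ifs <;> simp
  have h := dirSpace_le (M.dirSpace.comap ρ) hX (fun x hx f hf hfX hb => by
      have h1 := exchange_mem_dirSpace hX hx hfX hb
      have h3 : SameClass M f x := h1
      rw [Submodule.mem_comap, hρ]
      have h2 : x ∈ M.classFinset e ↔ f ∈ M.classFinset e := by
        rw [mem_classFinset, mem_classFinset]
        exact ⟨fun h => ⟨hf, h3.trans h.2⟩, fun h => ⟨hX.subset_ground hx, h3.symm.trans h.2⟩⟩
      by_cases hx' : x ∈ M.classFinset e
      · convert h1 using 1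
        ext a
        split_ifs with ha
        · rfl
        · have a1 : a ≠ x := fun h => ha (h ▸ hx')
          have a2 : a ≠ f := fun h => ha (h ▸ h2.1 hx')
          simp [a1, a2]
      · convert M.dirSpace.zero_mem using 1
        ext a
        split_ifs with ha
        · have a1 : a ≠ x := fun h => hx' (h ▸ ha)
          have a2 : a ≠ f := fun h => hx' (h2.2 (h ▸ ha))
          simp [a1, a2]
        · rfl)
  have := h hv
  rwa [Submodule.mem_comap, hρ] at this

end Linear

/-! ### Interior points of the ambient polytope. -/

section Interior

variable [M.Finite] {x y : α → ℝ}

/-- A point of the affine hull of the base polytope all of whose non-constant coordinates are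
strictly between `0` and `1`. -/
def IsInner (M : Matroid α) (x : α → ℝ) : Prop :=
  x ∈ affineSpan ℝ M.basePolytope ∧
    ∀ a, (0 < x a ∧ x a < 1) ∨ ∀ v ∈ M.dirSpace, v a = 0

omit [M.Finite] in
lemma mem_Icc_of_fixed {a : α} (hx : x ∈ affineSpan ℝ M.basePolytope)
    (ha : ∀ v ∈ M.dirSpace, v a = 0) : 0 ≤ x a ∧ x a ≤ 1 := by
  obtain ⟨X, hX⟩ := M.exists_isBase
  have h := ha _ ((mem_affineSpan_iff hX).1 hx)
  rw [Pi.sub_apply, sub_eq_zero] at h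
  rw [h]
  by_cases haX : a ∈ X <;> simp [haX]

omit [M.Finite] in
lemma IsInner.mem_ambientPolytope (h : M.IsInner x) : x ∈ M.ambientPolytope := by
  refine ⟨h.1, fun a => ?_, fun a => ?_⟩
  · rcases h.2 a with ha | ha
    · exact ha.1.le
    · exact (mem_Icc_of_fixed h.1 ha).1
  · rcases h.2 a with ha | ha
    · exact ha.2.le
    · exact (mem_Icc_of_fixed h.1 ha).2

/-- Inside the affine hull only finitely many coordinates vary, and their strict bounds persist
nearby; the constant ones agree with those of a base. -/
lemma IsInner.mem_intrinsicInterior (h : M.IsInner x) :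
    x ∈ intrinsicInterior ℝ M.ambientPolytope := by
  classical
  have hQ := h.mem_ambientPolytope
  refine _root_.mem_intrinsicInterior.2 ⟨⟨x, subset_affineSpan _ _ hQ⟩, ?_, rfl⟩
  rw [mem_interior_iff_mem_nhds]
  have hev : ∀ᶠ z : affineSpan ℝ M.ambientPolytope in nhds ⟨x, subset_affineSpan _ _ hQ⟩,
      ∀ a ∈ M.E, (0 < x a ∧ x a < 1) → (0 < (z : α → ℝ) a ∧ (z : α → ℝ) a < 1) := by
    rw [Filter.eventually_all_finite M.ground_finite]
    intro a _
    by_cases ha : 0 < x a ∧ x a < 1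
    · have hc : Continuous fun z : affineSpan ℝ M.ambientPolytope => (z : α → ℝ) a :=
        (continuous_apply a).comp continuous_subtype_val
      have := hc.continuousAt (x := ⟨x, subset_affineSpan _ _ hQ⟩)
      filter_upwards [this.eventually (Ioo_mem_nhds ha.1 ha.2)] with z hz _ using hz
    · exact Filter.Eventually.of_forall fun z hz => absurd hz ha
  filter_upwards [hev] with z hz
  have hz' : (z : α → ℝ) ∈ affineSpan ℝ M.basePolytope := by
    have h1 : affineSpan ℝ M.ambientPolytope ≤ affineSpan ℝ M.basePolytope := by
      rw [affineSpan_le]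
      exact Set.inter_subset_left
    exact h1 z.2
  have hb : ∀ a, 0 ≤ (z : α → ℝ) a ∧ (z : α → ℝ) a ≤ 1 := by
    intro a
    by_cases haE : a ∈ M.E
    · rcases h.2 a with ha | ha
      · exact ⟨(hz a haE ha).1.le, (hz a haE ha).2.le⟩
      · exact mem_Icc_of_fixed hz' ha
    · exact mem_Icc_of_fixed hz' (fun v hv => apply_eq_zero_of_notMem_ground hv haE)
  exact ⟨hz', fun a => (hb a).1, fun a => (hb a).2⟩

omit [M.Finite] in
lemma IsInner.combo (hx : M.IsInner x) (hy : y ∈ M.ambientPolytope) {s t : ℝ} (hs : 0 < s)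
    (ht : 0 ≤ t) (hst : s + t = 1) : M.IsInner (s • x + t • y) := by
  refine ⟨(affineSpan ℝ M.basePolytope).convex hx.1 hy.1 hs.le ht hst, fun a => ?_⟩
  rcases hx.2 a with ha | ha
  · left
    have h1 := hy.2.1 a
    have h2 := hy.2.2 a
    simp only [Pi.zero_apply, Pi.one_apply] at h1 h2
    simp only [Pi.add_apply, Pi.smul_apply, smul_eq_mul]
    constructor
    · have := mul_pos hs ha.1; have := mul_nonneg ht h1; linarith
    · have := mul_lt_mul_of_pos_left ha.2 hs; have := mul_le_mul_of_nonneg_left h2 ht; linarith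
  · exact Or.inr ha

omit [M.Finite] in
lemma indicator_mem_ambientPolytope {X : Set α} (hX : M.IsBase X) :
    X.indicator 1 ∈ M.ambientPolytope :=
  ⟨indicator_mem_affineSpan hX, Set.indicator_nonneg (fun _ _ => zero_le_one),
    Set.indicator_le_self' (fun _ _ => zero_le_one)⟩

end Interior

end Matroid

/-! ### Exchange cuts and the facets that they define. -/

namespace Matroid

variable {α : Type*} [DecidableEq α] {M : Matroid α} {X Y F : Finset α} {e f : α}

/-- A set `F` that contains `f` but not `e` and blocks the exchange of `e` and `f` at the base
`X`. The complement of `F` is connected by exchanges at `X`, and any element of `X ∩ F` that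
can be exchanged with an element outside `F` can also be exchanged with `f`. -/
structure ExchangeCut (M : Matroid α) (X F : Finset α) (e f : α) : Prop where
  base : M.IsBase X
  e_mem : e ∈ X
  e_notMem : e ∉ F
  f_mem : f ∈ F
  f_notMem : f ∉ X
  subset_ground : (F : Set α) ⊆ M.E
  same : M.SameClass e f
  closed : ∀ a ∈ X, a ∉ F → ∀ b ∈ F, b ∉ X → ¬ M.IsBase (insert b (X.erase a) : Finset α)
  crossing : ∀ a ∈ X, a ∈ F → ∀ b ∈ M.E, b ∉ F → b ∉ X →
    M.IsBase (insert b (X.erase a) : Finset α) → M.IsBase (insert f (X.erase a) : Finset α)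
  connected : ∀ S : Submodule ℝ (α → ℝ), (∀ a ∈ X, ∀ b ∈ M.E, b ∉ X →
    M.IsBase (insert b (X.erase a) : Finset α) → (a ∈ F ↔ b ∈ F) →
    (Pi.single b 1 - Pi.single a 1 : α → ℝ) ∈ S) →
    ∀ b ∈ M.E, b ∉ F → (Pi.single b 1 - Pi.single e 1 : α → ℝ) ∈ S
  exists_exchange : ∀ b ∈ M.E, b ∉ F → b ∉ X →
    ∃ a ∈ X, a ∉ F ∧ M.IsBase (insert b (X.erase a) : Finset α)

lemma exists_exchangeCut [M.Finite] (hX : M.IsBase X) (he : e ∈ X) (hf : f ∈ M.E) (hfX : f ∉ X)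
    (hbad : ¬ M.IsBase (insert f (X.erase e) : Finset α)) (hef : M.SameClass e f) :
    ∃ F, M.ExchangeCut X F e f := by
  classical
  let A : α → α → Prop := fun a b =>
    (a ∈ X ∧ b ∈ M.E ∧ b ∉ X ∧ M.IsBase (insert b (X.erase a) : Finset α)) ∨
    (b ∈ X ∧ a ∈ M.E ∧ a ∉ X ∧ M.IsBase (insert a (X.erase b) : Finset α))
  -- `N` is `f` with its neighbours in the exchange graph `A` of `X`, and `R` is the component of
  -- `e` after deleting `N`. An edge leaving `R` must end in a neighbour of `f`, which yields
  -- `closed` and `crossing`.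
  let N : α → Prop := fun a => a = f ∨ (a ∈ X ∧ M.IsBase (insert f (X.erase a) : Finset α))
  let T : α → α → Prop := fun a b => ¬ N a ∧ ¬ N b ∧ A a b
  let R : α → Prop := Relation.ReflTransGen T e
  have hNe : ¬ N e := by
    rintro (h | h)
    · exact hfX (h ▸ he)
    · exact hbad h.2
  have hRN : ∀ b, R b → ¬ N b := by
    intro b hb
    rcases hb.cases_tail with h | ⟨c, -, h⟩
    · rwa [h]
    · exact h.2.1
  let F := M.ground_finite.toFinset.filter (fun a => ¬ R a)
  have hF : ∀ {a}, a ∈ F ↔ a ∈ M.E ∧ ¬ R a := by intro a; simp [F]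
  have hF' : ∀ {a}, a ∈ M.E → a ∉ F → R a := by
    intro a ha h
    by_contra hR
    exact h (hF.2 ⟨ha, hR⟩)
  refine ⟨F, hX, he, ?_, ?_, hfX, fun a ha => (hF.1 ha).1, hef, ?_, ?_, ?_, ?_⟩
  · exact fun h => (hF.1 h).2 Relation.ReflTransGen.refl
  · exact hF.2 ⟨hf, fun h => hRN f h (Or.inl rfl)⟩
  · intro a ha haF b hbF hbX hb
    have hRa := hF' (hX.subset_ground ha) haF
    by_cases hNb : N b
    · rcases hNb with rfl | h
      · exact hRN a hRa (Or.inr ⟨ha, hb⟩)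
      · exact hbX h.1
    · exact (hF.1 hbF).2 (hRa.tail ⟨hRN a hRa, hNb, Or.inl ⟨ha, (hF.1 hbF).1, hbX, hb⟩⟩)
  · intro a ha haF b hbE hbF hbX hb
    have hRb := hF' hbE hbF
    by_cases hNa : N a
    · rcases hNa with rfl | h
      · exact absurd ha hfX
      · exact h.2
    · exact absurd (hRb.tail ⟨hRN b hRb, hNa, Or.inr ⟨ha, hbE, hbX, hb⟩⟩) (hF.1 haF).2
  · intro S hS b hbE hbF
    have hRb := hF' hbE hbF
    clear hbE hbF
    induction hRb with
    | refl => rw [sub_self]; exact S.zero_mem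
    | tail hc hcb ih =>
      rename_i c d
      have hd := hc.tail hcb
      have hcF : c ∉ F := fun h => (hF.1 h).2 hc
      have hdF : d ∉ F := fun h => (hF.1 h).2 hd
      rw [← sub_add_sub_cancel (Pi.single d 1 : α → ℝ) (Pi.single c 1)]
      refine S.add_mem ?_ ih
      rcases hcb.2.2 with h | h
      · exact hS c h.1 d h.2.1 h.2.2.1 h.2.2.2 (iff_of_false hcF hdF)
      · rw [← neg_sub]
        exact S.neg_mem (hS d h.1 c h.2.1 h.2.2.1 h.2.2.2 (iff_of_false hdF hcF))
  · intro b hbE hbF hbX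
    have hRb := hF' hbE hbF
    rcases hRb.cases_tail with h | ⟨c, hc, h⟩
    · exact absurd (h ▸ he) hbX
    · rcases h.2.2 with h' | h'
      · exact ⟨c, h'.1, fun h => (hF.1 h).2 hc, h'.2.2.2⟩
      · exact absurd h'.1 hbX

/-- The face of the base polytope on which `x(F)` attains the rank of `F`. -/
def rankFace (M : Matroid α) (F : Finset α) : Set (α → ℝ) :=
  {x ∈ M.basePolytope | coordSum F x = M.natRk F}

lemma card_inter_le_natRk (hY : M.IsBase Y) (F : Finset α) : (Y ∩ F).card ≤ M.natRk F := by
  have h1 : M.Indep ((Y ∩ F : Finset α) : Set α) :=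
    hY.indep.subset (by simp)
  have h2 := h1.encard_le_eRk_of_subset (X := F) (by simp)
  rw [Set.encard_coe_eq_coe_finsetCard] at h2
  have h3 : M.eRk (F : Set α) ≠ ⊤ := by
    have := M.eRk_le_encard (F : Set α)
    rw [Set.encard_coe_eq_coe_finsetCard] at this
    exact ne_top_of_le_ne_top (ENat.natCast_ne_top _) this
  rw [natRk, ← ENat.natCast_le_natCast, ENat.natCast_toNat h3]
  exact h2

namespace ExchangeCut

/-- By `closed`, an element of `F` outside `X` can only replace elements of `X ∩ F`, so these span
it. -/
lemma subset_closure (h : M.ExchangeCut X F e f) : (F : Set α) ⊆ M.closure (X ∩ F : Finset α) := by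
  intro b hb
  by_cases hbX : b ∈ X
  · exact M.mem_closure_of_mem' (by simp [hbX, Finset.mem_coe.1 hb]) (h.subset_ground hb)
  · refine h.base.mem_closure_of_forall_exchange (h.subset_ground hb) hbX (fun a ha hab => ?_)
    have haF : a ∈ F := by
      by_contra haF
      exact h.closed a ha haF b hb hbX hab
    exact M.mem_closure_of_mem' (by simp [ha, haF]) (h.base.subset_ground ha)

lemma isBasis (h : M.ExchangeCut X F e f) : M.IsBasis (X ∩ F : Finset α) F :=
  (h.base.indep.subset (by simp)).isBasis_of_subset_of_subset_closure (by simp) h.subset_closure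

lemma natRk_eq (h : M.ExchangeCut X F e f) : M.natRk F = (X ∩ F).card := by
  rw [natRk, ← h.isBasis.encard_eq_eRk, Set.encard_coe_eq_coe_finsetCard, ENat.toNat_natCast]

/-- An element `b` outside both `F` and `X` can replace some `a ∈ X` outside `F`, so `b` together
with `X ∩ F` extends to a base and `b` is not spanned by `X ∩ F`. -/
lemma isFlat (h : M.ExchangeCut X F e f) : M.IsFlat (F : Set α) := by
  rw [isFlat_iff_closure_eq, ← h.isBasis.closure_eq_closure]
  refine subset_antisymm (fun b hb => ?_) h.subset_closure
  have hbE := M.mem_ground_of_mem_closure hb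
  by_contra hbF
  rw [Finset.mem_coe] at hbF
  by_cases hbX : b ∈ X
  · refine h.base.indep.notMem_closure_sdiff_of_mem (e := b) hbX
      (M.closure_subset_closure ?_ hb)
    intro a ha
    simp only [Finset.coe_inter, Set.mem_inter_iff, Finset.mem_coe] at ha
    exact ⟨ha.1, fun hab => hbF ((show a = b from hab) ▸ ha.2)⟩
  · obtain ⟨a, haX, haF, hab⟩ := h.exists_exchange b hbE hbF hbX
    refine hab.indep.notMem_closure_sdiff_of_mem (e := b) (by simp)
      (M.closure_subset_closure ?_ hb)
    intro c hc
    simp only [Finset.coe_inter, Set.mem_inter_iff, Finset.mem_coe] at hc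
    refine ⟨?_, fun hcb => hbF ((show c = b from hcb) ▸ hc.2)⟩
    simp only [Finset.coe_insert, Finset.coe_erase]
    exact Or.inr ⟨hc.1, fun hca => haF ((show c = a from hca) ▸ hc.2)⟩

lemma indicator_mem_rankFace (h : M.ExchangeCut X F e f) : (X : Set α).indicator 1 ∈ M.rankFace F :=
  ⟨indicator_mem_basePolytope h.base, by rw [coordSum_indicator, h.natRk_eq]⟩

lemma card_exchange_inter_eq (h : M.ExchangeCut X F e f) {a b : α} (ha : a ∈ X) (hb : b ∉ X)
    (hF : a ∈ F ↔ b ∈ F) : (insert b (X.erase a) ∩ F).card = M.natRk F := by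
  have h1 := card_exchange_inter ha hb F
  rw [h.natRk_eq]
  by_cases haF : a ∈ F
  · rw [if_pos haF, if_pos (hF.1 haF)] at h1; omega
  · rw [if_neg haF, if_neg (fun hh => haF (hF.2 hh))] at h1; omega

lemma single_sub_single_mem (h : M.ExchangeCut X F e f) {a b : α} (ha : a ∈ X) (hb : b ∉ X)
    (hab : M.IsBase (insert b (X.erase a) : Finset α)) (hF : a ∈ F ↔ b ∈ F) :
    (Pi.single b 1 - Pi.single a 1 : α → ℝ) ∈ vectorSpan ℝ (M.rankFace F) := by
  have h2 : ((insert b (X.erase a) : Finset α) : Set α).indicator 1 ∈ M.rankFace F :=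
    ⟨indicator_mem_basePolytope hab, by
      rw [coordSum_indicator, h.card_exchange_inter_eq ha hb hF]⟩
  have := vsub_mem_vectorSpan ℝ h2 h.indicator_mem_rankFace
  rwa [indicator_exchange ha hb, vsub_eq_sub, add_sub_cancel_left] at this

omit [DecidableEq α] in
lemma vectorSpan_rankFace_le_dirSpace (M : Matroid α) (F : Finset α) :
    vectorSpan ℝ (M.rankFace F) ≤ M.dirSpace :=
  vectorSpan_mono ℝ (Set.sep_subset _ _)

omit [DecidableEq α] in
lemma vectorSpan_rankFace_le_ker (M : Matroid α) (F : Finset α) :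
    vectorSpan ℝ (M.rankFace F) ≤ LinearMap.ker (coordSum F) := by
  rw [vectorSpan_def, Submodule.span_le]
  rintro _ ⟨x, hx, y, hy, rfl⟩
  simp [hx.2, hy.2]

/-- The exchanges that preserve the intersection size with `F` span a hyperplane of the
direction space. -/
lemma dirSpace_le_sup [M.Finite] (h : M.ExchangeCut X F e f) (S : Submodule ℝ (α → ℝ))
    (hS : ∀ a ∈ X, ∀ b ∈ M.E, b ∉ X → M.IsBase (insert b (X.erase a) : Finset α) →
      (a ∈ F ↔ b ∈ F) → (Pi.single b 1 - Pi.single a 1 : α → ℝ) ∈ S) :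
    M.dirSpace ≤ S ⊔ Submodule.span ℝ {(Pi.single f 1 - Pi.single e 1 : α → ℝ)} := by
  refine dirSpace_le _ h.base (fun a ha b hb hbX hab => ?_)
  by_cases hF : a ∈ F ↔ b ∈ F
  · exact Submodule.mem_sup_left (hS a ha b hb hbX hab hF)
  · by_cases haF : a ∈ F
    · have hbF : b ∉ F := fun hh => hF (iff_of_true haF hh)
      have h1 := hS a ha f (h.subset_ground h.f_mem) h.f_notMem
        (h.crossing a ha haF b hb hbF hbX hab) (iff_of_true haF h.f_mem)
      have h2 := h.connected S hS b hb hbF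
      -- For a crossing exchange, with elements standing for their unit vectors, `b - a = (b - e) +
      -- (f - a) - (f - e)`; the first two terms preserve `F`.
      have h3 := Submodule.sub_mem _ (Submodule.mem_sup_left (S.add_mem h2 h1))
        (Submodule.mem_sup_right (S := S) (Submodule.mem_span_singleton_self
          (Pi.single f 1 - Pi.single e 1 : α → ℝ)))
      convert h3 using 1
      abel
    · have hbF : b ∈ F := by
        by_contra hh
        exact hF (iff_of_false haF hh)
      exact absurd hab (h.closed a ha haF b hbF hbX)

lemma coordSum_single_sub_single (h : M.ExchangeCut X F e f) :
    coordSum F (Pi.single f 1 - Pi.single e 1) = 1 := by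
  rw [map_sub, coordSum_single, coordSum_single, if_pos h.f_mem, if_neg h.e_notMem, sub_zero]

omit [DecidableEq α] in
lemma finiteDimensional_dirSpace (M : Matroid α) [M.Finite] : FiniteDimensional ℝ M.dirSpace := by
  rw [dirSpace, basePolytope, ← direction_affineSpan, affineSpan_convexHull, direction_affineSpan]
  refine finiteDimensional_vectorSpan_of_finite ℝ ((M.ground_finite.finite_subsets.image
    (fun B => B.indicator (1 : α → ℝ))).subset ?_)
  rintro _ ⟨B, hB, rfl⟩
  exact ⟨B, hB.subset_ground, rfl⟩

/-- The directions of the face, together with the single direction from `e` to `f`, span `dirSpace`.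
That direction changes `x(F)` by one, so it is not in the face. -/
lemma isFlacet [M.Finite] (h : M.ExchangeCut X F e f) : M.IsFlacet F := by
  refine ⟨h.isFlat, ⟨_, h.indicator_mem_rankFace⟩, ?_⟩
  change Module.finrank ℝ (vectorSpan ℝ (M.rankFace F)) + 1 = Module.finrank ℝ M.dirSpace
  have hv : (Pi.single f 1 - Pi.single e 1 : α → ℝ) ≠ 0 := by
    intro h0
    have := h.coordSum_single_sub_single
    rw [h0, map_zero] at this
    exact zero_ne_one this
  have hsup : M.dirSpace = vectorSpan ℝ (M.rankFace F) ⊔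
      Submodule.span ℝ {(Pi.single f 1 - Pi.single e 1 : α → ℝ)} :=
    le_antisymm (h.dirSpace_le_sup _ fun _ ha _ _ hbX hab hF =>
      h.single_sub_single_mem ha hbX hab hF) (sup_le (vectorSpan_rankFace_le_dirSpace M F) (by
      rw [Submodule.span_singleton_le_iff_mem]
      exact h.same.symm))
  have hdis : vectorSpan ℝ (M.rankFace F) ⊓
      Submodule.span ℝ {(Pi.single f 1 - Pi.single e 1 : α → ℝ)} = ⊥ := by
    rw [← disjoint_iff, Submodule.disjoint_span_singleton' hv]
    intro hm
    have := vectorSpan_rankFace_le_ker M F hm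
    rw [LinearMap.mem_ker, h.coordSum_single_sub_single] at this
    exact one_ne_zero this
  have := finiteDimensional_dirSpace M
  have := Submodule.finiteDimensional_of_le (vectorSpan_rankFace_le_dirSpace M F)
  have hr := Submodule.finrank_sup_add_finrank_inf_eq (vectorSpan ℝ (M.rankFace F))
    (Submodule.span ℝ {(Pi.single f 1 - Pi.single e 1 : α → ℝ)})
  rw [hdis, finrank_bot, ← hsup, finrank_span_singleton hv] at hr
  omega

/-- If all bases that attain the rank of `F` have the same intersection size with `G`, then `G`
defines a multiple of the functional of `F`. -/
lemma exists_smul [M.Finite] (h : M.ExchangeCut X F e f) {G : Finset α} {c : ℕ}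
    (hG : ∀ Y : Finset α, M.IsBase Y → (Y ∩ F).card = M.natRk F → (Y ∩ G).card = c) :
    ∃ s : ℝ, ∀ v ∈ M.dirSpace, coordSum G v = s * coordSum F v := by
  refine ⟨coordSum G (Pi.single f 1 - Pi.single e 1), fun v hv => ?_⟩
  obtain ⟨w, hw, u, hu, rfl⟩ := Submodule.mem_sup.1 (h.dirSpace_le_sup
    (LinearMap.ker (coordSum F) ⊓ LinearMap.ker (coordSum G)) (fun a ha b _ hbX hab hF => by
      have h1 := hG _ hab (h.card_exchange_inter_eq ha hbX hF)
      have h2 : coordSum G (((insert b (X.erase a) : Finset α) : Set α).indicator 1) =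
          coordSum G ((X : Set α).indicator 1) := by
        rw [coordSum_indicator, coordSum_indicator, h1, hG X h.base h.natRk_eq.symm]
      rw [indicator_exchange ha hbX, map_add, add_eq_left] at h2
      exact ⟨vectorSpan_rankFace_le_ker M F (h.single_sub_single_mem ha hbX hab hF), h2⟩) hv)
  obtain ⟨t, rfl⟩ := Submodule.mem_span_singleton.1 hu
  obtain ⟨h1, h2⟩ := Submodule.mem_inf.1 hw
  rw [LinearMap.mem_ker] at h1 h2
  rw [map_add, map_add, map_smul, map_smul, h1, h2, h.coordSum_single_sub_single]
  simp [mul_comm]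

/-- The face of an exchange cut contains a point in the interior of the ambient polytope. -/
lemma exists_isInner [M.Finite] (h : M.ExchangeCut X F e f) :
    ∃ u, M.IsInner u ∧ coordSum F u = M.natRk F := by
  classical
  let 𝓕 : Finset (Finset α) := M.ground_finite.toFinset.powerset.filter
    (fun Y => M.IsBase Y ∧ (Y ∩ F).card = M.natRk F)
  have hmem : ∀ {Y}, Y ∈ 𝓕 ↔ M.IsBase Y ∧ (Y ∩ F).card = M.natRk F := by
    intro Y
    simp only [𝓕, Finset.mem_filter, Finset.mem_powerset, and_iff_right_iff_imp, and_imp]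
    intro hY _ a ha
    simpa using hY.subset_ground ha
  have hX : X ∈ 𝓕 := hmem.2 ⟨h.base, h.natRk_eq.symm⟩
  have hc : 0 < (𝓕.card : ℝ) := by exact_mod_cast Finset.card_pos.2 ⟨X, hX⟩
  let w : ℝ := (𝓕.card : ℝ)⁻¹
  have hw : 0 < w := inv_pos.2 hc
  have hsum : ∑ Y ∈ 𝓕, w = 1 := by
    rw [Finset.sum_const, nsmul_eq_mul]
    exact mul_inv_cancel₀ hc.ne'
  -- The average of all bases tight for `F` is fractional wherever two of them differ.
  let u : α → ℝ := ∑ Y ∈ 𝓕, w • (Y : Set α).indicator 1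
  have hu : u ∈ M.basePolytope :=
    (convex_convexHull ℝ _).sum_mem (fun _ _ => hw.le) hsum
      (fun Y hY => indicator_mem_basePolytope (hmem.1 hY).1)
  have hua : ∀ a, u a = ∑ Y ∈ 𝓕, w * (Y : Set α).indicator 1 a := by
    intro a
    simp [u, Finset.sum_apply]
  refine ⟨u, ⟨subset_affineSpan _ _ hu, fun a => ?_⟩, ?_⟩
  · by_cases ha : ∃ c ∈ X, ∃ d ∈ M.E, d ∉ X ∧ M.IsBase (insert d (X.erase c) : Finset α) ∧
        (c ∈ F ↔ d ∈ F) ∧ (a = c ∨ a = d)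
    · left
      obtain ⟨c, hcX, d, hd, hdX, hcd, hF, ha⟩ := ha
      have hZ : insert d (X.erase c) ∈ 𝓕 := hmem.2 ⟨hcd, h.card_exchange_inter_eq hcX hdX hF⟩
      obtain ⟨Y, hY, haY, Z, hZ, haZ⟩ : ∃ Y ∈ 𝓕, a ∈ Y ∧ ∃ Z ∈ 𝓕, a ∉ Z := by
        rcases ha with rfl | rfl
        · refine ⟨X, hX, hcX, _, hZ, ?_⟩
          have : a ≠ d := fun hh => hdX (hh ▸ hcX)
          simp [this]
        · exact ⟨_, hZ, by simp, X, hX, hdX⟩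
      rw [hua]
      constructor
      · refine Finset.sum_pos' (fun Y _ => mul_nonneg hw.le ?_) ⟨Y, hY, ?_⟩
        · exact Set.indicator_nonneg (fun _ _ => zero_le_one) a
        · simp [haY, hw]
      · rw [← hsum]
        refine Finset.sum_lt_sum (fun Y _ => ?_) ⟨Z, hZ, ?_⟩
        · by_cases haY : a ∈ Y <;> simp [haY, hw.le]
        · simp [haZ, hw]
    -- A coordinate that no `F`-preserving exchange at `X` moves is moved by no exchange at all,
    -- because `crossing` and `exists_exchange` replace a crossing exchange by an `F`-preserving
    -- one.
    · right
      intro v hv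
      have hle := dirSpace_le (LinearMap.ker (LinearMap.proj (R := ℝ) (φ := fun _ : α => ℝ) a))
        h.base (fun c hc d hd hdX hcd => by
          by_cases hacd : a = c ∨ a = d
          · exfalso
            by_cases hF : c ∈ F ↔ d ∈ F
            · exact ha ⟨c, hc, d, hd, hdX, hcd, hF, hacd⟩
            · by_cases hcF : c ∈ F
              · have hdF : d ∉ F := fun hh => hF (iff_of_true hcF hh)
                rcases hacd with rfl | rfl
                · exact ha ⟨a, hc, f, h.subset_ground h.f_mem, h.f_notMem,
                    h.crossing a hc hcF d hd hdF hdX hcd, iff_of_true hcF h.f_mem, Or.inl rfl⟩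
                · obtain ⟨c', hc', hc'F, hb⟩ := h.exists_exchange a hd hdF hdX
                  exact ha ⟨c', hc', a, hd, hdX, hb, iff_of_false hc'F hdF, Or.inr rfl⟩
              · have hdF : d ∈ F := by
                  by_contra hh
                  exact hF (iff_of_false hcF hh)
                exact h.closed c hc hcF d hdF hdX hcd
          · rw [not_or] at hacd
            simp [LinearMap.mem_ker, hacd.1, hacd.2])
      simpa using hle hv
  · have h1 : ∀ Y ∈ 𝓕, coordSum F (w • (Y : Set α).indicator 1) = w * M.natRk F := by
      intro Y hY
      rw [map_smul, coordSum_indicator, (hmem.1 hY).2, smul_eq_mul]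
    rw [map_sum, Finset.sum_congr rfl h1, ← Finset.sum_mul, hsum, one_mul]

end ExchangeCut

end Matroid

/-! ### Exchange cuts define splits. -/

namespace Matroid

variable {α : Type*} {M : Matroid α} {F : Finset α} {e f : α}

section ExtremePoints

variable {x : α → ℝ}

lemma apply_eq_zero_of_mem_affineSpan [M.Finite] (hx : x ∈ affineSpan ℝ M.basePolytope) {a : α}
    (ha : a ∉ M.E) : x a = 0 := by
  classical
  obtain ⟨X, hX⟩ := M.exists_isBase
  have h := apply_eq_zero_of_notMem_ground ((mem_affineSpan_iff hX).1 hx) ha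
  rw [Pi.sub_apply, sub_eq_zero] at h
  rw [h, Set.indicator_of_notMem (fun hh => ha (hX.subset_ground hh))]

lemma mem_extremePoints_of_forall_eq_zero_or_one (hx : x ∈ M.ambientPolytope)
    (h01 : ∀ a, x a = 0 ∨ x a = 1) : x ∈ M.ambientPolytope.extremePoints ℝ := by
  rw [mem_extremePoints_iff_left]
  refine ⟨hx, fun y hy z hz hyz => ?_⟩
  obtain ⟨s, t, hs, ht, hst, rfl⟩ := hyz
  ext a
  have y0 := hy.2.1 a
  have y1 := hy.2.2 a
  have z0 := hz.2.1 a
  have z1 := hz.2.2 a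
  simp only [Pi.zero_apply, Pi.one_apply] at y0 y1 z0 z1
  have ha := h01 a
  simp only [Pi.add_apply, Pi.smul_apply, smul_eq_mul] at ha ⊢
  obtain rfl : t = 1 - s := by linarith
  rcases ha with ha | ha
  · have h1 := mul_nonneg hs.le y0
    have h2 := mul_nonneg ht.le z0
    have h3 : s * y a = 0 := by linarith
    rw [ha]
    exact (mul_eq_zero.1 h3).resolve_left hs.ne'
  · have h1 := mul_le_mul_of_nonneg_left y1 hs.le
    have h2 := mul_le_mul_of_nonneg_left z1 ht.le
    have h3 : s * y a = s * 1 := by linarith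
    rw [ha]
    exact mul_left_cancel₀ hs.ne' h3

variable [DecidableEq α]

/-- With two fractional coordinates in a class, small shifts from one to the other in both
directions stay in the cell, so the point is not extreme. On the hyperplane this needs `a` and `b`
on the same side of `F`; elsewhere the constraint is slack, which is what the neighbourhood
condition on `I` says. -/
lemma not_fractional_of_mem_extremePoints {I : Set ℝ} {c : ℝ}
    (hI : ∀ s ∈ I, s ≠ c → I ∈ nhds s)
    (hx : x ∈ {x ∈ M.ambientPolytope | coordSum F x ∈ I}.extremePoints ℝ) {a b : α} (hab : a ≠ b)
    (hc : M.SameClass a b) (hF : coordSum F x = c → (a ∈ F ↔ b ∈ F)) (ha : 0 < x a ∧ x a < 1) :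
    ¬ (0 < x b ∧ x b < 1) := by
  intro hb
  obtain ⟨⟨hQ, hxI⟩, hext⟩ := mem_extremePoints_iff_left.1 hx
  set v : α → ℝ := Pi.single a 1 - Pi.single b 1 with hv
  have va : v a = 1 := by simp [hv, hab]
  have vb : v b = -1 := by simp [hv, hab.symm]
  have hev : ∀ᶠ ε : ℝ in nhds 0,
      x + ε • v ∈ {x ∈ M.ambientPolytope | coordSum F x ∈ I} := by
    have ev (g : ℝ → ℝ) (hg : Continuous g) {U : Set ℝ} (hU : U ∈ nhds (g 0)) :
        ∀ᶠ ε : ℝ in nhds 0, g ε ∈ U := hg.continuousAt.eventually hU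
    have e1 := ev (fun ε => x a + ε) (by fun_prop) (U := Set.Ioo 0 1)
      (by simpa using Ioo_mem_nhds ha.1 ha.2)
    have e2 := ev (fun ε => x b - ε) (by fun_prop) (U := Set.Ioo 0 1)
      (by simpa using Ioo_mem_nhds hb.1 hb.2)
    have e3 : ∀ᶠ ε : ℝ in nhds 0, coordSum F x + ε * coordSum F v ∈ I := by
      by_cases hxc : coordSum F x = c
      · have : coordSum F v = 0 := by
          rw [hv, map_sub, coordSum_single, coordSum_single]
          simp [hF hxc]
        simp [this, hxI]
      · exact ev (fun ε => coordSum F x + ε * coordSum F v) (by fun_prop)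
          (by simpa using hI _ hxI hxc)
    filter_upwards [e1, e2, e3] with ε h1 h2 h3
    have hbd : ∀ d, 0 ≤ (x + ε • v) d ∧ (x + ε • v) d ≤ 1 := by
      intro d
      simp only [Pi.add_apply, Pi.smul_apply, smul_eq_mul]
      by_cases hda : d = a
      · subst hda
        rw [va, mul_one]
        exact ⟨h1.1.le, h1.2.le⟩
      · by_cases hdb : d = b
        · subst hdb
          rw [vb, mul_neg, mul_one, ← sub_eq_add_neg]
          exact ⟨h2.1.le, h2.2.le⟩
        · have : v d = 0 := by simp [hv, hda, hdb]
          rw [this, mul_zero, add_zero]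
          exact ⟨hQ.2.1 d, hQ.2.2 d⟩
    refine ⟨⟨add_mem_affineSpan hQ.1 (Submodule.smul_mem _ _ hc), fun d => (hbd d).1,
      fun d => (hbd d).2⟩, ?_⟩
    rwa [map_add, map_smul, smul_eq_mul]
  obtain ⟨δ, hδ, hball⟩ := Metric.eventually_nhds_iff.1 hev
  have h1 := hball (y := δ / 2) (by rw [Real.dist_eq, sub_zero, abs_of_pos (by linarith)]; linarith)
  have h2 := hball (y := -(δ / 2))
    (by rw [Real.dist_eq, sub_zero, abs_neg, abs_of_pos (by linarith)]; linarith)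
  have h3 := hext _ h1 _ h2 ⟨1 / 2, 1 / 2, by norm_num, by norm_num, by norm_num, by
    ext d
    simp only [Pi.add_apply, Pi.smul_apply, smul_eq_mul]
    ring⟩
  have h4 := congrFun h3 a
  simp only [Pi.add_apply, Pi.smul_apply, smul_eq_mul, va] at h4
  linarith

omit [DecidableEq α] in
lemma eq_zero_or_one_of_integral {S : Finset α} {a : α} (ha : a ∈ S)
    (hS : ∃ n : ℤ, coordSum S x = n) (h01 : ∀ b ∈ S, b ≠ a → x b = 0 ∨ x b = 1) :
    ¬ (0 < x a ∧ x a < 1) := by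
  classical
  rintro ⟨h0, h1⟩
  obtain ⟨n, hn⟩ := hS
  obtain ⟨m, hm⟩ : ∃ m : ℤ, ∑ b ∈ S.erase a, x b = m := by
    refine ⟨∑ b ∈ S.erase a, if x b = 1 then 1 else 0, ?_⟩
    rw [Int.cast_sum]
    refine Finset.sum_congr rfl fun b hb => ?_
    rcases h01 b (Finset.mem_of_mem_erase hb) (Finset.ne_of_mem_erase hb) with h | h <;> simp [h]
  rw [coordSum_apply, ← Finset.add_sum_erase _ _ ha, hm] at hn
  have h2 : x a = ((n - m : ℤ) : ℝ) := by push_cast; linarith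
  rw [h2] at h0 h1
  have h3 : (0 : ℤ) < n - m := by exact_mod_cast h0
  have h4 : n - m < 1 := by exact_mod_cast h1
  omega

lemma exists_int_coordSum_classFinset [M.Finite] (hx : x ∈ affineSpan ℝ M.basePolytope) (a : α) :
    ∃ n : ℤ, coordSum (M.classFinset a) x = n := by
  obtain ⟨X, hX⟩ := M.exists_finset_isBase
  have h := coordSum_classFinset ((mem_affineSpan_iff hX).1 hx) a
  rw [map_sub, sub_eq_zero, coordSum_indicator] at h
  exact ⟨_, by rw [h]; norm_cast⟩

lemma exists_int_coordSum_ground [M.Finite] (hx : x ∈ affineSpan ℝ M.basePolytope) :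
    ∃ n : ℤ, coordSum M.ground_finite.toFinset x = n := by
  obtain ⟨X, hX⟩ := M.exists_finset_isBase
  have h := coordSum_ground ((mem_affineSpan_iff hX).1 hx)
  rw [map_sub, sub_eq_zero, coordSum_indicator] at h
  exact ⟨_, by rw [h]; norm_cast⟩

lemma coordSum_inter_add_sdiff (S T : Finset α) (x : α → ℝ) :
    coordSum (S ∩ T) x + coordSum (S \ T) x = coordSum S x := by
  simp only [coordSum_apply]
  exact Finset.sum_inter_add_sum_sdiff S T x

end ExtremePoints

namespace ExchangeCut

variable [DecidableEq α] {X : Finset α} [M.Finite]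

lemma mem_classFinset (h : M.ExchangeCut X F e f) {a : α} (ha : a ∈ M.E) (haF : a ∉ F) :
    a ∈ M.classFinset e :=
  Matroid.mem_classFinset.2 ⟨ha, h.connected _ (fun _ ha _ _ hbX hab _ =>
    exchange_mem_dirSpace h.base ha hbX hab) a ha haF⟩

/-- The complement of `F` lies in the class of `e`. Every other class is contained in `F`, and for
the class of `e` the sum over its part in `F` is `x(F)` minus the integer sums over the other
classes. -/
lemma exists_int_coordSum_inter (h : M.ExchangeCut X F e f) {x : α → ℝ}
    (hx : x ∈ affineSpan ℝ M.basePolytope) (hF : coordSum F x = M.natRk F) (a : α) :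
    ∃ n : ℤ, coordSum (M.classFinset a ∩ F) x = n := by
  by_cases hae : M.SameClass a e
  · have hcl : M.classFinset a = M.classFinset e := by
      ext b
      rw [Matroid.mem_classFinset, Matroid.mem_classFinset]
      exact and_congr_right fun _ => ⟨fun hb => hb.trans hae, fun hb => hb.trans hae.symm⟩
    obtain ⟨m, hm⟩ := exists_int_coordSum_ground hx
    obtain ⟨k, hk⟩ := exists_int_coordSum_classFinset hx e
    have h1 := coordSum_inter_add_sdiff F (M.classFinset e) x
    have h2 := coordSum_inter_add_sdiff M.ground_finite.toFinset (M.classFinset e) x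
    have h3 : M.ground_finite.toFinset ∩ M.classFinset e = M.classFinset e := by
      refine Finset.inter_eq_right.2 fun b hb => ?_
      simpa using (Matroid.mem_classFinset.1 hb).1
    have h4 : M.ground_finite.toFinset \ M.classFinset e = F \ M.classFinset e := by
      ext b
      simp only [Finset.mem_sdiff, Set.Finite.mem_toFinset]
      refine and_congr_left fun hb => ⟨fun hbE => ?_, fun hbF => h.subset_ground hbF⟩
      by_contra hbF
      exact hb (h.mem_classFinset hbE hbF)
    rw [h3, h4, hm, hk] at h2
    rw [hF] at h1
    refine ⟨(M.natRk F : ℤ) - (m - k), ?_⟩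
    rw [hcl, Finset.inter_comm]
    push_cast
    linarith
  · have : M.classFinset a ∩ F = M.classFinset a := by
      refine Finset.inter_eq_left.2 fun b hb => ?_
      rw [Matroid.mem_classFinset] at hb
      by_contra hbF
      exact hae (hb.2.symm.trans (Matroid.mem_classFinset.1 (h.mem_classFinset hb.1 hbF)).2)
    rw [this]
    exact exists_int_coordSum_classFinset hx a

/-- An extreme point has at most one fractional coordinate per class, or per part of a class cut by
`F` when it is on the hyperplane. Each such part has an integral sum, so there is none: the cut
creates no new vertices. -/
lemma extremePoints_subset (h : M.ExchangeCut X F e f) {I : Set ℝ}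
    (hI : ∀ s ∈ I, s ≠ M.natRk F → I ∈ nhds s) :
    {x ∈ M.ambientPolytope | coordSum F x ∈ I}.extremePoints ℝ ⊆
      M.ambientPolytope.extremePoints ℝ := by
  intro x hx
  have hQ := hx.1.1
  refine mem_extremePoints_of_forall_eq_zero_or_one hQ fun a => ?_
  by_cases haE : a ∈ M.E
  swap
  · exact Or.inl (apply_eq_zero_of_mem_affineSpan hQ.1 haE)
  have cases01 : ∀ b, ¬ (0 < x b ∧ x b < 1) → x b = 0 ∨ x b = 1 := by
    intro b hb
    rcases (hQ.2.1 b).eq_or_lt with h0 | h0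
    · exact Or.inl h0.symm
    · rcases (hQ.2.2 b).eq_or_lt with h1 | h1
      · exact Or.inr h1
      · exact absurd ⟨h0, h1⟩ hb
  refine cases01 a fun hfrac => ?_
  have haa : a ∈ M.classFinset a := Matroid.mem_classFinset.2 ⟨haE, SameClass.refl M a⟩
  by_cases hc : coordSum F x = M.natRk F
  · by_cases haF : a ∈ F
    · refine eq_zero_or_one_of_integral (S := M.classFinset a ∩ F) (by simp [haa, haF])
        (h.exists_int_coordSum_inter hQ.1 hc a) (fun b hb hba => cases01 b ?_) hfrac
      rw [Finset.mem_inter, Matroid.mem_classFinset] at hb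
      exact not_fractional_of_mem_extremePoints hI hx hba.symm hb.1.2.symm
        (fun _ => iff_of_true haF hb.2) hfrac
    · refine eq_zero_or_one_of_integral (S := M.classFinset a \ F) (by simp [haa, haF]) ?_
        (fun b hb hba => cases01 b ?_) hfrac
      · obtain ⟨n, hn⟩ := h.exists_int_coordSum_inter hQ.1 hc a
        obtain ⟨m, hm⟩ := exists_int_coordSum_classFinset hQ.1 a
        have := coordSum_inter_add_sdiff (M.classFinset a) F x
        exact ⟨m - n, by push_cast; linarith⟩
      · rw [Finset.mem_sdiff, Matroid.mem_classFinset] at hb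
        exact not_fractional_of_mem_extremePoints hI hx hba.symm hb.1.2.symm
          (fun _ => iff_of_false haF hb.2) hfrac
  · refine eq_zero_or_one_of_integral haa (exists_int_coordSum_classFinset hQ.1 a)
      (fun b hb hba => cases01 b ?_) hfrac
    exact not_fractional_of_mem_extremePoints hI hx hba.symm
      (Matroid.mem_classFinset.1 hb).2.symm (fun hh => absurd hh hc) hfrac

lemma exists_isBase_card_lt (h : M.ExchangeCut X F e f) :
    ∃ Y : Finset α, M.IsBase Y ∧ (Y ∩ F).card < M.natRk F := by
  by_contra hc
  push Not at hc
  have h0 : M.dirSpace ≤ LinearMap.ker (coordSum F) :=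
    dirSpace_le _ h.base (fun a ha b _ hbX hab => by
      have h1 := (card_inter_le_natRk hab F).antisymm (hc _ hab)
      have h2 : coordSum F (((insert b (X.erase a) : Finset α) : Set α).indicator 1) =
          coordSum F ((X : Set α).indicator 1) := by
        rw [coordSum_indicator, coordSum_indicator, h1, h.natRk_eq]
      rw [indicator_exchange ha hbX, map_add, add_eq_left] at h2
      exact h2)
  have := h0 h.same.symm
  rw [LinearMap.mem_ker, h.coordSum_single_sub_single] at this
  exact one_ne_zero this

lemma isSplitFlacet (h : M.ExchangeCut X F e f) : M.IsSplitFlacet F := by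
  refine ⟨h.isFlacet, ?_, ?_, ?_, ?_⟩
  · obtain ⟨u, hu, hF⟩ := h.exists_isInner
    exact ⟨u, hu.mem_intrinsicInterior, hF⟩
  · obtain ⟨Y, hY, hlt⟩ := h.exists_isBase_card_lt
    refine ⟨_, indicator_mem_ambientPolytope hY, ?_⟩
    rw [coordSum_indicator]
    exact_mod_cast hlt.ne
  · exact h.extremePoints_subset (I := Set.Iic _) fun s hs hne =>
      Iic_mem_nhds (lt_of_le_of_ne hs hne)
  · exact h.extremePoints_subset (I := Set.Ici _) fun s hs hne =>
      Ici_mem_nhds (lt_of_le_of_ne hs hne.symm)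

end ExchangeCut

end Matroid

/-! ### Compatibility of the splits yields a split system. -/

namespace Matroid

variable {α : Type*} [DecidableEq α] {M : Matroid α} [M.Finite] {X Y F G : Finset α}
  {e f e' f' : α}

lemma coordSum_eq_zero_of_forall_compl (hF : (F : Set α) ⊆ M.E) {v : α → ℝ}
    (hv : v ∈ M.dirSpace) (h0 : ∀ a ∈ M.E, a ∉ F → v a = 0) : coordSum F v = 0 := by
  have h1 := coordSum_inter_add_sdiff M.ground_finite.toFinset F v
  have h2 : M.ground_finite.toFinset ∩ F = F := by
    refine Finset.inter_eq_right.2 fun b hb => ?_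
    simpa using hF hb
  have h3 : coordSum (M.ground_finite.toFinset \ F) v = 0 := by
    rw [coordSum_apply]
    refine Finset.sum_eq_zero fun a ha => ?_
    simp only [Finset.mem_sdiff, Set.Finite.mem_toFinset] at ha
    exact h0 a ha.1 ha.2
  rw [h2, h3, add_zero, coordSum_ground hv] at h1
  exact h1

lemma indicator_eq_sum_single (S : Finset α) :
    (S : Set α).indicator (1 : α → ℝ) = ∑ a ∈ S, Pi.single a 1 := by
  ext b
  simp [Finset.sum_apply, Pi.single_apply, Set.indicator_apply]

omit [M.Finite] in
lemma indicator_sub_indicator_mem_dirSpace {S T : Finset α} (hS : ∀ a ∈ S, M.SameClass a e)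
    (hT : ∀ a ∈ T, M.SameClass a e) (hcard : S.card = T.card) :
    (S : Set α).indicator 1 - (T : Set α).indicator 1 ∈ M.dirSpace := by
  have key {S : Finset α} (hS : ∀ a ∈ S, M.SameClass a e) :
      (S : Set α).indicator 1 - S.card • (Pi.single e 1 : α → ℝ) ∈ M.dirSpace := by
    rw [indicator_eq_sum_single, ← Finset.sum_const, ← Finset.sum_sub_distrib]
    exact Submodule.sum_mem _ hS
  have := Submodule.sub_mem _ (key hS) (key hT)
  rwa [hcard, sub_sub_sub_cancel_right] at this

omit [DecidableEq α] [M.Finite] in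
-- The segment from `u` to `y` stays in the hyperplane of `F` and is inner except possibly at `y`;
-- the value on `G` crosses `c` strictly in between.
lemma IsInner.exists_isInner {u y : α → ℝ} (hu : M.IsInner u) (hy : y ∈ M.ambientPolytope)
    {r c : ℝ} (huF : coordSum F u = r) (hyF : coordSum F y = r)
    (h : (coordSum G u - c) * (coordSum G y - c) < 0) :
    ∃ x, M.IsInner x ∧ coordSum F x = r ∧ coordSum G x = c := by
  set p := coordSum G u - c with hp
  set q := coordSum G y - c with hq
  have hne : q - p ≠ 0 := by
    intro h0
    have : q = p := by linarith
    rw [this] at h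
    exact absurd (mul_self_nonneg p) (not_le.2 h)
  have hs : 0 < q / (q - p) ∧ 0 < -p / (q - p) := by
    rcases mul_neg_iff.1 h with h1 | h1
    · exact ⟨div_pos_of_neg_of_neg h1.2 (by linarith), div_pos_of_neg_of_neg (by linarith)
        (by linarith)⟩
    · exact ⟨div_pos h1.2 (by linarith), div_pos (by linarith) (by linarith)⟩
  have hst : q / (q - p) + -p / (q - p) = 1 := by
    rw [← add_div, ← sub_eq_add_neg, div_self hne]
  refine ⟨_, hu.combo hy hs.1 hs.2.le hst, ?_, ?_⟩
  · rw [map_add, map_smul, map_smul, huF, hyF, ← add_smul, hst, one_smul]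
  · have e1 : coordSum G u = p + c := by rw [hp]; ring
    have e2 : coordSum G y = q + c := by rw [hq]; ring
    rw [map_add, map_smul, map_smul, e1, e2, smul_eq_mul, smul_eq_mul]
    have e3 : q / (q - p) * (p + c) + -p / (q - p) * (q + c) =
        (q / (q - p) + -p / (q - p)) * c := by ring
    rw [e3, hst, one_mul]

omit [DecidableEq α] in
lemma IsSplit.not_isInner {A : Matroid α} [A.Finite] (hA : A.IsSplit) (hF : A.IsSplitFlacet F)
    (hG : A.IsSplitFlacet G)
    (hne : A.splitHyperplane F ≠ A.splitHyperplane G) {x : α → ℝ} (hx : A.IsInner x)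
    (h1 : coordSum F x = A.natRk F) (h2 : coordSum G x = A.natRk G) : False :=
  Set.disjoint_left.1 (hA F G hF hG hne) ⟨⟨hx.1, h1⟩, ⟨hx.1, h2⟩⟩ hx.mem_intrinsicInterior

namespace ExchangeCut

/-- In a split matroid, all exchange cuts belong to the same class. -/
lemma sameClass_of_isSplit (hM : M.IsSplit) (h : M.ExchangeCut X F e f)
    (h' : M.ExchangeCut Y G e' f') : M.SameClass e' e := by
  classical
  by_contra hne
  obtain ⟨u, hu, huF⟩ := h.exists_isInner
  obtain ⟨u', hu', huG⟩ := h'.exists_isInner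
  -- Coordinates of `w` on the class of `e` and of `u'` elsewhere. As the complements of `F` and `G`
  -- lie in different classes, `F` sees only `w` and `G` sees only `u'`, so `mix u` is an inner
  -- point of both hyperplanes.
  let mix : (α → ℝ) → (α → ℝ) := fun w =>
    u' + fun a => if a ∈ M.classFinset e then (w - u') a else 0
  have mix_in : ∀ w a, a ∈ M.classFinset e → mix w a = w a := by
    intro w a ha; simp [mix, ha]
  have mix_out : ∀ w a, a ∉ M.classFinset e → mix w a = u' a := by
    intro w a ha; simp [mix, ha]
  have mix_mem : ∀ w ∈ affineSpan ℝ M.basePolytope, mix w ∈ affineSpan ℝ M.basePolytope :=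
    fun w hw => add_mem_affineSpan hu'.1 (restrict_class_mem_dirSpace (sub_mem_dirSpace hw hu'.1) e)
  have mix_F : ∀ w ∈ affineSpan ℝ M.basePolytope, coordSum F (mix w) = coordSum F w := by
    intro w hw
    rw [← sub_eq_zero, ← map_sub]
    refine coordSum_eq_zero_of_forall_compl h.subset_ground (sub_mem_dirSpace (mix_mem w hw) hw)
      fun a ha haF => ?_
    rw [Pi.sub_apply, mix_in w a (h.mem_classFinset ha haF), sub_self]
  have mix_G : ∀ w ∈ affineSpan ℝ M.basePolytope, coordSum G (mix w) = M.natRk G := by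
    intro w hw
    rw [← huG, ← sub_eq_zero, ← map_sub]
    refine coordSum_eq_zero_of_forall_compl h'.subset_ground
      (sub_mem_dirSpace (mix_mem w hw) hu'.1) fun a ha haG => ?_
    rw [Pi.sub_apply, mix_out w a, sub_self]
    intro hae
    have h1 := (Matroid.mem_classFinset.1 hae).2
    have h2 := (Matroid.mem_classFinset.1 (h'.mem_classFinset ha haG)).2
    exact hne (h2.symm.trans h1)
  have hx : M.IsInner (mix u) := by
    refine ⟨mix_mem u hu.1, fun a => ?_⟩
    by_cases ha : a ∈ M.classFinset e
    · rw [mix_in u a ha]; exact hu.2 a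
    · rw [mix_out u a ha]; exact hu'.2 a
  refine hM.not_isInner h.isSplitFlacet h'.isSplitFlacet (fun heq => ?_) hx
    ((mix_F u hu.1).trans huF) (mix_G u hu.1)
  -- The hyperplanes differ: mixing in a base that is not tight for `F` stays on that of `G` but
  -- leaves that of `F`.
  obtain ⟨Z, hZ, hlt⟩ := h.exists_isBase_card_lt
  have hZ' := indicator_mem_affineSpan hZ
  have : mix ((Z : Set α).indicator 1) ∈ M.splitHyperplane F := by
    rw [heq]
    exact ⟨mix_mem _ hZ', mix_G _ hZ'⟩
  have h2 := this.2
  rw [mix_F _ hZ', coordSum_indicator] at h2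
  exact hlt.ne (by exact_mod_cast h2)

lemma sdiff_classFinset_subset (h : M.ExchangeCut X F e f) (hY : M.IsBase Y) :
    Y \ M.classFinset e ⊆ F := by
  intro a ha
  rw [Finset.mem_sdiff] at ha
  by_contra haF
  exact ha.2 (h.mem_classFinset (hY.subset_ground ha.1) haF)

lemma card_inter_eq (h : M.ExchangeCut X F e f) (hY : M.IsBase Y) :
    (Y ∩ F).card = (Y ∩ (F ∩ M.classFinset e)).card + (Y \ M.classFinset e).card := by
  have := h.sdiff_classFinset_subset hY
  rw [← Finset.card_union_of_disjoint]
  · congr 1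
    ext a
    simp only [Finset.mem_inter, Finset.mem_union, Finset.mem_sdiff]
    have := @this a
    simp only [Finset.mem_sdiff] at this
    tauto
  · rw [Finset.disjoint_left]
    intro a
    simp only [Finset.mem_inter, Finset.mem_sdiff]
    tauto

/-- Elements of `X` that an element of `F` can replace are in `F` by `closed` and in the same class,
so `X` also attains the rank of each part of `F`. -/
lemma natRk_inter_classFinset (h : M.ExchangeCut X F e f) (c : α) :
    M.natRk (F ∩ M.classFinset c) = (X ∩ (F ∩ M.classFinset c)).card := by
  have hE : ((F ∩ M.classFinset c : Finset α) : Set α) ⊆ M.E := fun a ha =>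
    (Matroid.mem_classFinset.1 (Finset.mem_inter.1 ha).2).1
  have hB : M.IsBasis (X ∩ (F ∩ M.classFinset c) : Finset α) (F ∩ M.classFinset c : Finset α) := by
    refine (h.base.indep.subset (by simp)).isBasis_of_subset_of_subset_closure
      (Finset.coe_subset.2 Finset.inter_subset_right) ?_
    intro b hb
    rw [Finset.mem_coe] at hb
    by_cases hbX : b ∈ X
    · exact M.mem_closure_of_mem' (Finset.mem_coe.2 (Finset.mem_inter.2 ⟨hbX, hb⟩)) (hE hb)
    · refine h.base.mem_closure_of_forall_exchange (hE hb) hbX (fun a ha hab => ?_)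
      rw [Finset.mem_inter, Matroid.mem_classFinset] at hb
      have haF : a ∈ F := by
        by_contra haF
        exact h.closed a ha haF b hb.1 hbX hab
      have hac : M.SameClass a c :=
        SameClass.trans (SameClass.symm (exchange_mem_dirSpace h.base ha hbX hab)) hb.2.2
      have haE := h.base.subset_ground ha
      exact M.mem_closure_of_mem' (Finset.mem_coe.2 (Finset.mem_inter.2 ⟨ha, Finset.mem_inter.2
        ⟨haF, Matroid.mem_classFinset.2 ⟨haE, hac⟩⟩⟩)) haE
  rw [natRk, ← hB.encard_eq_eRk, Set.encard_coe_eq_coe_finsetCard, ENat.toNat_natCast]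

omit [DecidableEq α] [M.Finite] in
lemma _root_.Matroid.IsBase.finset_card_eq (hX : M.IsBase X) (hY : M.IsBase Y) :
    X.card = Y.card := by
  have := hX.encard_eq_encard_of_isBase hY
  rw [Set.encard_coe_eq_coe_finsetCard, Set.encard_coe_eq_coe_finsetCard] at this
  exact_mod_cast this

lemma _root_.Matroid.card_sdiff_classFinset (hX : M.IsBase X) (hY : M.IsBase Y) (e : α) :
    (X \ M.classFinset e).card = (Y \ M.classFinset e).card := by
  have h1 := Finset.card_inter_add_card_sdiff X (M.classFinset e)
  have h2 := Finset.card_inter_add_card_sdiff Y (M.classFinset e)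
  have h3 := card_inter_classFinset hX hY e
  have h4 := hX.finset_card_eq hY
  omega

lemma card_inter_eq_natRk_iff (h : M.ExchangeCut X F e f) (hY : M.IsBase Y) :
    (Y ∩ F).card = M.natRk F ↔
      (Y ∩ (F ∩ M.classFinset e)).card = M.natRk (F ∩ M.classFinset e) := by
  rw [h.natRk_eq, h.natRk_inter_classFinset, h.card_inter_eq hY, h.card_inter_eq h.base,
    card_sdiff_classFinset hY h.base e]
  omega

/-- Two different exchange cuts in the same class with a large intersection: some base attains the
rank of the first, but not of the second. -/
lemma exists_isBase_of_lt (h : M.ExchangeCut X F e f) (h' : M.ExchangeCut Y G e' f')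
    (hC : M.classFinset e' = M.classFinset e) (hFG : F ≠ G)
    (hlt : M.natRk (F ∩ M.classFinset e) + M.natRk (G ∩ M.classFinset e) <
      ((F ∩ M.classFinset e) ∩ (G ∩ M.classFinset e)).card + (X ∩ M.classFinset e).card) :
    ∃ Z : Finset α, M.IsBase Z ∧ (Z ∩ F).card = M.natRk F ∧ (Z ∩ G).card < M.natRk G := by
  by_contra hc
  push Not at hc
  -- If bases tight for `F` were tight for `G`, the two functionals would be proportional on
  -- directions. The factor `1` gives `F = G`; the factor `-1` makes `F` and `G` complementary in
  -- the class, so the intersection in `hlt` is empty and the ranks are too large for it.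
  obtain ⟨s, hs⟩ := h.exists_smul (G := G) (c := M.natRk G)
    (fun Z hZ hZF => (card_inter_le_natRk hZ G).antisymm (hc Z hZ hZF))
  have hef := h.same
  have key : ∀ a ∈ M.classFinset e, ((if a ∈ G then 1 else 0) - (if f ∈ G then 1 else 0) : ℝ) =
      s * ((if a ∈ F then 1 else 0) - 1) := by
    intro a ha
    have := hs _ ((Matroid.mem_classFinset.1 ha).2.trans hef)
    rwa [map_sub, map_sub, coordSum_single, coordSum_single, coordSum_single, coordSum_single,
      if_pos h.f_mem] at this
  have he' : e' ∈ M.classFinset e := by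
    rw [← hC]; exact h'.mem_classFinset (h'.base.subset_ground h'.e_mem) h'.e_notMem
  have hf' : f' ∈ M.classFinset e := by
    rw [Matroid.mem_classFinset]
    exact ⟨h'.subset_ground h'.f_mem, h'.same.symm.trans (Matroid.mem_classFinset.1 he').2⟩
  have ke := key e' he'
  have kf := key f' hf'
  rw [if_neg h'.e_notMem] at ke
  rw [if_pos h'.f_mem] at kf
  by_cases hfG : f ∈ G
  · rw [if_pos hfG] at ke kf
    have hs1 : s = 1 := by
      split_ifs at ke
      · norm_num at ke
      · linarith
    refine hFG (Finset.ext fun a => ?_)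
    by_cases haC : a ∈ M.classFinset e
    · have ka := key a haC
      rw [if_pos hfG, hs1] at ka
      by_cases haF : a ∈ F <;> by_cases haG : a ∈ G <;> simp [haF, haG] at ka ⊢
    · constructor
      · intro haF
        by_contra haG
        exact haC (hC ▸ h'.mem_classFinset (h.subset_ground haF) haG)
      · intro haG
        by_contra haF
        exact haC (h.mem_classFinset (h'.subset_ground haG) haF)
  · rw [if_neg hfG] at ke kf
    have hs1 : s = -1 := by
      split_ifs at kf
      · norm_num at kf
      · linarith
    have hd : ∀ a ∈ M.classFinset e, (a ∈ F ↔ a ∉ G) := by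
      intro a ha
      have ka := key a ha
      rw [if_neg hfG, hs1] at ka
      by_cases haF : a ∈ F <;> by_cases haG : a ∈ G <;> simp [haF, haG] at ka ⊢
    have h0 : ((F ∩ M.classFinset e) ∩ (G ∩ M.classFinset e)).card = 0 := by
      rw [Finset.card_eq_zero, Finset.eq_empty_iff_forall_notMem]
      intro a ha
      simp only [Finset.mem_inter] at ha
      exact (hd a ha.1.2).1 ha.1.1 ha.2.1
    have h1 := card_inter_le_natRk h.base (F ∩ M.classFinset e)
    have h2 := card_inter_le_natRk h.base (G ∩ M.classFinset e)
    have h3 := card_inter_add_card_inter_of_pure (S := X ∩ M.classFinset e) (H := F) (K := G)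
      (fun a ha => hd a (Finset.mem_inter.1 ha).2)
    have e1 (T : Finset α) : X ∩ M.classFinset e ∩ T = X ∩ (T ∩ M.classFinset e) := by
      rw [Finset.inter_assoc, Finset.inter_comm T]
    rw [e1, e1] at h3
    omega

end ExchangeCut

/-- A subset of `C` with prescribed intersection sizes. -/
lemma exists_finset_card_inter {C H K : Finset α} {ρ h k : ℕ} (hH : H ⊆ C) (hK : K ⊆ C)
    (h1 : h ≤ H.card) (h2 : h ≤ ρ) (h3 : ρ + H.card ≤ C.card + h) (h4 : k < K.card) (h5 : k < ρ)
    (h6 : h + k < (H ∩ K).card + ρ) (h7 : k < (K \ H).card + h) :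
    ∃ S ⊆ C, S.card = ρ ∧ (S ∩ H).card = h ∧ k < (S ∩ K).card := by
  have cH := Finset.card_inter_add_card_sdiff H K
  have cK := Finset.card_inter_add_card_sdiff K H
  rw [Finset.inter_comm K H] at cK
  have cC : (C \ (H ∪ K)).card + (H.card + (K \ H).card) = C.card := by
    have e1 := Finset.card_sdiff_add_card_eq_card (Finset.union_subset hH hK)
    have e2 : (H ∪ K).card = H.card + (K \ H).card := by
      rw [← Finset.union_sdiff_self_eq_union, Finset.card_union_of_disjoint Finset.disjoint_sdiff]
    omega
  -- Greedy choice: fill the `h` places in `H` from `H ∩ K` first, and the other `ρ - h` places from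
  -- `K \ H` first.
  set i := min (H ∩ K).card h with hi
  set j := min (K \ H).card (ρ - h) with hj
  obtain ⟨S₁, s₁, c₁⟩ := Finset.exists_subset_card_eq (s := H ∩ K) (n := i) (by omega)
  obtain ⟨S₂, s₂, c₂⟩ := Finset.exists_subset_card_eq (s := H \ K) (n := h - i) (by omega)
  obtain ⟨S₃, s₃, c₃⟩ := Finset.exists_subset_card_eq (s := K \ H) (n := j) (by omega)
  obtain ⟨S₄, s₄, c₄⟩ := Finset.exists_subset_card_eq (s := C \ (H ∪ K)) (n := ρ - h - j)
    (by omega)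
  have m₁ : ∀ a ∈ S₁, a ∈ H ∧ a ∈ K := fun a ha => Finset.mem_inter.1 (s₁ ha)
  have m₂ : ∀ a ∈ S₂, a ∈ H ∧ a ∉ K := fun a ha => Finset.mem_sdiff.1 (s₂ ha)
  have m₃ : ∀ a ∈ S₃, a ∈ K ∧ a ∉ H := fun a ha => Finset.mem_sdiff.1 (s₃ ha)
  have m₄ : ∀ a ∈ S₄, a ∈ C ∧ a ∉ H ∧ a ∉ K := fun a ha => by simpa using s₄ ha
  have d₁₂ : (S₁ ∪ S₂).card = h := by
    rw [Finset.card_union_of_disjoint, c₁, c₂]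
    · omega
    · exact Finset.disjoint_left.2 fun a h1 h2 => (m₂ a h2).2 (m₁ a h1).2
  have d₃₄ : (S₃ ∪ S₄).card = ρ - h := by
    rw [Finset.card_union_of_disjoint, c₃, c₄]
    · omega
    · exact Finset.disjoint_left.2 fun a h1 h2 => (m₄ a h2).2.2 (m₃ a h1).1
  have d₁₃ : (S₁ ∪ S₃).card = i + j := by
    rw [Finset.card_union_of_disjoint, c₁, c₃]
    exact Finset.disjoint_left.2 fun a h1 h2 => (m₃ a h2).2 (m₁ a h1).1
  refine ⟨(S₁ ∪ S₂) ∪ (S₃ ∪ S₄), ?_, ?_, ?_, ?_⟩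
  · intro a ha
    simp only [Finset.mem_union] at ha
    rcases ha with (ha | ha) | ha | ha
    · exact hH (m₁ a ha).1
    · exact hH (m₂ a ha).1
    · exact hK (m₃ a ha).1
    · exact (m₄ a ha).1
  · rw [Finset.card_union_of_disjoint, d₁₂, d₃₄]
    · omega
    · rw [Finset.disjoint_left]
      intro a ha hb
      rw [Finset.mem_union] at ha hb
      have : a ∈ H := ha.elim (fun h => (m₁ a h).1) (fun h => (m₂ a h).1)
      exact hb.elim (fun h => (m₃ a h).2 this) (fun h => (m₄ a h).2.1 this)
  · rw [← d₁₂]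
    congr 1
    ext a
    have := m₁ a; have := m₂ a; have := m₃ a; have := m₄ a
    simp only [Finset.mem_inter, Finset.mem_union]
    tauto
  · refine lt_of_lt_of_le (b := i + j) (by omega) ?_
    rw [← d₁₃]
    refine Finset.card_le_card fun a ha => ?_
    have := m₁ a; have := m₃ a
    simp only [Finset.mem_inter, Finset.mem_union] at ha ⊢
    tauto

/-- In a split matroid, different exchange cuts have a small intersection. -/
lemma ExchangeCut.card_inter_add_le (hM : M.IsSplit) (h : M.ExchangeCut X F e f)
    (h' : M.ExchangeCut Y G e' f') (hFG : F ≠ G) :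
    ((F ∩ M.classFinset e) ∩ (G ∩ M.classFinset e)).card + (X ∩ M.classFinset e).card ≤
      M.natRk (F ∩ M.classFinset e) + M.natRk (G ∩ M.classFinset e) := by
  by_contra hlt
  rw [not_le] at hlt
  have hee := ExchangeCut.sameClass_of_isSplit hM h h'
  have hC : M.classFinset e' = M.classFinset e := by
    ext b
    rw [Matroid.mem_classFinset, Matroid.mem_classFinset]
    exact and_congr_right fun _ => ⟨fun hb => hb.trans hee, fun hb => hb.trans hee.symm⟩
  set C := M.classFinset e with hCdef
  obtain ⟨Z, hZ, hZF, hZG⟩ := h.exists_isBase_of_lt h' hC hFG hlt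
  obtain ⟨Z', hZ', hZG', hZF'⟩ := h'.exists_isBase_of_lt h hC.symm hFG.symm (by
    rw [hC, Finset.inter_comm (G ∩ C) (F ∩ C), card_inter_classFinset h'.base h.base e, ← hCdef]
    omega)
  have hX := h.base
  have rF : M.natRk F = M.natRk (F ∩ C) + (X \ C).card := by
    rw [h.natRk_eq, h.card_inter_eq hX, h.natRk_inter_classFinset]
  have rG : M.natRk G = M.natRk (G ∩ C) + (X \ C).card := by
    rw [h'.natRk_eq, h'.card_inter_eq h'.base, hC, ← hC, h'.natRk_inter_classFinset, hC,
      card_sdiff_classFinset h'.base hX e]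
  have heC : e ∈ C := h.mem_classFinset (hX.subset_ground h.e_mem) h.e_notMem
  have he'C : e' ∈ C := hC ▸ h'.mem_classFinset (h'.base.subset_ground h'.e_mem) h'.e_notMem
  have hfC' : f' ∈ C := Matroid.mem_classFinset.2 ⟨h'.subset_ground h'.f_mem,
    h'.same.symm.trans hee⟩
  have b1 : M.natRk (F ∩ C) = (X ∩ (F ∩ C)).card := h.natRk_inter_classFinset e
  have b2 : M.natRk (G ∩ C) = (Y ∩ (G ∩ C)).card := h'.natRk_inter_classFinset e
  have c1 : (Y ∩ C).card = (X ∩ C).card := card_inter_classFinset h'.base hX e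
  have k1 : M.natRk (F ∩ C) ≤ (F ∩ C).card := b1 ▸ Finset.card_le_card Finset.inter_subset_right
  have k2 : M.natRk (F ∩ C) ≤ (X ∩ C).card :=
    b1 ▸ Finset.card_le_card (Finset.inter_subset_inter_left Finset.inter_subset_right)
  have k3 : (X ∩ C).card + (F ∩ C).card ≤ C.card + M.natRk (F ∩ C) := by
    rw [b1, ← Finset.card_union_add_card_inter]
    refine Nat.add_le_add (Finset.card_le_card
      (Finset.union_subset Finset.inter_subset_right Finset.inter_subset_right))
      (Finset.card_le_card ?_)
    intro a; simp only [Finset.mem_inter]; tauto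
  have k4 : M.natRk (G ∩ C) < (G ∩ C).card := by
    rw [b2]
    refine Finset.card_lt_card ⟨Finset.inter_subset_right, fun hh => h'.f_notMem ?_⟩
    exact (Finset.mem_inter.1 (hh (Finset.mem_inter.2 ⟨h'.f_mem, hfC'⟩))).1
  have k5 : M.natRk (G ∩ C) < (X ∩ C).card := by
    rw [b2, ← c1]
    refine Finset.card_lt_card ⟨Finset.inter_subset_inter_left Finset.inter_subset_right,
      fun hh => h'.e_notMem ?_⟩
    have := hh (Finset.mem_inter.2 ⟨h'.e_mem, he'C⟩)
    simp only [Finset.mem_inter] at this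
    exact this.2.1
  have k7 : M.natRk (G ∩ C) < ((G ∩ C) \ (F ∩ C)).card + M.natRk (F ∩ C) := by
    have t1 : (Z' ∩ (G ∩ C)).card = M.natRk (G ∩ C) := by
      have := (h'.card_inter_eq_natRk_iff hZ').1 hZG'
      rwa [hC] at this
    have t2 : (Z' ∩ (F ∩ C)).card < M.natRk (F ∩ C) :=
      lt_of_le_of_ne (card_inter_le_natRk hZ' _)
        (fun hh => hZF'.ne ((h.card_inter_eq_natRk_iff hZ').2 hh))
    have t3 := Finset.card_inter_add_card_sdiff (Z' ∩ (G ∩ C)) (F ∩ C)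
    have t4 : (Z' ∩ (G ∩ C) ∩ (F ∩ C)).card ≤ (Z' ∩ (F ∩ C)).card :=
      Finset.card_le_card (Finset.inter_subset_inter_right Finset.inter_subset_left)
    have t5 : ((Z' ∩ (G ∩ C)) \ (F ∩ C)).card ≤ ((G ∩ C) \ (F ∩ C)).card :=
      Finset.card_le_card (Finset.sdiff_subset_sdiff Finset.inter_subset_right subset_rfl)
    omega
  -- Inside a class the ambient polytope allows any `ρ`-set, base or not. Replacing `X ∩ C` by `S`
  -- gives a vertex on the hyperplane of `F` that lies beyond that of `G`.
  obtain ⟨S, hSC, cS, cSF, cSG⟩ := exists_finset_card_inter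
    (H := F ∩ C) (K := G ∩ C) Finset.inter_subset_right Finset.inter_subset_right k1 k2 k3 k4 k5
    (by omega) k7
  have hz : ((X \ C ∪ S : Finset α) : Set α).indicator (1 : α → ℝ) =
      (X : Set α).indicator 1 +
        ((S : Set α).indicator 1 - ((X ∩ C : Finset α) : Set α).indicator 1) := by
    ext a
    have := @hSC a
    by_cases h1 : a ∈ X <;> by_cases h2 : a ∈ C <;> by_cases h3 : a ∈ S <;>
      simp_all
  have hzQ : ((X \ C ∪ S : Finset α) : Set α).indicator (1 : α → ℝ) ∈ M.ambientPolytope := by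
    refine ⟨?_, Set.indicator_nonneg (fun _ _ => zero_le_one),
      Set.indicator_le_self' (fun _ _ => zero_le_one)⟩
    rw [hz]
    exact add_mem_affineSpan (indicator_mem_affineSpan hX) (indicator_sub_indicator_mem_dirSpace
      (e := e) (fun a ha => (Matroid.mem_classFinset.1 (hSC ha)).2)
      (fun a ha => (Matroid.mem_classFinset.1 (Finset.mem_inter.1 ha).2).2) cS)
  have zcard {T : Finset α} (hT : X \ C ⊆ T) :
      ((X \ C ∪ S) ∩ T).card = (X \ C).card + (S ∩ (T ∩ C)).card := by
    rw [← Finset.card_union_of_disjoint]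
    · congr 1
      ext a
      have := @hT a; have := @hSC a
      simp only [Finset.mem_inter, Finset.mem_union, Finset.mem_sdiff] at *
      tauto
    · rw [Finset.disjoint_left]
      intro a
      simp only [Finset.mem_inter, Finset.mem_sdiff]
      tauto
  have zF := zcard (h.sdiff_classFinset_subset hX)
  have zG := zcard (hC ▸ h'.sdiff_classFinset_subset hX)
  obtain ⟨u, hu, huF⟩ := h.exists_isInner
  have hneq : M.splitHyperplane F ≠ M.splitHyperplane G := by
    intro heq
    have hmem : (Z : Set α).indicator 1 ∈ M.splitHyperplane F :=
      ⟨indicator_mem_affineSpan hZ, by rw [coordSum_indicator, hZF]⟩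
    rw [heq] at hmem
    have := hmem.2
    rw [coordSum_indicator] at this
    exact hZG.ne (by exact_mod_cast this)
  -- On the hyperplane of `F` the base `Z` is strictly below that of `G` and the vertex from `S`
  -- strictly above. Whichever is opposite to `u` gives an inner point of both hyperplanes,
  -- contradicting compatibility.
  obtain ⟨x, hx, hxF, hxG⟩ : ∃ x, M.IsInner x ∧ coordSum F x = M.natRk F ∧
      coordSum G x = M.natRk G := by
    rcases lt_trichotomy (coordSum G u) (M.natRk G : ℝ) with hlt' | heq | hgt
    · refine hu.exists_isInner hzQ huF ?_ (mul_neg_of_neg_of_pos (by linarith) ?_)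
      · rw [coordSum_indicator, zF, cSF, rF, add_comm]
      · rw [coordSum_indicator, sub_pos, zG, rG]
        exact_mod_cast (by omega)
    · exact ⟨u, hu, huF, heq⟩
    · refine hu.exists_isInner (indicator_mem_ambientPolytope hZ) huF ?_
        (mul_neg_of_pos_of_neg (by linarith) ?_)
      · rw [coordSum_indicator, hZF]
      · rw [coordSum_indicator, sub_neg]
        exact_mod_cast hZG
  exact hM.not_isInner h.isSplitFlacet h'.isSplitFlacet hneq hx hxF hxG

/-- The exchanges in a split matroid are governed by a split system on a union of classes, and
are not restricted inside the other classes. -/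
lemma IsSplit.exists_splitSystem (hM : M.IsSplit) :
    ∃ (C : Finset α) (ρ : ℕ) (𝓗 : Set (Finset α)) (b : Finset α → ℕ), SplitSystem M C ρ 𝓗 b ∧
      (∀ a ∈ M.E, ∀ a' ∈ M.E, M.SameClass a a' → a ∈ C → a' ∈ C) ∧
      ∀ X : Finset α, M.IsBase X → ∀ a ∈ X, ∀ b ∈ M.E, b ∉ X → M.SameClass a b → a ∉ C →
        M.IsBase (insert b (X.erase a) : Finset α) := by
  by_cases hex : ∃ X F e f, M.ExchangeCut X F e f
  · obtain ⟨X₀, F₀, e₀, f₀, h₀⟩ := hex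
    refine ⟨M.classFinset e₀, (X₀ ∩ M.classFinset e₀).card,
      {H | ∃ X F e f, M.ExchangeCut X F e f ∧ H = F ∩ M.classFinset e₀}, M.natRk, ?_, ?_, ?_⟩
    · refine ⟨fun X hX => card_inter_classFinset hX h₀.base e₀, ?_, ?_, ?_, ?_⟩
      · rintro _ ⟨X, F, e, f, -, rfl⟩
        exact Finset.inter_subset_right
      · intro X hX H _
        exact card_inter_le_natRk hX H
      · rintro _ ⟨X, F, e, f, h, rfl⟩ _ ⟨Y, G, e', f', h', rfl⟩ hne
        have hC : M.classFinset e = M.classFinset e₀ := by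
          have hee := ExchangeCut.sameClass_of_isSplit hM h₀ h
          ext b
          rw [mem_classFinset, mem_classFinset]
          exact and_congr_right fun _ => ⟨fun hb => hb.trans hee, fun hb => hb.trans hee.symm⟩
        have := h.card_inter_add_le hM h' (fun hFG => hne (by rw [hFG]))
        rwa [hC, card_inter_classFinset h.base h₀.base e₀] at this
      · intro X hX e heX heC f hfC hfX hbad
        rw [mem_classFinset] at heC hfC
        obtain ⟨F, h⟩ := exists_exchangeCut hX heX hfC.1 hfX hbad (heC.2.trans hfC.2.symm)
        exact ⟨_, ⟨X, F, e, f, h, rfl⟩, (h.natRk_inter_classFinset e₀).symm,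
          Finset.mem_inter.2 ⟨h.f_mem, mem_classFinset.2 hfC⟩,
          fun hh => h.e_notMem (Finset.mem_inter.1 hh).1⟩
    · intro a _ a' ha' haa' ha
      exact mem_classFinset.2 ⟨ha', haa'.symm.trans (mem_classFinset.1 ha).2⟩
    · intro X hX a ha b hb hbX hab haC
      by_contra hbad
      obtain ⟨F, h⟩ := exists_exchangeCut hX ha hb hbX hbad hab
      exact haC (mem_classFinset.2 ⟨hX.subset_ground ha, ExchangeCut.sameClass_of_isSplit hM h₀ h⟩)
  -- Without any cut, all exchanges inside classes succeed and `C` may be empty.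
  · refine ⟨∅, 0, ∅, fun _ => 0, ⟨by simp, by simp, by simp, by simp, by simp⟩, by simp, ?_⟩
    intro X hX a ha b hb hbX hab _
    by_contra hbad
    obtain ⟨F, h⟩ := exists_exchangeCut hX ha hb hbX hbad hab
    exact hex ⟨X, F, a, b, h⟩

end Matroid

/-! ### Reduction to one component, paving matroids and the theorem. -/

namespace Matroid

variable {α : Type*} [DecidableEq α] {M : Matroid α} [M.Finite]
  {C X X₁ X₂ B₁ B₂ : Finset α} {e e' f p : α}

/-- Bases meet a class in equally many elements, so `P` and `Q` do too. -/
lemma ExchangePair.exists_sameClass (h : ExchangePair M C X₁ X₂ B₁ B₂) (hp : p ∈ X₁ \ B₁) :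
    ∃ q ∈ X₂ \ B₂, M.SameClass p q := by
  have h1 := card_inter_add_card_sdiff_inter X₁ B₁ (M.classFinset p)
  rw [card_inter_classFinset h.base₁ h.target₁ p, ← h.sdiff₂] at h1
  have h2 : 0 < ((X₁ \ B₁) ∩ M.classFinset p).card :=
    Finset.card_pos.2 ⟨p, Finset.mem_inter.2 ⟨hp, Matroid.mem_classFinset.2
      ⟨h.base₁.subset_ground (h.mem_left hp).1, SameClass.refl M p⟩⟩⟩
  obtain ⟨q, hq⟩ := Finset.card_pos.1 (show 0 < ((X₂ \ B₂) ∩ M.classFinset p).card by omega)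
  rw [Finset.mem_inter, Matroid.mem_classFinset] at hq
  exact ⟨q, hq.1, hq.2.2.symm⟩

/-- Elements outside `C` can be exchanged first, if `C` is a union of classes outside of which
any two elements in the same class can be exchanged. -/
lemma ExchangePair.hasStrictlyMonotoneSeq_add {D : Finset α} {m d : ℕ}
    (hC : ∀ a ∈ M.E, ∀ a' ∈ M.E, M.SameClass a a' → a ∈ C → a' ∈ C)
    (hex : ∀ X : Finset α, M.IsBase X → ∀ a ∈ X, ∀ b ∈ M.E, b ∉ X → M.SameClass a b → a ∉ C →
      M.IsBase (insert b (X.erase a) : Finset α))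
    (hseq : ∀ X₁ X₂, ExchangePair M C X₁ X₂ B₁ B₂ → (X₁ ∩ B₁ ∩ C).card = d →
      M.HasStrictlyMonotoneSeq (X₁, X₂) (B₁, B₂) m) :
    ∀ (n : ℕ) (X₁ X₂ : Finset α), ExchangePair M D X₁ X₂ B₁ B₂ → (X₁ ∩ B₁ ∩ C).card = d →
      ((X₁ \ B₁) \ C).card = n → M.HasStrictlyMonotoneSeq (X₁, X₂) (B₁, B₂) (m + n)
  | 0, X₁, X₂, h, hd, hn => by
    have hP : X₁ \ B₁ ⊆ C := Finset.sdiff_eq_empty_iff_subset.1 (Finset.card_eq_zero.1 hn)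
    refine hseq X₁ X₂ ⟨h.base₁, h.base₂, h.target₁, h.target₂, h.sdiff₁, h.sdiff₂, hP,
      fun q hq => ?_⟩ hd
    obtain ⟨p, hp, hqp⟩ := h.symm.exists_sameClass hq
    exact hC p (h.base₁.subset_ground (h.mem_left hp).1) q
      (h.base₂.subset_ground (h.symm.mem_left hq).1) hqp.symm (hP hp)
  | n + 1, X₁, X₂, h, hd, hn => by
    obtain ⟨p, hp⟩ := Finset.card_pos.1 (show 0 < ((X₁ \ B₁) \ C).card by omega)
    obtain ⟨hp, hpC⟩ := Finset.mem_sdiff.1 hp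
    obtain ⟨q, hq, hpq⟩ := h.exists_sameClass hp
    have mp := h.mem_left hp
    have mq := h.symm.mem_left hq
    have pE := h.base₁.subset_ground mp.1
    have qE := h.base₂.subset_ground mq.1
    have hqC : q ∉ C := fun hqC => hpC (hC q qE p pE hpq.symm hqC)
    have b₁ := hex X₁ h.base₁ p mp.1 q qE mq.2.2.1 hpq hpC
    have b₂ := hex X₂ h.base₂ q mq.1 p pE mp.2.2.1 hpq.symm hqC
    refine h.hasStrictlyMonotoneSeq_cons hp hq b₁ b₂
      (hasStrictlyMonotoneSeq_add hC hex hseq n _ _ (h.exchange hp hq b₁ b₂) ?_ ?_)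
    · rw [← hd]
      congr 1
      ext a
      simp only [Finset.mem_inter, Finset.mem_insert, Finset.mem_erase]
      grind
    · rw [h.exchange_sdiff hp hq, Finset.erase_sdiff_comm,
        Finset.card_erase_of_mem (Finset.mem_sdiff.2 ⟨hp, hpC⟩), hn, Nat.add_sub_cancel]

omit [M.Finite] in
-- Both sides equal `|X₁ \ B₁|` plus the sizes of `X₁ ∩ B₁` and `X₁ ∩ B₁ ∩ C`. This converts the
-- bound inside `C` plus the free exchanges outside `C` into a bound in terms of the rank.
lemma ExchangePair.card_sdiff_sdiff_add {𝓗 : Set (Finset α)} {b : Finset α → ℕ} {ρ : ℕ}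
    {D : Finset α} (hS : SplitSystem M C ρ 𝓗 b) (h : ExchangePair M D X₁ X₂ B₁ B₂) :
    ((X₁ \ B₁) \ C).card + ρ + (X₁ ∩ B₁).card = X₁.card + (X₁ ∩ B₁ ∩ C).card := by
  have h1 := hS.card_inter X₁ h.base₁
  have h2 := card_inter_eq_sdiff_add X₁ B₁ C
  have h3 := Finset.card_inter_add_card_sdiff (X₁ \ B₁) C
  have h4 := Finset.card_inter_add_card_sdiff X₁ B₁
  omega

lemma IsSplit.hasStrictlyMonotoneSeq {D : Finset α} (hM : M.IsSplit)
    (h : ExchangePair M D X₁ X₂ B₁ B₂) :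
    M.HasStrictlyMonotoneSeq (X₁, X₂) (B₁, B₂) (X₁.card - 3 * (X₁ ∩ B₁).card) := by
  obtain ⟨C, ρ, 𝓗, b, hS, hC, hex⟩ := hM.exists_splitSystem
  refine (ExchangePair.hasStrictlyMonotoneSeq_add (m := ρ - 3 * (X₁ ∩ B₁ ∩ C).card) hC hex
    (fun Y₁ Y₂ hY hd => ?_) _ X₁ X₂ h rfl rfl).mono ?_
  · exact hd ▸ hY.hasStrictlyMonotoneSeq hS
  · have h1 := h.card_sdiff_sdiff_add hS
    have h2 : (X₁ ∩ B₁ ∩ C).card ≤ (X₁ ∩ B₁).card := Finset.card_le_card Finset.inter_subset_left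
    omega

lemma IsSplit.hasStrictlyMonotoneSeq_of_isBaseOrderable {D : Finset α} (hM : M.IsSplit)
    (hM' : M.IsBaseOrderable) (h : ExchangePair M D X₁ X₂ B₁ B₂) :
    M.HasStrictlyMonotoneSeq (X₁, X₂) (B₁, B₂) (X₁.card - 2 * (X₁ ∩ B₁).card) := by
  obtain ⟨C, ρ, 𝓗, b, hS, hC, hex⟩ := hM.exists_splitSystem
  refine (ExchangePair.hasStrictlyMonotoneSeq_add (m := ρ - 2 * (X₁ ∩ B₁ ∩ C).card) hC hex
    (fun Y₁ Y₂ hY hd => ?_) _ X₁ X₂ h rfl rfl).mono ?_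
  · exact hd ▸ hY.hasStrictlyMonotoneSeq_of_isBaseOrderable hS hM'
  · have h1 := h.card_sdiff_sdiff_add hS
    have h2 : (X₁ ∩ B₁ ∩ C).card ≤ (X₁ ∩ B₁).card := Finset.card_le_card Finset.inter_subset_left
    omega

omit [M.Finite] in
/-- In a paving matroid, at most one element of a base is not exchangeable for a given one. -/
lemma IsPaving.isBase_or_isBase (hM : M.IsPaving) (hX : M.IsBase X) (he : e ∈ X) (he' : e' ∈ X)
    (hne : e ≠ e') (hf : f ∈ M.E) (hfX : f ∉ X) :
    M.IsBase (insert f (X.erase e) : Finset α) ∨ M.IsBase (insert f (X.erase e') : Finset α) := by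
  set T : Finset α := insert f ((X.erase e).erase e') with hT
  have hfT : f ∉ (X.erase e).erase e' := by simp [hfX]
  have he'X : e' ∈ X.erase e := Finset.mem_erase.2 ⟨hne.symm, he'⟩
  have cT : T.card + 1 = X.card := by
    rw [hT, Finset.card_insert_of_notMem hfT, Finset.card_erase_of_mem he'X,
      Finset.card_erase_of_mem he]
    have := Finset.card_pos.2 ⟨e', he'X⟩
    rw [Finset.card_erase_of_mem he] at this
    omega
  have iT : M.Indep (T : Set α) := by
    refine hM _ ?_ ?_
    · intro a ha
      simp only [hT, Finset.coe_insert, Finset.coe_erase] at ha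
      rcases ha with rfl | ha
      · exact hf
      · exact hX.subset_ground ha.1.1
    · rw [← hX.encard_eq_eRank, Set.encard_coe_eq_coe_finsetCard,
        Set.encard_coe_eq_coe_finsetCard]
      exact_mod_cast (by omega : T.card < X.card)
  have hTX : (T : Set α).encard < (X : Set α).encard := by
    rw [Set.encard_coe_eq_coe_finsetCard, Set.encard_coe_eq_coe_finsetCard]
    exact_mod_cast (by omega : T.card < X.card)
  obtain ⟨a, ha, hi⟩ := iT.augment hX.indep hTX
  have key (Y : Finset α) (hY : (insert a T : Finset α) = Y) : M.IsBase (Y : Set α) := by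
    subst hY
    rw [← Finset.coe_insert] at hi
    refine hi.isBase_of_eRk_ge (Finset.finite_toSet _) ?_
    rw [← hX.encard_eq_eRank, hi.eRk_eq_encard, Set.encard_coe_eq_coe_finsetCard,
      Set.encard_coe_eq_coe_finsetCard, Finset.card_insert_of_notMem (by simpa using ha.2), cT]
  have haX : a ∈ X := ha.1
  have haT : a ∉ T := by simpa using ha.2
  have ha2 : a = e ∨ a = e' := by
    by_contra hh
    push Not at hh
    exact haT (by simp [hT, hh, haX])
  rcases ha2 with rfl | rfl
  · right
    apply key
    ext c
    simp only [hT, Finset.mem_insert, Finset.mem_erase]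
    grind
  · left
    apply key
    ext c
    simp only [hT, Finset.mem_insert, Finset.mem_erase]
    grind

omit [M.Finite] in
-- Fix two elements of `Q`. Each `e ∈ P` can replace one of them in `X₂`, so without an exchange
-- that one cannot replace `e` in `X₁`. Among three elements of `P` two then fail with the same
-- element of `Q`, against `isBase_or_isBase`.
lemma IsPaving.exists_exchange {D : Finset α} (hM : M.IsPaving)
    (h : ExchangePair M D X₁ X₂ B₁ B₂) (hP : 2 < (X₁ \ B₁).card) (hQ : 1 < (X₂ \ B₂).card) :
    ∃ e ∈ X₁ \ B₁, ∃ f ∈ X₂ \ B₂, M.IsBase (insert f (X₁.erase e) : Finset α) ∧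
      M.IsBase (insert e (X₂.erase f) : Finset α) := by
  by_contra! hno
  obtain ⟨f₁, hf₁, f₂, hf₂, hf⟩ := Finset.one_lt_card.1 hQ
  have m₁ := h.symm.mem_left hf₁
  have m₂ := h.symm.mem_left hf₂
  have hX₁ {e e' f : α} (he : e ∈ X₁ \ B₁) (he' : e' ∈ X₁ \ B₁) (hne : e ≠ e')
      (hf : f ∈ X₂ \ B₂) := hM.isBase_or_isBase h.base₁ (h.mem_left he).1 (h.mem_left he').1 hne
        (h.base₂.subset_ground (h.symm.mem_left hf).1) (h.symm.mem_left hf).2.2.1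
  have hX₂ {e : α} (he : e ∈ X₁ \ B₁) := hM.isBase_or_isBase h.base₂ m₁.1 m₂.1 hf
    (h.base₁.subset_ground (h.mem_left he).1) (h.mem_left he).2.2.1
  obtain ⟨e₁, he₁, e₂, he₂, e₃, he₃, h12, h13, h23⟩ := Finset.two_lt_card.1 hP
  have key {e : α} (he : e ∈ X₁ \ B₁) : ¬ M.IsBase (insert f₁ (X₁.erase e) : Finset α) ∨
      ¬ M.IsBase (insert f₂ (X₁.erase e) : Finset α) :=
    (hX₂ he).imp (fun h₂ h₁ => hno e he f₁ hf₁ h₁ h₂) (fun h₂ h₁ => hno e he f₂ hf₂ h₁ h₂)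
  have no₁ {e e' : α} (he : e ∈ X₁ \ B₁) (he' : e' ∈ X₁ \ B₁) (hne : e ≠ e') {f : α}
      (hf : f ∈ X₂ \ B₂) (h₁ : ¬ M.IsBase (insert f (X₁.erase e) : Finset α))
      (h₂ : ¬ M.IsBase (insert f (X₁.erase e') : Finset α)) : False :=
    (hX₁ he he' hne hf).elim h₁ h₂
  rcases key he₁ with k1 | k1 <;> rcases key he₂ with k2 | k2
  · exact no₁ he₁ he₂ h12 hf₁ k1 k2
  · exact (key he₃).elim (no₁ he₁ he₃ h13 hf₁ k1) (no₁ he₂ he₃ h23 hf₂ k2)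
  · exact (key he₃).elim (no₁ he₂ he₃ h23 hf₁ k2) (no₁ he₁ he₃ h13 hf₂ k1)
  · exact no₁ he₁ he₂ h12 hf₂ k1 k2

omit [M.Finite] in
lemma IsPaving.hasStrictlyMonotoneSeq {D : Finset α} (hM : M.IsPaving) :
    ∀ (n : ℕ) (X₁ X₂ : Finset α), ExchangePair M D X₁ X₂ B₁ B₂ → (X₁ \ B₁).card = n + 2 →
      M.HasStrictlyMonotoneSeq (X₁, X₂) (B₁, B₂) n
  | 0, _, _, _, _ => hasStrictlyMonotoneSeq_zero
  | n + 1, X₁, X₂, h, hn => by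
    have hQ : (X₂ \ B₂).card = (X₁ \ B₁).card := by
      rw [h.sdiff₂]
      refine Finset.card_sdiff_comm ?_
      have := h.base₁.encard_eq_encard_of_isBase h.target₁
      rw [Set.encard_coe_eq_coe_finsetCard, Set.encard_coe_eq_coe_finsetCard] at this
      exact_mod_cast this.symm
    obtain ⟨e, he, f, hf, b₁, b₂⟩ := hM.exists_exchange h (by omega) (by omega)
    refine h.hasStrictlyMonotoneSeq_cons he hf b₁ b₂
      (hasStrictlyMonotoneSeq hM n _ _ (h.exchange he hf b₁ b₂) ?_)
    rw [h.exchange_sdiff he hf, Finset.card_erase_of_mem he, hn]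
    rfl

omit [M.Finite] in
-- The union is only a container for `P` and `Q`; the set `C` of the split system enters after the
-- elements outside it have been exchanged.
lemma CompatiblePairs.exchangePair
    (h : M.CompatiblePairs ((X₁ : Set α), (X₂ : Set α)) ((B₁ : Set α), (B₂ : Set α))) :
    ExchangePair M (X₁ ∪ X₂) X₁ X₂ B₁ B₂ := by
  obtain ⟨h1, h2, h3, h4, h5, h6⟩ := h
  dsimp only at h1 h2 h3 h4 h5 h6
  have key (a : α) : (a ∈ X₁ ∧ a ∈ X₂ ↔ a ∈ B₁ ∧ a ∈ B₂) ∧ (a ∈ X₁ ∨ a ∈ X₂ ↔ a ∈ B₁ ∨ a ∈ B₂) :=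
    ⟨Set.ext_iff.1 h5 a, Set.ext_iff.1 h6 a⟩
  refine ⟨h1, h2, h3, h4, ?_, ?_, Finset.sdiff_subset.trans Finset.subset_union_left,
    Finset.sdiff_subset.trans Finset.subset_union_right⟩ <;>
  · ext a
    have := key a
    simp only [Finset.mem_sdiff]
    tauto

end Matroid

theorem theorem4p2 {α : Type*} (M : Matroid α) [M.Finite] (r : ℕ) (hr : M.eRank = r)
    (A₁ A₂ B₁ B₂ : Set α) (hAB : M.CompatiblePairs (A₁, A₂) (B₁, B₂)) :
    (M.IsSplit →
      M.HasStrictlyMonotoneSeq (A₁, A₂) (B₁, B₂) (r - 3 * (A₁ ∩ B₁).ncard)) ∧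
    (M.IsBaseOrderable → M.IsSplit →
      M.HasStrictlyMonotoneSeq (A₁, A₂) (B₁, B₂) (r - 2 * (A₁ ∩ B₁).ncard)) ∧
    (M.IsPaving →
      M.HasStrictlyMonotoneSeq (A₁, A₂) (B₁, B₂) (r - (A₁ ∩ B₁).ncard - 2)) := by
  classical
  lift A₁ to Finset α using M.set_finite A₁ hAB.1.subset_ground
  lift A₂ to Finset α using M.set_finite A₂ hAB.2.1.subset_ground
  lift B₁ to Finset α using M.set_finite B₁ hAB.2.2.1.subset_ground
  lift B₂ to Finset α using M.set_finite B₂ hAB.2.2.2.1.subset_ground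
  have h := hAB.exchangePair
  have hA : A₁.card = r := by
    have := h.base₁.encard_eq_eRank
    rw [hr, Set.encard_coe_eq_coe_finsetCard] at this
    exact_mod_cast this
  rw [← Finset.coe_inter, Set.ncard_coe_finset, ← hA]
  refine ⟨fun hM => hM.hasStrictlyMonotoneSeq h,
    fun hM' hM => hM.hasStrictlyMonotoneSeq_of_isBaseOrderable hM' h, fun hM => ?_⟩
  rcases Nat.lt_or_ge (A₁ \ B₁).card 2 with hlt | hge
  · have := Finset.card_inter_add_card_sdiff A₁ B₁
    rw [show A₁.card - (A₁ ∩ B₁).card - 2 = 0 by omega]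
    exact Matroid.hasStrictlyMonotoneSeq_zero
  · have := Finset.card_inter_add_card_sdiff A₁ B₁
    exact hM.hasStrictlyMonotoneSeq _ A₁ A₂ h (by omega)
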